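/- **Setting.** Let $N\in\mathbb N$ and let $2\le q\le p<N$ be real; for $m\in\{p,q\}$ put $m^*=Nm/(N-m)$ and $D^{1,m}(\mathbb R^N)=\{u\in L^{m^*}(\mathbb R^N): \nabla u\in L^m(\mathbb R^N)\}$ (weak gradient). Let $f:\mathbb R\to[0,\infty)$ be continuous with $f(t)=0$ for $t\le 0$, $\limsup_{s\to0^+}sf(s)/s^{p^*}<\infty$, $\limsup_{s\to+\infty}sf(s)/s^{\tau}=0$ for some $\tau\in(p,p^*)$, and $0\le\theta F(s)\le sf(s)$ for all $s>0$, where $\theta>p$ and $F(s)=\int_0^sf(t)\,dt$. Let $a,b:\mathbb R^N\to[0,\infty)$ be continuous with $a\in L^{N/p}(\mathbb R^N)$, $b\in L^{N/q}(\mathbb R^N)$, with $a\le a_\infty$ and $b\le b_\infty$ on the unit ball $B_1(0)$ for positive constants $a_\infty,b_\infty$, and with $R_0^{-p^2/(p-1)}\inf_{|x|\ge R_0}|x|^{p^2/(p-1)}a(x)\ge\Lambda$ for constants $\Lambda>0$ and $R_0>1$. Put $k=\theta p/(\theta-p)$. For $R>1$ let $g(x,t)=f(t)$ if $|x|\le R$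 or $f(t)\le\frac{a(x)}k|t|^{p-2}t$, and $g(x,t)=\frac{a(x)}k|t|^{p-2}t$ otherwise; let $G(x,t)=\int_0^tg(x,s)\,ds$. The penalized auxiliary problem is $$-\Delta_pu-\Delta_qu+a(x)|u|^{p-2}u+b(x)|u|^{q-2}u=g(x,u)\quad\text{in }\mathbb R^N,\qquad u>0 .$$ Let $E$ be the space of all $u\in D^{1,p}(\mathbb R^N)\cap D^{1,q}(\mathbb R^N)$ with $\int a|u|^p<\infty$ and $\int b|u|^q<\infty$, with the norm $\|u\|=\big(\int|\nabla u|^p+\int a|u|^p\big)^{1/p}+\big(\int|\nabla u|^q+\int b|u|^q\big)^{1/q}$, and on $E$ let $$J(u)=\tfrac1p\int\big(|\nabla u|^p+a|u|^p\big)+\tfrac1q\int\big(|\nabla u|^q+b|u|^q\big)-\int G(x,u)\,dx .$$ Let $X_0=D_0^{1,p}(B_1(0))\cap D_0^{1,q}(B_1(0))$, its elements being extended by zero, let $X$ be any set of functions with $X_0\subseteq X\subseteq E$ (for instance $X=X_0$ or $X=E$), and let $e_1\in X_0$ with $J(e_1)<0$. The mountain-pass level is $c=\inf_{\gamma\in\Gamma}\max_{t\in[0,1]}J(\gamma(t))$,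 where $\Gamma$ is the set of all continuous $\gamma:[0,1]\to X$ (for the norm of $E$) with $\gamma(0)=0$ and $\gamma(1)=e_1$. A *positive ground state solution* of the auxiliary problem is a function $u\in E$ with $u>0$ almost everywhere, $J'(u)=0$ (that is, $u$ satisfies the weak form of the equation for all test functions in $E$) and $J(u)=c$. **Lemma 3.4.** There is a constant $M_2>0$, depending only on $N,p,q,\theta,\tau,f,a_\infty,b_\infty$ and in particular not on $R$ (nor on $R_0$, $\Lambda$, $X$, $e_1$, $u$, nor on $a,b$ otherwise), such that whenever $R_0\ge R>1$, every positive ground state solution $u$ of the auxiliary problem satisfies $\|u\|_{L^\infty(\mathbb R^N)}\le M_2$ and $$u(x)\le M_2\,\Big(\frac{R}{|x|}\Big)^{(N-p)/(p-1)}\qquad\text{for almost every }x\text{ with }|x|\ge R .$$ -/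

import Mathlib

open MeasureTheory Filter Topology Set
open scoped ENNReal ContDiff

noncomputable section

namespace PQLaplace

/-- The space `ℝ^N` with its Euclidean norm. -/
abbrev RN (N : ℕ) : Type := EuclideanSpace ℝ (Fin N)

/-- The locally integrable field `G` is the distributional gradient of the locally integrable
function `u` on `ℝ^N`. -/
def HasWeakGradient {N : ℕ} (u : RN N → ℝ) (G : RN N → RN N) : Prop :=
  LocallyIntegrable u volume ∧ LocallyIntegrable G volume ∧
    ∀ φ : RN N → ℝ, ContDiff ℝ ∞ φ → HasCompactSupport φ → ∀ e : RN N,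
      ∫ x, u x * fderiv ℝ φ x e = -∫ x, inner ℝ (G x) e * φ x

open Classical in
/-- The weak gradient `∇u` (unique up to a null set where it exists, and `0` if there is none). -/
def weakGrad {N : ℕ} (u : RN N → ℝ) : RN N → RN N :=
  if h : ∃ G, HasWeakGradient u G then h.choose else 0

/-- The critical Sobolev exponent `m* = N m / (N - m)`. -/
def critExp (N : ℕ) (m : ℝ) : ℝ := N * m / (N - m)

/-- `D^{1,m}(ℝ^N)`: functions in `L^{m*}` all of whose weak first derivatives are in `L^m`. -/
def MemD {N : ℕ} (m : ℝ) (u : RN N → ℝ) : Prop :=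
  MemLp u (ENNReal.ofReal (critExp N m)) volume ∧
    ∃ G, HasWeakGradient u G ∧ MemLp G (ENNReal.ofReal m) volume

/-- The space `E` of all `u ∈ D^{1,p} ∩ D^{1,q}` with `∫ a |u|^p < ∞` and `∫ b |u|^q < ∞`. -/
def spaceE {N : ℕ} (p q : ℝ) (a b : RN N → ℝ) : Set (RN N → ℝ) :=
  {u | MemD p u ∧ MemD q u ∧
    Integrable (fun x => a x * |u x| ^ p) volume ∧ Integrable (fun x => b x * |u x| ^ q) volume}

/-- `D_0^{1,p}(B_1(0)) ∩ D_0^{1,q}(B_1(0))`, its elements being extended by zero to `ℝ^N`. -/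
def spaceBall {N : ℕ} (p q : ℝ) : Set (RN N → ℝ) :=
  {u | MemD p u ∧ MemD q u ∧ ∀ᵐ x, x ∉ Metric.ball (0 : RN N) 1 → u x = 0}

/-- `‖u‖_{1,m} = (∫ |∇u|^m + ∫ V |u|^m)^{1/m}`. -/
def norm1 {N : ℕ} (m : ℝ) (V : RN N → ℝ) (u : RN N → ℝ) : ℝ :=
  ((∫ x, ‖weakGrad u x‖ ^ m) + ∫ x, V x * |u x| ^ m) ^ (1 / m)

/-- The norm of `E`. -/
def normE {N : ℕ} (p q : ℝ) (a b : RN N → ℝ) (u : RN N → ℝ) : ℝ :=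
  norm1 p a u + norm1 q b u

/-- The primitive `F(s) = ∫_0^s f(t) dt`. -/
def primF (f : ℝ → ℝ) (s : ℝ) : ℝ := ∫ t in (0 : ℝ)..s, f t

/-- The hypotheses on the nonlinearity `f`. -/
structure NonlinearityHyp (N : ℕ) (p θ τ : ℝ) (f : ℝ → ℝ) : Prop where
  continuous : Continuous f
  nonneg : ∀ t, 0 ≤ f t
  /-- at most critical growth at the origin -/
  f1 : limsup (fun s : ℝ => ((s * f s / s ^ critExp N p : ℝ) : EReal)) (𝓝[>] 0) < ⊤
  /-- subcritical growth at infinity -/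
  p_lt_τ : p < τ
  τ_lt : τ < critExp N p
  f2 : limsup (fun s : ℝ => ((s * f s / s ^ τ : ℝ) : EReal)) atTop = 0
  /-- the Ambrosetti-Rabinowitz condition -/
  p_lt_θ : p < θ
  f3 : ∀ s : ℝ, 0 < s → 0 ≤ θ * primF f s ∧ θ * primF f s ≤ s * f s
  f4 : ∀ t : ℝ, t ≤ 0 → f t = 0

/-- The hypotheses on the potentials `a` and `b`. -/
structure PotentialHyp {N : ℕ} (p q aInf bInf Lam R₀ : ℝ) (a b : RN N → ℝ) : Prop where
  continuous_a : Continuous a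
  continuous_b : Continuous b
  nonneg_a : ∀ x, 0 ≤ a x
  nonneg_b : ∀ x, 0 ≤ b x
  memLp_a : MemLp a (ENNReal.ofReal (N / p)) volume
  memLp_b : MemLp b (ENNReal.ofReal (N / q)) volume
  a_le : ∀ x ∈ Metric.ball (0 : RN N) 1, a x ≤ aInf
  b_le : ∀ x ∈ Metric.ball (0 : RN N) 1, b x ≤ bInf
  Lam_pos : 0 < Lam
  one_lt_R₀ : 1 < R₀
  le_a : ∀ x : RN N, R₀ ≤ ‖x‖ →
    Lam ≤ 1 / R₀ ^ (p ^ 2 / (p - 1)) * (‖x‖ ^ (p ^ 2 / (p - 1)) * a x)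

open Classical in
/-- The penalized nonlinearity `g(x,t)`, with `k = θ p / (θ - p)`. -/
def penal {N : ℕ} (p θ R : ℝ) (f : ℝ → ℝ) (a : RN N → ℝ) (x : RN N) (t : ℝ) : ℝ :=
  if ‖x‖ ≤ R ∨ f t ≤ a x / (θ * p / (θ - p)) * (|t| ^ (p - 2) * t) then f t
  else a x / (θ * p / (θ - p)) * (|t| ^ (p - 2) * t)

/-- The energy functional `J` of the auxiliary problem, with `G(x,t) = ∫_0^t g(x,s) ds`. -/
def energyJ {N : ℕ} (p q θ R : ℝ) (f : ℝ → ℝ) (a b : RN N → ℝ) (u : RN N → ℝ) : ℝ :=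
  1 / p * (∫ x, ‖weakGrad u x‖ ^ p) + 1 / p * (∫ x, a x * |u x| ^ p)
    + 1 / q * (∫ x, ‖weakGrad u x‖ ^ q) + 1 / q * (∫ x, b x * |u x| ^ q)
    - ∫ x, ∫ s in (0 : ℝ)..(u x), penal p θ R f a x s

/-- The derivative `J'(u)v`. -/
def derivJ {N : ℕ} (p q θ R : ℝ) (f : ℝ → ℝ) (a b : RN N → ℝ) (u v : RN N → ℝ) : ℝ :=
  (∫ x, ‖weakGrad u x‖ ^ (p - 2) * inner ℝ (weakGrad u x) (weakGrad v x))
    + (∫ x, a x * (|u x| ^ (p - 2) * u x * v x))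
    + (∫ x, ‖weakGrad u x‖ ^ (q - 2) * inner ℝ (weakGrad u x) (weakGrad v x))
    + (∫ x, b x * (|u x| ^ (q - 2) * u x * v x))
    - ∫ x, penal p θ R f a x (u x) * v x

/-- `Γ`: the paths `γ : [0,1] → X`, continuous for the norm of `E`, from `0` to `e`. -/
def paths {N : ℕ} (p q : ℝ) (a b : RN N → ℝ) (X : Set (RN N → ℝ)) (e : RN N → ℝ) :
    Set (ℝ → RN N → ℝ) :=
  {γ | (∀ t ∈ Icc (0 : ℝ) 1, γ t ∈ X) ∧
    (∀ t ∈ Icc (0 : ℝ) 1,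
      Tendsto (fun s => normE p q a b (γ s - γ t)) (𝓝[Icc 0 1] t) (𝓝 0)) ∧
    γ 0 =ᵐ[volume] 0 ∧ γ 1 =ᵐ[volume] e}

/-- The mountain-pass level `c = inf_{γ ∈ Γ} max_{t ∈ [0,1]} J(γ(t))`. -/
def mpLevel {N : ℕ} (p q θ R : ℝ) (f : ℝ → ℝ) (a b : RN N → ℝ) (X : Set (RN N → ℝ))
    (e : RN N → ℝ) : ℝ :=
  sInf ((fun γ : ℝ → RN N → ℝ =>
    sSup ((fun t => energyJ p q θ R f a b (γ t)) '' Icc (0 : ℝ) 1)) '' paths p q a b X e)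

/-- `u` is a positive ground state solution of the auxiliary problem: a positive function in `E`
with `J'(u) = 0` whose energy `J(u)` is the mountain-pass level. -/
structure IsPositiveGroundState {N : ℕ} (p q θ R : ℝ) (f : ℝ → ℝ) (a b : RN N → ℝ)
    (X : Set (RN N → ℝ)) (e u : RN N → ℝ) : Prop where
  mem : u ∈ spaceE p q a b
  pos : ∀ᵐ x, 0 < u x
  critical : ∀ v ∈ spaceE p q a b, derivJ p q θ R f a b u v = 0
  level : energyJ p q θ R f a b u = mpLevel p q θ R f a b X e

end PQLaplace

end

/-! The constant arises from an energy bound, an iteration and a comparison, none of which sees `R`.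

Energy. The penalization acts only where |x| > R > 1, so on functions supported in the unit ball J
is the unpenalized functional (`energyJ_of_mem_spaceBall`). A fixed bump v in that ball makes J
bounded on the ray {cv : c ≥ 0} by a number C₀ built from `aInf`, `bInf` and f, because F grows at
least like s^θ with θ > p ≥ q. The endpoint e is arbitrary, and the segment from 0 to e could have
large energy. The path used instead runs from 0 to Tv, then to Te, then back to e: the second leg
has nonpositive energy for large T, since v and e are bounded below on a common set of positive
measure, and J(de) ≤ 0 for d ≥ 1. Hence c ≤ C₀ although T depends on e, a and b
(`exists_mpLevel_le`).

Boundedness. The functional J(u) - J'(u)u/θ dominates (1/p - 1/θ)∫|∇u|^p, because the part of g that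
violates the Ambrosetti-Rabinowitz inequality is paid for by a|u|^p (`grad_energy_le`). With this
bound, De Giorgi truncation at levels M(1 - 2^{-n}), the Sobolev inequality and the growth f(s) ≤ C
s^{τ-1}, τ < p*, give u ≤ M almost everywhere. Subcriticality produces a negative power of M in the
recursion, so a large M makes it contract (`exists_sup_bound`).

Decay. For |x| > R one has g(x,u) ≤ a u^{p-1}, since k ≥ 1, so there -Δ_p u - Δ_q u ≤ 0. The
function M(R/|x|)^α with α = (N-p)/(p-1) is p-harmonic away from 0, and q-superharmonic because q ≤
p. It equals M on the sphere of radius R, so strict monotonicity of the p-Laplacian and the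
comparison principle put it above u, first up to an ε that gives the test function a support of
finite measure (`le_barrier_add`, `le_decay`).

Weak gradients are purely distributional here, so mollification, the chain rule, positive parts and
the Sobolev inequality on D^{1,m} are derived as well. -/

noncomputable section

namespace PQLaplace

open scoped Convolution NNReal

/-! ### Weak gradients: uniqueness, linearity, smooth functions. -/

variable {N : ℕ}

theorem HasWeakGradient.ae_unique {u : RN N → ℝ} {G G' : RN N → RN N}
    (h : HasWeakGradient u G) (h' : HasWeakGradient u G') : G =ᵐ[volume] G' := by
  refine ae_eq_of_integral_contDiff_smul_eq h.2.1 h'.2.1 fun φ hφ hc => ?_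
  have i1 : Integrable (fun x => φ x • G x) :=
    h.2.1.integrable_smul_left_of_hasCompactSupport hφ.continuous hc
  have i2 : Integrable (fun x => φ x • G' x) :=
    h'.2.1.integrable_smul_left_of_hasCompactSupport hφ.continuous hc
  refine ext_inner_left ℝ fun e => ?_
  rw [← integral_inner i1, ← integral_inner i2]
  have e1 := h.2.2 φ hφ hc e
  rw [h'.2.2 φ hφ hc e, neg_inj] at e1
  simp only [real_inner_comm _ e, real_inner_smul_left]
  simpa [mul_comm] using e1.symm

theorem HasWeakGradient.congr {u v : RN N → ℝ} {G H : RN N → RN N}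
    (h : HasWeakGradient u G) (huv : u =ᵐ[volume] v) (hGH : G =ᵐ[volume] H) :
    HasWeakGradient v H := by
  refine ⟨h.1.congr huv, h.2.1.congr hGH, fun φ hφ hc e => ?_⟩
  have := h.2.2 φ hφ hc e
  rw [integral_congr_ae (g := fun x => v x * fderiv ℝ φ x e)
    (by filter_upwards [huv] with x hx; rw [hx]),
    integral_congr_ae (f := fun x => inner ℝ (G x) e * φ x) (g := fun x => inner ℝ (H x) e * φ x)
    (by filter_upwards [hGH] with x hx; rw [hx])] at this
  exact this

theorem HasWeakGradient.weakGrad_ae_eq {u : RN N → ℝ} {G : RN N → RN N}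
    (h : HasWeakGradient u G) : weakGrad u =ᵐ[volume] G := by
  have hex : ∃ G, HasWeakGradient u G := ⟨G, h⟩
  have : weakGrad u = hex.choose := by simp only [weakGrad, dif_pos hex]
  rw [this]
  exact hex.choose_spec.ae_unique h

theorem HasWeakGradient.inner_integrable {u : RN N → ℝ} {G : RN N → RN N}
    (h : HasWeakGradient u G) {φ : RN N → ℝ} (hφ : Continuous φ) (hc : HasCompactSupport φ)
    (e : RN N) : Integrable (fun x => inner ℝ (G x) e * φ x) := by
  have i1 : Integrable (fun x => φ x • G x) :=
    h.2.1.integrable_smul_left_of_hasCompactSupport hφ hc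
  refine (i1.inner_const (𝕜 := ℝ) e).congr (ae_of_all _ fun x => ?_)
  simp [inner_smul_left, mul_comm]

theorem HasWeakGradient.mul_fderiv_integrable {u : RN N → ℝ} {G : RN N → RN N}
    (h : HasWeakGradient u G) {φ : RN N → ℝ} (hφ : ContDiff ℝ ∞ φ) (hc : HasCompactSupport φ)
    (e : RN N) : Integrable (fun x => u x * fderiv ℝ φ x e) := by
  have c1 : Continuous (fun x => fderiv ℝ φ x e) :=
    (hφ.continuous_fderiv (by simp)).clm_apply continuous_const
  have c2 : HasCompactSupport (fun x => fderiv ℝ φ x e) := hc.fderiv_apply ℝ e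
  simpa [mul_comm] using h.1.integrable_smul_left_of_hasCompactSupport c1 c2

theorem HasWeakGradient.linear_comb {u v : RN N → ℝ} {G H : RN N → RN N}
    (hu : HasWeakGradient u G) (hv : HasWeakGradient v H) (c d : ℝ) :
    HasWeakGradient (fun x => c * u x + d * v x) (fun x => c • G x + d • H x) := by
  refine ⟨(hu.1.smul c).add (hv.1.smul d), (hu.2.1.smul c).add (hv.2.1.smul d),
    fun φ hφ hc e => ?_⟩
  have e1 : ∀ x, (c * u x + d * v x) * fderiv ℝ φ x e
      = c * (u x * fderiv ℝ φ x e) + d * (v x * fderiv ℝ φ x e) := fun x => by ring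
  have e2 : ∀ x, inner ℝ (c • G x + d • H x) e * φ x
      = c * (inner ℝ (G x) e * φ x) + d * (inner ℝ (H x) e * φ x) := fun x => by
    rw [inner_add_left, real_inner_smul_left, real_inner_smul_left]; ring
  simp only [e1, e2]
  rw [integral_add ((hu.mul_fderiv_integrable hφ hc e).const_mul c)
      ((hv.mul_fderiv_integrable hφ hc e).const_mul d),
    integral_add ((hu.inner_integrable hφ.continuous hc e).const_mul c)
      ((hv.inner_integrable hφ.continuous hc e).const_mul d)]
  simp only [integral_const_mul]
  rw [hu.2.2 φ hφ hc e, hv.2.2 φ hφ hc e]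
  ring

theorem hasWeakGradient_of_contDiff {u : RN N → ℝ} (hu : ContDiff ℝ 1 u) :
    HasWeakGradient u (gradient u) := by
  have hg : Continuous (gradient u) :=
    (InnerProductSpace.toDual ℝ (RN N)).symm.continuous.comp (hu.continuous_fderiv one_ne_zero)
  refine ⟨hu.continuous.locallyIntegrable, hg.locallyIntegrable, fun φ hφ hc e => ?_⟩
  have hφ1 : Continuous (fun x => fderiv ℝ φ x e) :=
    (hφ.continuous_fderiv (by simp)).clm_apply continuous_const
  have hu1 : Continuous (fun x => fderiv ℝ u x e) :=
    (hu.continuous_fderiv one_ne_zero).clm_apply continuous_const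
  rw [integral_mul_fderiv_eq_neg_fderiv_mul_of_integrable]
  · congr 1
    refine integral_congr_ae (ae_of_all _ fun x => ?_)
    simp [gradient]
  · exact (hu1.mul hφ.continuous).integrable_of_hasCompactSupport hc.mul_left
  · exact (hu.continuous.mul hφ1).integrable_of_hasCompactSupport (hc.fderiv_apply ℝ e).mul_left
  · exact (hu.continuous.mul hφ.continuous).integrable_of_hasCompactSupport hc.mul_left
  · exact fun x _ => hu.differentiable one_ne_zero x
  · exact fun x _ => hφ.differentiable (by simp) x

theorem hasWeakGradient_const (c : ℝ) : HasWeakGradient (fun _ : RN N => c) (fun _ => 0) := by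
  have h := hasWeakGradient_of_contDiff (N := N) (u := fun _ => c) contDiff_const
  refine h.congr .rfl (ae_of_all _ fun x => ?_)
  simp [gradient]

/-! ### Mollification. -/

/-- A sequence of bump functions shrinking to the origin. -/
def bump (N n : ℕ) : ContDiffBump (0 : RN N) where
  rIn := 1 / (2 * ((n : ℝ) + 1))
  rOut := 1 / ((n : ℝ) + 1)
  rIn_pos := by positivity
  rIn_lt_rOut := by
    apply one_div_lt_one_div_of_lt (by positivity)
    have : (0 : ℝ) ≤ n := by positivity
    linarith

theorem bump_rOut_tendsto : Tendsto (fun n => (bump N n).rOut) atTop (𝓝 0) :=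
  tendsto_one_div_add_atTop_nhds_zero_nat

theorem bump_rOut_le_one (n : ℕ) : (bump N n).rOut ≤ 1 := by
  have : (0 : ℝ) ≤ n := by positivity
  simp only [bump]
  rw [div_le_one (by positivity)]
  linarith

/-- Mollification at scale `1 / (n + 1)`. -/
def moll (n : ℕ) (u : RN N → ℝ) : RN N → ℝ :=
  (bump N n).normed volume ⋆[ContinuousLinearMap.lsmul ℝ ℝ, volume] u

theorem moll_apply (n : ℕ) (u : RN N → ℝ) (x : RN N) :
    moll n u x = ∫ t, (bump N n).normed volume t * u (x - t) := by
  simp [moll, convolution_def]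

theorem moll_apply' (n : ℕ) (u : RN N → ℝ) (x : RN N) :
    moll n u x = ∫ t, (bump N n).normed volume (x - t) * u t := by
  simp [moll, convolution_eq_swap]

theorem contDiff_moll (n : ℕ) {u : RN N → ℝ} (hu : LocallyIntegrable u) :
    ContDiff ℝ ∞ (moll n u) :=
  (bump N n).hasCompactSupport_normed.contDiff_convolution_left _ (bump N n).contDiff_normed hu

theorem moll_integrand_integrable (n : ℕ) {u : RN N → ℝ} (hu : LocallyIntegrable u) (x : RN N) :
    Integrable fun t => (bump N n).normed volume t * u (x - t) := by
  have := (bump N n).hasCompactSupport_normed (μ := volume) |>.convolutionExists_left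
    (ContinuousLinearMap.lsmul ℝ ℝ) (bump N n).continuous_normed hu x
  exact this.integrable

theorem moll_tendsto_ae {u : RN N → ℝ} (hu : LocallyIntegrable u) :
    ∀ᵐ x, Tendsto (fun n => moll n u x) atTop (𝓝 (u x)) := by
  -- The outer radius is always twice the inner one; this fixed ratio is what Lebesgue
  -- differentiation requires.
  refine ContDiffBump.ae_convolution_tendsto_right_of_locallyIntegrable (K := 2)
    bump_rOut_tendsto (Eventually.of_forall fun n => ?_) hu
  simp only [bump]
  apply le_of_eq
  field_simp

/-- The derivative falls on the kernel, and t ↦ φ(x - t) is an admissible test function. The sign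
from the reflection cancels the one from integration by parts. -/
theorem fderiv_moll (n : ℕ) {u : RN N → ℝ} {G : RN N → RN N} (h : HasWeakGradient u G)
    (x e : RN N) : fderiv ℝ (moll n u) x e = moll n (fun y => inner ℝ (G y) e) x := by
  set φ := (bump N n).normed volume with hφdef
  have hφ : ContDiff ℝ ∞ φ := (bump N n).contDiff_normed
  have hc : HasCompactSupport φ := (bump N n).hasCompactSupport_normed
  have hd := hc.hasFDerivAt_convolution_right (ContinuousLinearMap.lsmul ℝ ℝ).flip h.1
    (hφ.of_le (by simp)) x
  have e0 : moll n u = (u ⋆[(ContinuousLinearMap.lsmul ℝ ℝ).flip, volume] φ) := by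
    rw [convolution_flip]; rfl
  rw [e0, hd.fderiv, convolution_precompR_apply _ h.1 (hc.fderiv ℝ)
    (hφ.continuous_fderiv (by simp)), moll_apply', convolution_def]
  have hψ : ContDiff ℝ ∞ (fun t => φ (x - t)) := hφ.comp (contDiff_const.sub contDiff_id)
  have hψc : HasCompactSupport (fun t => φ (x - t)) :=
    hc.comp_homeomorph (Homeomorph.subLeft x)
  have key := h.2.2 _ hψ hψc e
  have hder : ∀ t, fderiv ℝ (fun t => φ (x - t)) t e = - fderiv ℝ φ (x - t) e := by
    intro t
    have h1 : HasFDerivAt (fun t => x - t) (-ContinuousLinearMap.id ℝ (RN N)) t := by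
      simpa using (hasFDerivAt_id t).const_sub x
    have h2 : HasFDerivAt φ (fderiv ℝ φ (x - t)) (x - t) :=
      (hφ.differentiable (by simp) _).hasFDerivAt
    have h3 : HasFDerivAt (fun t => φ (x - t)) _ t := h2.comp t h1
    rw [h3.fderiv]
    simp
  simp only [hder, mul_neg, integral_neg, neg_inj] at key
  simp only [ContinuousLinearMap.flip_apply, ContinuousLinearMap.lsmul_apply, smul_eq_mul]
  simp only [mul_comm] at key ⊢
  exact key

theorem moll_norm_le (n : ℕ) (u : RN N → ℝ) (x : RN N) :
    ‖moll n u x‖ ≤ ∫ t, (bump N n).normed volume t * ‖u (x - t)‖ := by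
  rw [moll_apply]
  refine (norm_integral_le_integral_norm _).trans (le_of_eq ?_)
  refine integral_congr_ae (ae_of_all _ fun t => ?_)
  simp [abs_of_nonneg ((bump N n).nonneg_normed t)]

theorem locallyIntegrable_norm {F : Type*} [NormedAddCommGroup F] {G : RN N → F}
    (h : LocallyIntegrable G) : LocallyIntegrable fun x => ‖G x‖ := fun x =>
  let ⟨s, hs, hi⟩ := h x
  ⟨s, hs, hi.norm⟩

/-- Evaluating in each direction `e` reduces the vector-valued gradient to scalar mollifications, so
the scalar L^p contraction suffices for gradients. -/
theorem norm_fderiv_moll_le (n : ℕ) {u : RN N → ℝ} {G : RN N → RN N} (h : HasWeakGradient u G)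
    (x : RN N) : ‖fderiv ℝ (moll n u) x‖ ≤ moll n (fun y => ‖G y‖) x := by
  have hnn : 0 ≤ moll n (fun y => ‖G y‖) x := by
    rw [moll_apply]
    exact integral_nonneg fun t => mul_nonneg ((bump N n).nonneg_normed t) (norm_nonneg _)
  refine ContinuousLinearMap.opNorm_le_bound _ hnn fun e => ?_
  rw [fderiv_moll n h]
  refine (moll_norm_le n _ x).trans ?_
  rw [moll_apply, ← integral_mul_const]
  refine integral_mono_of_nonneg (ae_of_all _ fun t => ?_) ?_ (ae_of_all _ fun t => ?_)
  · exact mul_nonneg ((bump N n).nonneg_normed t) (norm_nonneg _)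
  · exact (moll_integrand_integrable n (locallyIntegrable_norm h.2.1) x).mul_const _
  · simp only
    rw [mul_assoc]
    exact mul_le_mul_of_nonneg_left (norm_inner_le_norm _ _) ((bump N n).nonneg_normed t)

/-- The probability measure with density a normalized bump function. -/
def bumpMeasure (N n : ℕ) : Measure (RN N) :=
  volume.withDensity fun t => ENNReal.ofReal ((bump N n).normed volume t)

theorem measurable_bump_density (n : ℕ) :
    Measurable fun t => ENNReal.ofReal ((bump N n).normed volume t) :=
  ((bump N n).continuous_normed.measurable).ennreal_ofReal

instance (n : ℕ) : IsProbabilityMeasure (bumpMeasure N n) := by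
  constructor
  rw [bumpMeasure, withDensity_apply _ MeasurableSet.univ, Measure.restrict_univ,
    ← ofReal_integral_eq_lintegral_ofReal (bump N n).integrable_normed
    (ae_of_all _ (bump N n).nonneg_normed), (bump N n).integral_normed, ENNReal.ofReal_one]

theorem enorm_moll_le (n : ℕ) (u : RN N → ℝ) (x : RN N) :
    ‖moll n u x‖ₑ ≤ ∫⁻ t, ENNReal.ofReal ((bump N n).normed volume t) * ‖u (x - t)‖ₑ := by
  rw [moll_apply]
  refine (enorm_integral_le_lintegral_enorm _).trans (le_of_eq ?_)
  refine lintegral_congr fun t => ?_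
  rw [enorm_mul, Real.enorm_eq_ofReal ((bump N n).nonneg_normed t)]

/-- Jensen's inequality for the probability measure `bumpMeasure`, obtained from the monotonicity of
L^p norms in the exponent. -/
theorem enorm_moll_rpow_le (n : ℕ) {u : RN N → ℝ} (hu : AEStronglyMeasurable u) {p : ℝ}
    (hp : 1 ≤ p) (x : RN N) : ‖moll n u x‖ₑ ^ p ≤
      ∫⁻ t, ENNReal.ofReal ((bump N n).normed volume t) * ‖u (x - t)‖ₑ ^ p := by
  have hp0 : 0 < p := by linarith
  have hux : AEStronglyMeasurable (fun t => u (x - t)) volume :=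
    hu.comp_measurePreserving (Measure.measurePreserving_sub_left volume x)
  have hux' : AEStronglyMeasurable (fun t => u (x - t)) (bumpMeasure N n) :=
    hux.mono_ac (withDensity_absolutelyContinuous _ _)
  have h1 := eLpNorm_le_eLpNorm_of_exponent_le (μ := bumpMeasure N n) (p := 1)
    (q := ENNReal.ofReal p) (by simpa using hp) hux'
  rw [eLpNorm_one_eq_lintegral_enorm, eLpNorm_eq_lintegral_rpow_enorm_toReal (by simpa using hp0)
    ENNReal.ofReal_ne_top, ENNReal.toReal_ofReal hp0.le] at h1
  have h2 := ENNReal.rpow_le_rpow h1 hp0.le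
  rw [← ENNReal.rpow_mul, one_div_mul_cancel hp0.ne', ENNReal.rpow_one] at h2
  rw [bumpMeasure, lintegral_withDensity_eq_lintegral_mul₀ (measurable_bump_density n).aemeasurable
    hux.enorm, lintegral_withDensity_eq_lintegral_mul₀ (measurable_bump_density n).aemeasurable
    (hux.enorm.pow_const _)] at h2
  exact (ENNReal.rpow_le_rpow (enorm_moll_le n u x) hp0.le).trans h2

theorem eLpNorm_moll_le (n : ℕ) {u : RN N → ℝ} (hu : AEStronglyMeasurable u) {p : ℝ}
    (hp : 1 ≤ p) : eLpNorm (moll n u) (ENNReal.ofReal p) volume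
      ≤ eLpNorm u (ENNReal.ofReal p) volume := by
  have hp0 : 0 < p := by linarith
  rw [eLpNorm_eq_lintegral_rpow_enorm_toReal (by simpa using hp0) ENNReal.ofReal_ne_top,
    eLpNorm_eq_lintegral_rpow_enorm_toReal (by simpa using hp0) ENNReal.ofReal_ne_top,
    ENNReal.toReal_ofReal hp0.le]
  refine ENNReal.rpow_le_rpow ?_ (by positivity)
  calc ∫⁻ x, ‖moll n u x‖ₑ ^ p
      ≤ ∫⁻ x, ∫⁻ t, ENNReal.ofReal ((bump N n).normed volume t) * ‖u (x - t)‖ₑ ^ p :=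
        lintegral_mono fun x => enorm_moll_rpow_le n hu hp x
    _ = ∫⁻ t, ∫⁻ x, ENNReal.ofReal ((bump N n).normed volume t) * ‖u (x - t)‖ₑ ^ p := by
        apply lintegral_lintegral_swap
        refine AEMeasurable.mul ?_ ?_
        · exact ((measurable_bump_density n).comp measurable_snd).aemeasurable
        · refine AEMeasurable.pow_const ?_ _
          have : AEStronglyMeasurable (fun z : RN N × RN N => u (z.1 - z.2))
              (volume.prod volume) :=
            hu.comp_quasiMeasurePreserving
              (quasiMeasurePreserving_sub_of_right_invariant volume volume)
          exact this.enorm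
    _ = ∫⁻ t, ENNReal.ofReal ((bump N n).normed volume t) * ∫⁻ x, ‖u x‖ₑ ^ p := by
        refine lintegral_congr fun t => ?_
        rw [lintegral_const_mul' _ _ ENNReal.ofReal_ne_top,
          lintegral_sub_right_eq_self (fun x => ‖u x‖ₑ ^ p) t]
    _ = ∫⁻ x, ‖u x‖ₑ ^ p := by
        rw [lintegral_mul_const _ (measurable_bump_density n)]
        have h : (bumpMeasure N n) univ = 1 := measure_univ
        rw [bumpMeasure, withDensity_apply _ MeasurableSet.univ, Measure.restrict_univ] at h
        rw [h, one_mul]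

theorem moll_sub (n : ℕ) {u v : RN N → ℝ} (hu : LocallyIntegrable u) (hv : LocallyIntegrable v) :
    moll n (u - v) = moll n u - moll n v := by
  ext x
  simp only [Pi.sub_apply, moll_apply, mul_sub]
  exact integral_sub (moll_integrand_integrable n hu x) (moll_integrand_integrable n hv x)

theorem moll_eq_zero_of_ball (n : ℕ) {u : RN N → ℝ} {x : RN N}
    (h : ∀ y, dist y x < 1 → u y = 0) : moll n u x = 0 := by
  rw [moll_apply]
  refine integral_eq_zero_of_ae (ae_of_all _ fun t => ?_)
  by_cases ht : t ∈ Metric.ball (0 : RN N) (bump N n).rOut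
  · have : u (x - t) = 0 := h _ (by
      have := bump_rOut_le_one (N := N) n
      simp only [Metric.mem_ball, dist_zero_right] at ht
      simpa [dist_eq_norm] using ht.trans_le this)
    simp [this]
  · rw [← (bump N n).support_normed_eq (μ := volume), Function.notMem_support] at ht
    simp [ht]

theorem abs_moll_le (n : ℕ) {u : RN N → ℝ} {C : ℝ} (hC : ∀ x, |u x| ≤ C) (x : RN N) :
    |moll n u x| ≤ C := by
  have h := moll_norm_le n u x
  rw [Real.norm_eq_abs] at h
  refine h.trans ?_
  have : ∫ t, (bump N n).normed volume t * C = C := by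
    rw [integral_mul_const, (bump N n).integral_normed, one_mul]
  rw [← this]
  refine integral_mono_of_nonneg (ae_of_all _ fun t => ?_)
    ((bump N n).integrable_normed.mul_const C) (ae_of_all _ fun t => ?_)
  · exact mul_nonneg ((bump N n).nonneg_normed t) (norm_nonneg _)
  · exact mul_le_mul_of_nonneg_left (hC _) ((bump N n).nonneg_normed t)

theorem eLpNorm_moll_sub_tendsto_of_continuous {g : RN N → ℝ} (hg : Continuous g)
    (hc : HasCompactSupport g) :
    Tendsto (fun n => eLpNorm (moll n g - g) 1 volume) atTop (𝓝 0) := by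
  obtain ⟨C, hC⟩ := hc.exists_bound_of_continuous hg
  set K := Metric.cthickening 1 (tsupport g)
  have hK : IsCompact K := IsCompact.cthickening hc
  have hli := hg.locallyIntegrable (μ := (volume : Measure (RN N)))
  simp only [eLpNorm_one_eq_lintegral_enorm]
  have h0 : ∫⁻ _ : RN N, (0 : ℝ≥0∞) = 0 := by simp
  rw [← h0]
  refine tendsto_lintegral_of_dominated_convergence
    (K.indicator fun _ => ENNReal.ofReal (2 * C)) (fun n => ?_) (fun n => ?_) ?_ ?_
  · exact (((contDiff_moll n hli).continuous.sub hg).measurable).enorm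
  · refine ae_of_all _ fun x => ?_
    by_cases hx : x ∈ K
    · rw [indicator_of_mem hx]
      change ‖(moll n g - g) x‖ₑ ≤ _
      rw [← ofReal_norm]
      apply ENNReal.ofReal_le_ofReal
      have h1 := abs_moll_le n hC x
      have h2 := hC x
      simp only [Real.norm_eq_abs] at *
      have h3 := abs_sub (moll n g x) (g x)
      simp only [Pi.sub_apply]
      linarith
    · rw [indicator_of_notMem hx]
      have hx' : ∀ y, dist y x < 1 → g y = 0 := by
        intro y hy
        by_contra hne
        exact hx (Metric.mem_cthickening_of_dist_le x y 1 _
          (subset_tsupport _ hne) (by rw [dist_comm]; exact hy.le))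
      simp [moll_eq_zero_of_ball n hx', hx' x (by simp)]
  · rw [lintegral_indicator hK.measurableSet]
    simp only [lintegral_const, Measure.restrict_apply MeasurableSet.univ, univ_inter]
    exact ENNReal.mul_ne_top ENNReal.ofReal_ne_top hK.measure_lt_top.ne
  · filter_upwards [moll_tendsto_ae hli] with x hx
    have := (hx.sub_const (g x)).enorm
    simpa using this

theorem eLpNorm_moll_sub_tendsto {f : RN N → ℝ} (hf : Integrable f) :
    Tendsto (fun n => eLpNorm (moll n f - f) 1 volume) atTop (𝓝 0) := by
  rw [ENNReal.tendsto_nhds_zero]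
  intro ε hε
  have hε3 : ε / 3 ≠ 0 := by
    simpa using hε.ne'
  obtain ⟨g, hgc, hfg, hg, hgL⟩ :=
    (memLp_one_iff_integrable.2 hf).exists_hasCompactSupport_eLpNorm_sub_le ENNReal.one_ne_top hε3
  filter_upwards [(ENNReal.tendsto_nhds_zero.1 (eLpNorm_moll_sub_tendsto_of_continuous hg hgc))
    (ε / 3) (pos_iff_ne_zero.2 hε3)] with n hn
  have hgl := hg.locallyIntegrable (μ := (volume : Measure (RN N)))
  have e1 : moll n f - f = moll n (f - g) + ((moll n g - g) - (f - g)) := by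
    rw [moll_sub n hf.locallyIntegrable hgl]
    abel
  have m1 : AEStronglyMeasurable (moll n (f - g)) volume :=
    (contDiff_moll n (hf.locallyIntegrable.sub hgl)).continuous.aestronglyMeasurable
  have m2 : AEStronglyMeasurable (f - g) volume :=
    hf.aestronglyMeasurable.sub hg.aestronglyMeasurable
  have m3 : AEStronglyMeasurable (moll n g - g) volume :=
    ((contDiff_moll n hgl).continuous.sub hg).aestronglyMeasurable
  have h4 := eLpNorm_moll_le n m2 (le_refl (1 : ℝ))
  rw [ENNReal.ofReal_one] at h4
  rw [e1]
  calc _ ≤ eLpNorm (moll n (f - g)) 1 volume + eLpNorm ((moll n g - g) - (f - g)) 1 volume :=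
        eLpNorm_add_le m1 (m3.sub m2) le_rfl
    _ ≤ ε / 3 + (ε / 3 + ε / 3) := by
        gcongr
        · exact h4.trans hfg
        · exact (eLpNorm_sub_le m3 m2 le_rfl).trans (add_le_add hn hfg)
    _ = ε := by rw [← add_assoc, ENNReal.add_thirds]

/-- Kernels have radius at most 1, so on the ball of radius r nothing changes when u is cut off
outside radius r + 1. This reduces the claim to integrable functions. -/
theorem setLIntegral_moll_sub_tendsto {u : RN N → ℝ} (hu : LocallyIntegrable u) (r : ℝ) :
    Tendsto (fun n => ∫⁻ x in Metric.closedBall 0 r, ‖moll n u x - u x‖ₑ) atTop (𝓝 0) := by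
  set B := Metric.closedBall (0 : RN N) (r + 1)
  have hB : IsCompact B := isCompact_closedBall _ _
  have hf : Integrable (B.indicator u) :=
    (integrable_indicator_iff hB.measurableSet).2 (hu.integrableOn_isCompact hB)
  refine tendsto_of_tendsto_of_tendsto_of_le_of_le tendsto_const_nhds
    (eLpNorm_moll_sub_tendsto hf) (fun n => zero_le) (fun n => ?_)
  simp only [eLpNorm_one_eq_lintegral_enorm]
  refine le_trans (le_of_eq ?_) (setLIntegral_le_lintegral (Metric.closedBall 0 r) _)
  refine setLIntegral_congr_fun Metric.isClosed_closedBall.measurableSet fun x hx => ?_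
  simp only [Metric.mem_closedBall, dist_zero_right] at hx
  have h1 : moll n (u - B.indicator u) x = 0 := by
    refine moll_eq_zero_of_ball n fun y hy => ?_
    have : y ∈ B := by
      rw [dist_eq_norm] at hy
      have := norm_le_norm_add_norm_sub x y
      simp only [B, Metric.mem_closedBall, dist_zero_right]
      rw [norm_sub_rev] at this
      linarith
    simp [this]
  rw [moll_sub n hu hf.locallyIntegrable, Pi.sub_apply, sub_eq_zero] at h1
  have hxB : x ∈ B := by
    simp only [B, Metric.mem_closedBall, dist_zero_right]; linarith
  simp [h1, hxB]

/-- Passing to the limit in a product of a boundedly convergent sequence and mollifications. -/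
theorem tendsto_integral_mul_moll {u : RN N → ℝ} (hu : LocallyIntegrable u)
    {b : ℕ → RN N → ℝ} {b₀ φ : RN N → ℝ} {C : ℝ} (hbm : ∀ n, AEStronglyMeasurable (b n) volume)
    (hbC : ∀ n x, |b n x| ≤ C) (hb : ∀ᵐ x, Tendsto (fun n => b n x) atTop (𝓝 (b₀ x)))
    (hφ : Continuous φ) (hc : HasCompactSupport φ) :
    Tendsto (fun n => ∫ x, b n x * moll n u x * φ x) atTop (𝓝 (∫ x, b₀ x * u x * φ x)) := by
  obtain ⟨D, hD⟩ := hc.exists_bound_of_continuous hφ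
  obtain ⟨r, hr⟩ : ∃ r, tsupport φ ⊆ Metric.closedBall 0 r := hc.isBounded.subset_closedBall 0
  have hφ0 : ∀ x, x ∉ Metric.closedBall (0 : RN N) r → φ x = 0 := fun x hx =>
    image_eq_zero_of_notMem_tsupport fun h => hx (hr h)
  have hC0 : 0 ≤ C := (abs_nonneg _).trans (hbC 0 0)
  have hD0 : 0 ≤ D := (norm_nonneg _).trans (hD 0)
  have iu : Integrable fun x => u x * φ x := by
    simpa [mul_comm] using hu.integrable_smul_left_of_hasCompactSupport hφ hc
  have im : ∀ n, Integrable fun x => moll n u x * φ x := fun n =>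
    ((contDiff_moll n hu).continuous.mul hφ).integrable_of_hasCompactSupport hc.mul_left
  have ibm : ∀ n (g : RN N → ℝ), Integrable g → Integrable fun x => b n x * g x := fun n g hg =>
    hg.bdd_mul (c := C) (hbm n) (ae_of_all _ (hbC n))
  have t1 : Tendsto (fun n => ∫ x, b n x * (u x * φ x)) atTop (𝓝 (∫ x, b₀ x * (u x * φ x))) := by
    refine tendsto_integral_of_dominated_convergence (fun x => C * ‖u x * φ x‖)
      (fun n => (ibm n _ iu).aestronglyMeasurable) (iu.norm.const_mul C)
      (fun n => ae_of_all _ fun x => ?_) ?_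
    · rw [norm_mul]
      exact mul_le_mul_of_nonneg_right (hbC n x) (norm_nonneg _)
    · filter_upwards [hb] with x hx
      exact hx.mul_const _
  -- Mollifications converge locally in L¹ but have no common majorant. Their error is therefore
  -- separated from the dominated-convergence limit `t1` and estimated with the bounded factors
  -- pulled out.
  have t2 : Tendsto (fun n => ∫ x, b n x * (moll n u x * φ x) - b n x * (u x * φ x))
      atTop (𝓝 0) := by
    rw [tendsto_zero_iff_norm_tendsto_zero]
    have hlim₀ := ENNReal.Tendsto.const_mul (a := ENNReal.ofReal (C * D))
      (setLIntegral_moll_sub_tendsto hu r) (Or.inr ENNReal.ofReal_ne_top)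
    rw [mul_zero] at hlim₀
    have hlim := (ENNReal.tendsto_toReal ENNReal.zero_ne_top).comp hlim₀
    rw [ENNReal.toReal_zero] at hlim
    have hfin : ∀ n, ∫⁻ x in Metric.closedBall 0 r, ‖moll n u x - u x‖ₑ ≠ ⊤ := fun n =>
      ((((contDiff_moll n hu).continuous.locallyIntegrable).sub hu).integrableOn_isCompact
        (isCompact_closedBall 0 r)).hasFiniteIntegral.ne
    refine tendsto_of_tendsto_of_tendsto_of_le_of_le tendsto_const_nhds hlim
      (fun n => norm_nonneg _) (fun n => ?_)
    rw [← toReal_enorm]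
    refine ENNReal.toReal_mono (ENNReal.mul_ne_top ENNReal.ofReal_ne_top (hfin n)) ?_
    refine (enorm_integral_le_lintegral_enorm _).trans ?_
    beta_reduce
    rw [← lintegral_const_mul' _ _ ENNReal.ofReal_ne_top,
      ← lintegral_indicator Metric.isClosed_closedBall.measurableSet]
    refine lintegral_mono fun x => ?_
    by_cases hx : x ∈ Metric.closedBall (0 : RN N) r
    · rw [indicator_of_mem hx]
      have : b n x * (moll n u x * φ x) - b n x * (u x * φ x)
          = (b n x * φ x) * (moll n u x - u x) := by ring
      rw [this, enorm_mul]
      gcongr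
      rw [← ofReal_norm, norm_mul]
      exact ENNReal.ofReal_le_ofReal
        (mul_le_mul (hbC n x) (hD x) (norm_nonneg _) hC0)
    · rw [indicator_of_notMem hx]
      simp [hφ0 x hx]
  have t3 := t2.add t1
  rw [zero_add] at t3
  have e1 : ∀ x, b₀ x * u x * φ x = b₀ x * (u x * φ x) := fun x => by ring
  simp only [e1]
  refine t3.congr fun n => ?_
  rw [integral_sub (ibm n _ (im n)) (ibm n _ iu), sub_add_cancel]
  exact integral_congr_ae (ae_of_all _ fun x => by ring)

/-! ### Chain rule and positive part for weak gradients. -/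

theorem locallyIntegrable_inner {G : RN N → RN N} (h : LocallyIntegrable G) (e : RN N) :
    LocallyIntegrable fun x => inner ℝ (G x) e := fun x =>
  let ⟨s, hs, hi⟩ := h x
  ⟨s, hs, hi.inner_const e⟩

theorem abs_sub_le_of_deriv_bound {h h' : ℝ → ℝ} {C : ℝ} (hh : ∀ t, HasDerivAt h (h' t) t)
    (hC : ∀ t, |h' t| ≤ C) (s t : ℝ) : |h s - h t| ≤ C * |s - t| :=
  Convex.norm_image_sub_le_of_norm_hasDerivWithin_le (s := univ)
    (fun x _ => (hh x).hasDerivWithinAt) (fun x _ => hC x) convex_univ (mem_univ t) (mem_univ s)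

/-- The chain rule for weak gradients. -/
theorem HasWeakGradient.comp_deriv {u : RN N → ℝ} {G : RN N → RN N} (hu : HasWeakGradient u G)
    {h h' : ℝ → ℝ} {C : ℝ} (hh : ∀ t, HasDerivAt h (h' t) t) (hh' : Continuous h')
    (hC : ∀ t, |h' t| ≤ C) (h0 : h 0 = 0) :
    HasWeakGradient (fun x => h (u x)) (fun x => h' (u x) • G x) := by
  have hC0 : 0 ≤ C := (abs_nonneg _).trans (hC 0)
  have hcont : Continuous h := continuous_iff_continuousAt.2 fun t => (hh t).continuousAt
  have hdiff : Differentiable ℝ h := fun t => (hh t).differentiableAt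
  have hum := hu.1.aestronglyMeasurable
  refine ⟨?_, ?_, fun φ hφ hc e => ?_⟩
  · refine (hu.1.smul C).mono (hcont.comp_aestronglyMeasurable hum) (ae_of_all _ fun x => ?_)
    have := abs_sub_le_of_deriv_bound hh hC (u x) 0
    simpa [h0, abs_mul, abs_of_nonneg hC0] using this
  · refine (hu.2.1.smul C).mono ((hh'.comp_aestronglyMeasurable hum).smul
      hu.2.1.aestronglyMeasurable) (ae_of_all _ fun x => ?_)
    simp only [norm_smul, Pi.smul_apply, Real.norm_eq_abs, abs_of_nonneg hC0]
    exact mul_le_mul_of_nonneg_right (hC _) (norm_nonneg _)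
  -- Writing h(t) as a bounded continuous factor times t gives both sides of the integration by
  -- parts the shape bounded × mollification × test function handled by `tendsto_integral_mul_moll`.
  have hds : Continuous (dslope h 0) := by
    refine continuous_iff_continuousAt.2 fun t => ?_
    rcases eq_or_ne t 0 with rfl | ht
    · exact continuousAt_dslope_same.2 (hdiff 0)
    · exact (continuousAt_dslope_of_ne ht).2 hcont.continuousAt
  have hdsC : ∀ t, |dslope h 0 t| ≤ C := by
    intro t
    rcases eq_or_ne t 0 with rfl | ht
    · rw [dslope_same, (hh 0).deriv]; exact hC 0
    · rw [dslope_of_ne _ ht, slope_def_field, abs_div, div_le_iff₀ (by simpa using ht)]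
      exact abs_sub_le_of_deriv_bound hh hC t 0
  have hdse : ∀ t, dslope h 0 t * t = h t := by
    intro t
    have := sub_smul_dslope h 0 t
    simp only [sub_zero, smul_eq_mul, h0] at this
    rw [mul_comm]; exact this
  have hlim : ∀ g : ℝ → ℝ, Continuous g → ∀ᵐ x, Tendsto (fun n => g (moll n u x)) atTop
      (𝓝 (g (u x))) := fun g hg => by
    filter_upwards [moll_tendsto_ae hu.1] with x hx
    exact (hg.tendsto _).comp hx
  have hms : ∀ n (g : ℝ → ℝ), Continuous g →
      AEStronglyMeasurable (fun x => g (moll n u x)) volume := fun n g hg =>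
    (hg.comp (contDiff_moll n hu.1).continuous).aestronglyMeasurable
  have hφ' : Continuous fun x => fderiv ℝ φ x e :=
    (hφ.continuous_fderiv (by simp)).clm_apply continuous_const
  have t1 := tendsto_integral_mul_moll hu.1 (fun n => hms n _ hds) (fun n x => hdsC _)
    (hlim _ hds) hφ' (hc.fderiv_apply ℝ e)
  have t2 := (tendsto_integral_mul_moll (locallyIntegrable_inner hu.2.1 e)
    (fun n => hms n _ hh') (fun n x => hC _) (hlim _ hh') hφ.continuous hc).neg
  simp only [hdse] at t1
  have e1 : ∀ x, inner ℝ (h' (u x) • G x) e * φ x = h' (u x) * inner ℝ (G x) e * φ x := fun x => by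
    rw [real_inner_smul_left]
  simp only [e1]
  refine tendsto_nhds_unique t1 (t2.congr fun n => ?_)
  have hz := contDiff_moll n hu.1
  have hd : ∀ x, fderiv ℝ (fun x => h (moll n u x)) x e
      = h' (moll n u x) * moll n (fun y => inner ℝ (G y) e) x := by
    intro x
    have := (hh (moll n u x)).comp_hasFDerivAt x (hz.differentiable (by simp) x).hasFDerivAt
    rw [show (fun x => h (moll n u x)) = h ∘ moll n u from rfl, this.fderiv]
    simp [fderiv_moll n hu]
  have hz' : Continuous fun x => moll n u x := hz.continuous
  have hG' : Continuous (moll n (fun y => inner ℝ (G y) e)) :=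
    (contDiff_moll n (locallyIntegrable_inner hu.2.1 e)).continuous
  rw [integral_mul_fderiv_eq_neg_fderiv_mul_of_integrable]
  · simp only [hd]
  · simp only [hd]
    exact (((hh'.comp hz').mul hG').mul hφ.continuous).integrable_of_hasCompactSupport hc.mul_left
  · exact ((hcont.comp hz').mul hφ').integrable_of_hasCompactSupport
      (hc.fderiv_apply ℝ e).mul_left
  · exact ((hcont.comp hz').mul hφ.continuous).integrable_of_hasCompactSupport hc.mul_left
  · exact fun x _ => (hdiff _).comp x (hz.differentiable (by simp) x)
  · exact fun x _ => hφ.differentiable (by simp) x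

/-- This controls the second term in the derivative of t ↦ t S(nt) uniformly in n, S being the
smooth transition, whose derivative vanishes off [0,1]. -/
theorem exists_bound_mul_deriv_smoothTransition :
    ∃ C, ∀ t, |t * deriv Real.smoothTransition t| ≤ C := by
  have hs : ContDiff ℝ ∞ Real.smoothTransition := Real.smoothTransition.contDiff
  have hc : Continuous fun t => t * deriv Real.smoothTransition t :=
    continuous_id.mul (hs.continuous_deriv (by simp))
  obtain ⟨C, hC⟩ := (isCompact_Icc (a := (0 : ℝ)) (b := 1)).exists_bound_of_continuousOn
    hc.continuousOn
  refine ⟨C, fun t => ?_⟩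
  have hC0 : 0 ≤ C := (norm_nonneg _).trans (hC 0 (by simp))
  by_cases h0 : t < 0
  · have : Real.smoothTransition =ᶠ[𝓝 t] fun _ => 0 := by
      filter_upwards [Iio_mem_nhds h0] with y hy
      exact Real.smoothTransition.zero_of_nonpos (le_of_lt hy)
    rw [this.deriv_eq]
    simpa using hC0
  by_cases h1 : 1 < t
  · have : Real.smoothTransition =ᶠ[𝓝 t] fun _ => 1 := by
      filter_upwards [Ioi_mem_nhds h1] with y hy
      exact Real.smoothTransition.one_of_one_le (le_of_lt hy)
    rw [this.deriv_eq]
    simpa using hC0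
  exact hC t ⟨not_lt.1 h0, not_lt.1 h1⟩

theorem deriv_smoothTransition_eq_zero {t : ℝ} (ht : t ≤ 0 ∨ 1 < t) :
    t * deriv Real.smoothTransition t = 0 := by
  rcases ht with ht | ht
  · rcases ht.eq_or_lt with rfl | ht
    · simp
    have : Real.smoothTransition =ᶠ[𝓝 t] fun _ => 0 := by
      filter_upwards [Iio_mem_nhds ht] with y hy
      exact Real.smoothTransition.zero_of_nonpos (le_of_lt hy)
    rw [this.deriv_eq]
    simp
  · have : Real.smoothTransition =ᶠ[𝓝 t] fun _ => 1 := by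
      filter_upwards [Ioi_mem_nhds ht] with y hy
      exact Real.smoothTransition.one_of_one_le (le_of_lt hy)
    rw [this.deriv_eq]
    simp

/-- The weak gradient of the positive part. -/
theorem HasWeakGradient.max_zero {u : RN N → ℝ} {G : RN N → RN N} (hu : HasWeakGradient u G) :
    HasWeakGradient (fun x => max (u x) 0) (fun x => (if 0 < u x then (1 : ℝ) else 0) • G x) := by
  obtain ⟨C, hC⟩ := exists_bound_mul_deriv_smoothTransition
  set S := Real.smoothTransition
  have hS : ContDiff ℝ ∞ S := Real.smoothTransition.contDiff
  -- These functions vanish for t ≤ 0 and equal t once nt ≥ 1, with derivatives bounded uniformly in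
  -- n. The derivatives vanish at t = 0, which is why the limit is the indicator of the strict set
  -- {u > 0}.
  set h : ℕ → ℝ → ℝ := fun n t => t * S (n * t)
  set h' : ℕ → ℝ → ℝ := fun n t => S (n * t) + (n * t) * deriv S (n * t)
  have hh : ∀ n t, HasDerivAt (h n) (h' n t) t := by
    intro n t
    have h1 : HasDerivAt (fun t : ℝ => (n : ℝ) * t) n t := by
      simpa using (hasDerivAt_id t).const_mul (n : ℝ)
    have h2 : HasDerivAt S (deriv S (n * t)) (n * t) :=
      (hS.differentiable (by simp) _).hasDerivAt
    have h3 : HasDerivAt (fun t => S (n * t)) _ t := h2.comp t h1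
    have h4 : HasDerivAt (fun t => t * S (n * t)) _ t := (hasDerivAt_id t).mul h3
    convert! h4 using 1
    simp only [h', id]
    ring
  have hc' : ∀ n, Continuous (h' n) := fun n => by
    have := hS.continuous
    have := hS.continuous_deriv (by simp)
    simp only [h']
    fun_prop
  have hS1 : ∀ t, |S t| ≤ 1 := fun t => by
    rw [abs_of_nonneg (Real.smoothTransition.nonneg t)]
    exact Real.smoothTransition.le_one t
  have hb : ∀ n t, |h' n t| ≤ 1 + C := fun n t =>
    (abs_add_le _ _).trans (add_le_add (hS1 _) (hC _))
  have ev : ∀ t : ℝ, 0 < t → ∀ᶠ n : ℕ in atTop, 1 < n * t := fun t ht => by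
    filter_upwards [(tendsto_natCast_atTop_atTop (R := ℝ)).eventually_gt_atTop (1 / t)] with n hn
    rwa [div_lt_iff₀ ht] at hn
  have lim1 : ∀ t, Tendsto (fun n => h n t) atTop (𝓝 (max t 0)) := by
    intro t
    rcases le_or_gt t 0 with ht | ht
    · refine tendsto_const_nhds.congr fun n => ?_
      have : S (n * t) = 0 :=
        Real.smoothTransition.zero_of_nonpos (mul_nonpos_of_nonneg_of_nonpos (by positivity) ht)
      simp [h, this, ht]
    · refine tendsto_const_nhds.congr' ?_
      filter_upwards [ev t ht] with n hn
      have : S (n * t) = 1 := Real.smoothTransition.one_of_one_le hn.le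
      simp [h, this, ht.le]
  have lim2 : ∀ t, Tendsto (fun n => h' n t) atTop (𝓝 (if 0 < t then (1 : ℝ) else 0)) := by
    intro t
    rcases le_or_gt t 0 with ht | ht
    · refine tendsto_const_nhds.congr fun n => ?_
      have hle : (n : ℝ) * t ≤ 0 := mul_nonpos_of_nonneg_of_nonpos (by positivity) ht
      have : S (n * t) = 0 := Real.smoothTransition.zero_of_nonpos hle
      simp only [h', this, S, deriv_smoothTransition_eq_zero (Or.inl hle), not_lt.2 ht, if_false,
        add_zero]
    · refine tendsto_const_nhds.congr' ?_
      filter_upwards [ev t ht] with n hn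
      have : S (n * t) = 1 := Real.smoothTransition.one_of_one_le hn.le
      simp only [h', this, S, deriv_smoothTransition_eq_zero (Or.inr hn), ht, if_true, add_zero]
  have hw : ∀ n, HasWeakGradient (fun x => h n (u x)) (fun x => h' n (u x) • G x) := fun n =>
    hu.comp_deriv (hh n) (hc' n) (hb n) (by simp [h])
  have hum := hu.1.aestronglyMeasurable
  have hind : Measurable fun t : ℝ => if 0 < t then (1 : ℝ) else 0 :=
    Measurable.ite measurableSet_Ioi measurable_const measurable_const
  refine ⟨?_, ?_, fun φ hφ hc e => ?_⟩
  · refine hu.1.mono ((continuous_id.max continuous_const).comp_aestronglyMeasurable hum)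
      (ae_of_all _ fun x => ?_)
    simp only [Real.norm_eq_abs]
    rw [abs_of_nonneg (le_max_right _ _)]
    exact max_le (le_abs_self _) (abs_nonneg _)
  · refine hu.2.1.mono (((hind.comp_aemeasurable hum.aemeasurable).aestronglyMeasurable).smul
      hu.2.1.aestronglyMeasurable) (ae_of_all _ fun x => ?_)
    change ‖(if 0 < u x then (1 : ℝ) else 0) • G x‖ ≤ ‖G x‖
    split_ifs <;> simp
  have i1 := hu.mul_fderiv_integrable hφ hc e
  have i2 := hu.inner_integrable hφ.continuous hc e
  have t1 : Tendsto (fun n => ∫ x, h n (u x) * fderiv ℝ φ x e) atTop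
      (𝓝 (∫ x, max (u x) 0 * fderiv ℝ φ x e)) := by
    refine tendsto_integral_of_dominated_convergence _
      (fun n => ((hw n).mul_fderiv_integrable hφ hc e).aestronglyMeasurable) i1.norm
      (fun n => ae_of_all _ fun x => ?_) (ae_of_all _ fun x => (lim1 (u x)).mul_const _)
    simp only [norm_mul, h]
    refine mul_le_mul_of_nonneg_right ?_ (norm_nonneg _)
    simpa using mul_le_mul_of_nonneg_left (hS1 (n * u x)) (norm_nonneg (u x))
  have t2 : Tendsto (fun n => -∫ x, inner ℝ (h' n (u x) • G x) e * φ x) atTop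
      (𝓝 (-∫ x, inner ℝ ((if 0 < u x then (1 : ℝ) else 0) • G x) e * φ x)) := by
    refine (tendsto_integral_of_dominated_convergence _
      (fun n => ((hw n).inner_integrable hφ.continuous hc e).aestronglyMeasurable)
      (i2.norm.const_mul (1 + C))
      (fun n => ae_of_all _ fun x => ?_) (ae_of_all _ fun x => ?_)).neg
    · rw [real_inner_smul_left, mul_assoc, norm_mul]
      exact mul_le_mul_of_nonneg_right (hb n _) (norm_nonneg _)
    · exact (((lim2 (u x)).smul_const (G x)).inner tendsto_const_nhds).mul_const _
  refine tendsto_nhds_unique t1 (t2.congr fun n => ?_)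
  exact ((hw n).2.2 φ hφ hc e).symm

/-! ### The Sobolev inequality on D^{1,m}. -/

/-- A cutoff function equal to `1` near the origin. -/
def cutoff (N : ℕ) : ContDiffBump (0 : RN N) where
  rIn := 1
  rOut := 2
  rIn_pos := by norm_num
  rIn_lt_rOut := by norm_num

/-- Rescaling one fixed bump makes D independent of ρ and confines the gradient to the shell ρ ≤ |x|
≤ 2ρ. -/
theorem exists_cutoff (N : ℕ) : ∃ D : ℝ, 0 ≤ D ∧ ∀ ρ : ℝ, 0 < ρ → ∃ η : RN N → ℝ,
    ContDiff ℝ ∞ η ∧ HasCompactSupport η ∧ (∀ x, 0 ≤ η x ∧ η x ≤ 1) ∧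
    (∀ x, ‖x‖ ≤ ρ → η x = 1) ∧ (∀ x, ‖fderiv ℝ η x‖ ≤ D / ρ) ∧
    (∀ x, ‖x‖ < ρ → fderiv ℝ η x = 0) ∧ (∀ x, 2 * ρ < ‖x‖ → fderiv ℝ η x = 0) := by
  have hη : ContDiff ℝ ∞ (cutoff N) := (cutoff N).contDiff
  obtain ⟨D, hD⟩ := ((cutoff N).hasCompactSupport.fderiv ℝ).exists_bound_of_continuous
    (hη.continuous_fderiv (by simp))
  refine ⟨D, (norm_nonneg _).trans (hD 0), fun ρ hρ => ?_⟩
  have hsm : ContDiff ℝ ∞ (fun x : RN N => ρ⁻¹ • x) := contDiff_const_smul _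
  have one : ∀ x : RN N, ‖x‖ ≤ ρ → cutoff N (ρ⁻¹ • x) = 1 := fun x hx => by
    apply (cutoff N).one_of_mem_closedBall
    simp only [Metric.mem_closedBall, dist_zero_right, norm_smul, norm_inv, Real.norm_eq_abs,
      abs_of_pos hρ, cutoff]
    rwa [inv_mul_le_iff₀ hρ, mul_one]
  have zer : ∀ x : RN N, 2 * ρ ≤ ‖x‖ → cutoff N (ρ⁻¹ • x) = 0 := fun x hx => by
    apply (cutoff N).zero_of_le_dist
    simp only [dist_zero_right, norm_smul, norm_inv, Real.norm_eq_abs,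
      abs_of_pos hρ, cutoff]
    rwa [le_inv_mul_iff₀ hρ, mul_comm]
  refine ⟨fun x => cutoff N (ρ⁻¹ • x), hη.comp hsm, ?_,
    fun x => ⟨(cutoff N).nonneg, (cutoff N).le_one⟩, one, ?_, ?_, ?_⟩
  · exact (cutoff N).hasCompactSupport.comp_smul (inv_ne_zero hρ.ne')
  · intro x
    have h1 : HasFDerivAt (fun x : RN N => ρ⁻¹ • x) (ρ⁻¹ • ContinuousLinearMap.id ℝ (RN N)) x :=
      (hasFDerivAt_id x).const_smul ρ⁻¹
    have h2 : HasFDerivAt (cutoff N) (fderiv ℝ (cutoff N) (ρ⁻¹ • x)) (ρ⁻¹ • x) :=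
      (hη.differentiable (by simp) _).hasFDerivAt
    have h3 : HasFDerivAt (fun x => cutoff N (ρ⁻¹ • x)) _ x := h2.comp x h1
    rw [h3.fderiv, ContinuousLinearMap.comp_smul, ContinuousLinearMap.comp_id, norm_smul, norm_inv,
      Real.norm_eq_abs, abs_of_pos hρ, div_eq_inv_mul]
    exact mul_le_mul_of_nonneg_left (hD _) (by positivity)
  · intro x hx
    have : (fun x : RN N => cutoff N (ρ⁻¹ • x)) =ᶠ[𝓝 x] fun _ => 1 := by
      filter_upwards [(isOpen_lt continuous_norm continuous_const).mem_nhds hx] with y hy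
      exact one y (le_of_lt hy)
    rw [this.fderiv_eq, fderiv_const_apply]
  · intro x hx
    have : (fun x : RN N => cutoff N (ρ⁻¹ • x)) =ᶠ[𝓝 x] fun _ => 0 := by
      filter_upwards [(isOpen_lt continuous_const continuous_norm).mem_nhds hx] with y hy
      exact zer y (le_of_lt hy)
    rw [this.fderiv_eq, fderiv_const_apply]

theorem critExp_inv {m : ℝ} (hm : 0 < m) (hmN : m < N) :
    (critExp N m)⁻¹ = m⁻¹ - (N : ℝ)⁻¹ := by
  have : (0 : ℝ) < N := hm.trans hmN
  have h2 : (N : ℝ) - m ≠ 0 := by linarith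
  rw [critExp]
  field_simp

theorem lt_critExp {m : ℝ} (hm : 0 < m) (hmN : m < N) : m < critExp N m := by
  have : (0 : ℝ) < N := hm.trans hmN
  rw [critExp, lt_div_iff₀ (by linarith)]
  nlinarith

theorem critExp_pos {m : ℝ} (hm : 0 < m) (hmN : m < N) : 0 < critExp N m :=
  hm.trans (lt_critExp hm hmN)

theorem eLpNorm_tail_tendsto_zero {u : RN N → ℝ} {s : ℝ} (hs : 0 < s)
    (hu : MemLp u (ENNReal.ofReal s)) :
    Tendsto (fun n : ℕ => eLpNorm u (ENNReal.ofReal s)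
      (volume.restrict {x : RN N | (n : ℝ) + 1 ≤ ‖x‖})) atTop (𝓝 0) := by
  have hs0 : ENNReal.ofReal s ≠ 0 := by simpa using hs
  have hms : ∀ n : ℕ, MeasurableSet {x : RN N | (n : ℝ) + 1 ≤ ‖x‖} := fun n =>
    (isClosed_le continuous_const continuous_norm).measurableSet
  simp only [eLpNorm_eq_lintegral_rpow_enorm_toReal hs0 ENNReal.ofReal_ne_top,
    ENNReal.toReal_ofReal hs.le]
  have hfin : ∫⁻ x, ‖u x‖ₑ ^ s ≠ ⊤ := by
    have := (lintegral_rpow_enorm_lt_top_of_eLpNorm_lt_top hs0 ENNReal.ofReal_ne_top hu.2).ne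
    rwa [ENNReal.toReal_ofReal hs.le] at this
  have key : Tendsto (fun n : ℕ => ∫⁻ x in {x : RN N | (n : ℝ) + 1 ≤ ‖x‖}, ‖u x‖ₑ ^ s)
      atTop (𝓝 0) := by
    have h0 : ∫⁻ _ : RN N, (0 : ℝ≥0∞) = 0 := by simp
    rw [← h0]
    simp only [← lintegral_indicator (hms _)]
    refine tendsto_lintegral_of_dominated_convergence' (fun x => ‖u x‖ₑ ^ s)
      (fun n => (hu.1.enorm.pow_const s).indicator (hms n))
      (fun n => ae_of_all _ fun x => indicator_le_self _ _ x) hfin (ae_of_all _ fun x => ?_)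
    refine tendsto_const_nhds.congr' ?_
    filter_upwards [(tendsto_natCast_atTop_atTop (R := ℝ)).eventually_gt_atTop ‖x‖] with n hn
    rw [indicator_of_notMem]
    simp only [mem_ofPred_eq, not_le]
    linarith
  have := (ENNReal.continuous_rpow_const (y := 1 / s)).tendsto 0 |>.comp key
  rwa [ENNReal.zero_rpow_of_pos (by positivity)] at this

/-- Hölder's inequality on the shell: its volume is at most of order ρ^N and 1/m - 1/m* = 1/N, so
the volume factor is of order ρ and cancels the 1/ρ of the cutoff gradient. Only the tail of u in
L^{m*} is left. -/
theorem eLpNorm_fderiv_cutoff_le {m D ρ : ℝ} (hm : 1 ≤ m) (hmN : m < N) (hn : 0 < ρ)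
    {u η : RN N → ℝ} (hu : ContDiff ℝ ∞ u) (h1 : ContDiff ℝ ∞ η) (h3 : ∀ x, 0 ≤ η x ∧ η x ≤ 1)
    (h5 : ∀ x, ‖fderiv ℝ η x‖ ≤ D / ρ) (h6 : ∀ x, ‖x‖ < ρ → fderiv ℝ η x = 0)
    (h7 : ∀ x, 2 * ρ < ‖x‖ → fderiv ℝ η x = 0) :
    eLpNorm (fderiv ℝ fun x => η x * u x) (ENNReal.ofReal m) volume
      ≤ eLpNorm (fderiv ℝ u) (ENNReal.ofReal m) volume
        + ENNReal.ofReal (2 * D) * volume (Metric.closedBall (0 : RN N) 1) ^ (N : ℝ)⁻¹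
          * eLpNorm u (ENNReal.ofReal (critExp N m)) (volume.restrict {x : RN N | ρ ≤ ‖x‖}) := by
  have hm0 : 0 < m := by linarith
  have hN : (0 : ℝ) < N := hm0.trans hmN
  have hs0 := critExp_pos hm0 hmN
  set s := critExp N m with hs
  set κ := volume (Metric.closedBall (0 : RN N) 1)
  have hD0 : 0 ≤ D := by
    have := (norm_nonneg _).trans (h5 0)
    rwa [le_div_iff₀ hn, zero_mul] at this
  set T := eLpNorm u (ENNReal.ofReal s) (volume.restrict {x : RN N | ρ ≤ ‖x‖})
  set A : Set (RN N) := {x | ρ ≤ ‖x‖} ∩ Metric.closedBall 0 (2 * ρ)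
  have hA : MeasurableSet A :=
    (isClosed_le continuous_const continuous_norm).measurableSet.inter
      Metric.isClosed_closedBall.measurableSet
  have hfd : ∀ x, fderiv ℝ (fun x => η x * u x) x
      = η x • fderiv ℝ u x + A.indicator (fun x => u x • fderiv ℝ η x) x := by
    intro x
    rw [fderiv_fun_mul (h1.differentiable (by simp) x) (hu.differentiable (by simp) x)]
    congr 1
    by_cases hx : x ∈ A
    · rw [indicator_of_mem hx]
    · rw [indicator_of_notMem hx]
      have : fderiv ℝ η x = 0 := by
        by_cases hx1 : ‖x‖ < ρ
        · exact h6 x hx1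
        · refine h7 x (not_le.1 fun h => hx ⟨not_lt.1 hx1, ?_⟩)
          simpa using h
      rw [this, smul_zero]
  have hu1 : Continuous (fun x => ‖fderiv ℝ u x‖) := (hu.continuous_fderiv (by simp)).norm
  have a1 : AEStronglyMeasurable (fun x => ‖fderiv ℝ u x‖) volume := hu1.aestronglyMeasurable
  have a2 : AEStronglyMeasurable (A.indicator fun x => D / ρ * u x) volume :=
    (continuous_const.mul hu.continuous).aestronglyMeasurable.indicator hA
  have hle : ∀ x, ‖fderiv ℝ (fun x => η x * u x) x‖
      ≤ ‖fderiv ℝ u x‖ + ‖A.indicator (fun x => D / ρ * u x) x‖ := by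
    intro x
    rw [hfd]
    refine (norm_add_le _ _).trans (add_le_add ?_ ?_)
    · rw [norm_smul, Real.norm_eq_abs, abs_of_nonneg (h3 x).1]
      exact mul_le_of_le_one_left (norm_nonneg _) (h3 x).2
    · by_cases hx : x ∈ A
      · rw [indicator_of_mem hx, indicator_of_mem hx, norm_smul, norm_mul, mul_comm]
        exact mul_le_mul_of_nonneg_right ((h5 x).trans (le_abs_self _)) (norm_nonneg _)
      · simp [hx]
  refine (eLpNorm_mono_real hle).trans ((eLpNorm_add_le a1 a2.norm (by simpa using hm)).trans ?_)
  rw [eLpNorm_norm]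
  refine add_le_add le_rfl ?_
  · rw [eLpNorm_norm, eLpNorm_indicator_eq_eLpNorm_restrict hA]
    have b1 : eLpNorm (fun x => D / ρ * u x) (ENNReal.ofReal m) (volume.restrict A)
        ≤ ENNReal.ofReal (D / ρ) * eLpNorm u (ENNReal.ofReal m) (volume.restrict A) := by
      refine eLpNorm_le_mul_eLpNorm_of_ae_le_mul (ae_of_all _ fun x => ?_) _
      rw [norm_mul, Real.norm_eq_abs, abs_of_nonneg (by positivity)]
    have b2 := eLpNorm_le_eLpNorm_mul_rpow_measure_univ (μ := volume.restrict A)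
      (ENNReal.ofReal_le_ofReal (lt_critExp hm0 hmN).le)
      hu.continuous.aestronglyMeasurable
    have b3 : eLpNorm u (ENNReal.ofReal s) (volume.restrict A) ≤ T :=
      eLpNorm_mono_measure _ (Measure.restrict_mono inter_subset_left le_rfl)
    have b4 : (volume.restrict A univ) ^ (1 / (ENNReal.ofReal m).toReal
        - 1 / (ENNReal.ofReal s).toReal) ≤ ENNReal.ofReal (2 * ρ) * κ ^ (N : ℝ)⁻¹ := by
      rw [ENNReal.toReal_ofReal hm0.le, ENNReal.toReal_ofReal hs0.le, one_div, one_div,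
        critExp_inv hm0 hmN, sub_sub_cancel, Measure.restrict_apply MeasurableSet.univ, univ_inter]
      calc (volume A) ^ (N : ℝ)⁻¹
          ≤ (ENNReal.ofReal ((2 * ρ) ^ N) * κ) ^ (N : ℝ)⁻¹ := by
            refine ENNReal.rpow_le_rpow ?_ (by positivity)
            refine (measure_mono inter_subset_right).trans (le_of_eq ?_)
            rw [Measure.addHaar_closedBall' _ _ (by positivity), finrank_euclideanSpace_fin]
        _ = _ := by
            rw [ENNReal.mul_rpow_of_nonneg _ _ (by positivity),
              ENNReal.ofReal_rpow_of_nonneg (by positivity) (by positivity),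
              Real.pow_rpow_inv_natCast (by positivity) (by exact_mod_cast hN.ne')]
    calc _ ≤ ENNReal.ofReal (D / ρ) * (T * (ENNReal.ofReal (2 * ρ) * κ ^ (N : ℝ)⁻¹)) :=
          b1.trans (mul_le_mul_right (b2.trans (mul_le_mul' b3 b4)) _)
      _ = (ENNReal.ofReal (D / ρ) * ENNReal.ofReal (2 * ρ)) * κ ^ (N : ℝ)⁻¹ * T := by ring
      _ = ENNReal.ofReal (2 * D) * κ ^ (N : ℝ)⁻¹ * T := by
          rw [← ENNReal.ofReal_mul (by positivity)]
          congr 3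
          field_simp

/-- The Gagliardo-Nirenberg-Sobolev inequality applies to the compactly supported ηₙu. The cutoff
error vanishes with the tail of u, and Fatou's lemma recovers u. -/
theorem sobolev_smooth {m : ℝ} (hm : 1 ≤ m) (hmN : m < N) : ∃ C : ℝ≥0, ∀ u : RN N → ℝ,
    ContDiff ℝ ∞ u → MemLp u (ENNReal.ofReal (critExp N m)) →
    eLpNorm u (ENNReal.ofReal (critExp N m)) volume
      ≤ C * eLpNorm (fderiv ℝ u) (ENNReal.ofReal m) volume := by
  have hm0 : 0 < m := by linarith
  have hN : (0 : ℝ) < N := hm0.trans hmN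
  have hs0 := critExp_pos hm0 hmN
  set s := critExp N m with hs
  set C := SNormLESNormFDerivOfEqConst ℝ (volume : Measure (RN N)) (m.toNNReal : ℝ)
  refine ⟨C, fun u hu huL => ?_⟩
  obtain ⟨D, hD0, hD⟩ := exists_cutoff N
  choose η h1 h2 h3 h4 h5 h6 h7 using fun n : ℕ => hD ((n : ℝ) + 1) (by positivity)
  set X := eLpNorm (fderiv ℝ u) (ENNReal.ofReal m) volume
  set T : ℕ → ℝ≥0∞ := fun n => eLpNorm u (ENNReal.ofReal s)
      (volume.restrict {x : RN N | (n : ℝ) + 1 ≤ ‖x‖})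
  set κ := volume (Metric.closedBall (0 : RN N) 1)
  set D' : ℝ≥0∞ := ENNReal.ofReal (2 * D) * κ ^ (N : ℝ)⁻¹
  have hκ : κ ≠ ⊤ := (isCompact_closedBall _ _).measure_lt_top.ne
  have hD' : D' ≠ ⊤ := ENNReal.mul_ne_top ENNReal.ofReal_ne_top
    (ENNReal.rpow_ne_top_of_nonneg (by positivity) hκ)
  have bound : ∀ n, eLpNorm (fun x => η n x * u x) (ENNReal.ofReal s) volume
      ≤ C * (X + D' * T n) := by
    intro n
    have hn : (0 : ℝ) < n + 1 := by positivity
    set ρ : ℝ := n + 1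
    have hcd : ContDiff ℝ ∞ (fun x => η n x * u x) := (h1 n).mul hu
    have g1 : eLpNorm (fun x => η n x * u x) (ENNReal.ofReal s) volume
        ≤ C * eLpNorm (fderiv ℝ fun x => η n x * u x) (ENNReal.ofReal m) volume :=
      eLpNorm_le_eLpNorm_fderiv_of_eq (volume : Measure (RN N)) (u := fun x => η n x * u x)
      (p := m.toNNReal) (p' := s.toNNReal) (hcd.of_le (by simp)) (h2 n).mul_right
      (by simpa using hm) (by simpa using hN)
      (by rw [NNReal.coe_inv, Real.coe_toNNReal _ hm0.le, Real.coe_toNNReal _ hs0.le, finrank_euclideanSpace_fin]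
          exact critExp_inv hm0 hmN)
    refine g1.trans ?_
    refine mul_le_mul_right ?_ _
    exact eLpNorm_fderiv_cutoff_le hm hmN hn hu (h1 n) (h3 n) (h5 n) (h6 n) (h7 n)
  have lim : Tendsto (fun n => C * (X + D' * T n)) atTop (𝓝 (C * X)) := by
    have hT := eLpNorm_tail_tendsto_zero hs0 huL
    have t1 := ENNReal.Tendsto.const_mul (a := D') hT (Or.inr hD')
    have t2 := ENNReal.Tendsto.const_mul (a := (C : ℝ≥0∞)) (t1.const_add X)
      (Or.inr ENNReal.coe_ne_top)
    simpa using t2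
  have fatou : eLpNorm u (ENNReal.ofReal s) volume
      ≤ atTop.liminf fun n => eLpNorm (fun x => η n x * u x) (ENNReal.ofReal s) volume := by
    refine Lp.eLpNorm_lim_le_liminf_eLpNorm
      (fun n => ((h1 n).continuous.mul hu.continuous).aestronglyMeasurable) u
      (ae_of_all _ fun x => ?_)
    refine tendsto_const_nhds.congr' ?_
    filter_upwards [(tendsto_natCast_atTop_atTop (R := ℝ)).eventually_ge_atTop ‖x‖] with n hn
    rw [Pi.mul_apply, h4 n x (by linarith), one_mul]
  refine fatou.trans ?_
  rw [← lim.liminf_eq]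
  exact liminf_le_liminf (Eventually.of_forall bound)

/-- Mollification increases neither norm, so the smooth case passes to the limit by Fatou's lemma.
-/
theorem sobolev_eLpNorm {m : ℝ} (hm : 1 ≤ m) (hmN : m < N) : ∃ C : ℝ≥0, ∀ (u : RN N → ℝ)
    (G : RN N → RN N), HasWeakGradient u G → MemLp u (ENNReal.ofReal (critExp N m)) →
    eLpNorm u (ENNReal.ofReal (critExp N m)) volume
      ≤ C * eLpNorm G (ENNReal.ofReal m) volume := by
  obtain ⟨C, hC⟩ := sobolev_smooth hm hmN
  have hm0 : 0 < m := by linarith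
  have hs1 : 1 ≤ critExp N m := hm.trans (lt_critExp hm0 hmN).le
  refine ⟨C, fun u G h hu => ?_⟩
  have hn : ∀ n, eLpNorm (moll n u) (ENNReal.ofReal (critExp N m)) volume
      ≤ C * eLpNorm G (ENNReal.ofReal m) volume := by
    intro n
    have hsm := contDiff_moll n h.1
    have hL : MemLp (moll n u) (ENNReal.ofReal (critExp N m)) :=
      ⟨hsm.continuous.aestronglyMeasurable, (eLpNorm_moll_le n hu.1 hs1).trans_lt hu.2⟩
    refine (hC _ hsm hL).trans (mul_le_mul_right ?_ _)
    have hGm := h.2.1.aestronglyMeasurable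
    calc _ ≤ eLpNorm (moll n fun y => ‖G y‖) (ENNReal.ofReal m) volume :=
          eLpNorm_mono_real fun x => norm_fderiv_moll_le n h x
      _ ≤ eLpNorm (fun y => ‖G y‖) (ENNReal.ofReal m) volume := eLpNorm_moll_le n hGm.norm hm
      _ = _ := eLpNorm_norm G
  refine (Lp.eLpNorm_lim_le_liminf_eLpNorm
    (fun n => (contDiff_moll n h.1).continuous.aestronglyMeasurable) u (moll_tendsto_ae h.1)).trans ?_
  refine (liminf_le_liminf (Eventually.of_forall hn)).trans ?_
  simp

theorem eLpNorm_toReal_rpow {F : Type*} [NormedAddCommGroup F] {s : ℝ} (hs : 0 < s) {f : RN N → F}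
    (hf : MemLp f (ENNReal.ofReal s)) :
    (eLpNorm f (ENNReal.ofReal s) volume).toReal = (∫ x, ‖f x‖ ^ s) ^ (1 / s) := by
  rw [hf.eLpNorm_eq_integral_rpow_norm (by simpa using hs) ENNReal.ofReal_ne_top,
    ENNReal.toReal_ofReal hs.le, ENNReal.toReal_ofReal (by positivity), one_div]

/-- The Sobolev inequality on `D^{1,m}`. -/
theorem sobolev {m : ℝ} (hm : 1 ≤ m) (hmN : m < N) : ∃ S : ℝ, 0 < S ∧ ∀ (u : RN N → ℝ)
    (G : RN N → RN N), HasWeakGradient u G → MemLp u (ENNReal.ofReal (critExp N m)) →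
    MemLp G (ENNReal.ofReal m) →
    ∫ x, |u x| ^ critExp N m ≤ S * (∫ x, ‖G x‖ ^ m) ^ (critExp N m / m) := by
  obtain ⟨C, hC⟩ := sobolev_eLpNorm hm hmN
  have hm0 : 0 < m := by linarith
  have hs0 := critExp_pos hm0 hmN
  refine ⟨((C : ℝ) + 1) ^ critExp N m, by positivity, fun u G h hu hG => ?_⟩
  have h1 := ENNReal.toReal_mono (ENNReal.mul_ne_top ENNReal.coe_ne_top hG.2.ne) (hC u G h hu)
  rw [ENNReal.toReal_mul, eLpNorm_toReal_rpow hs0 hu, eLpNorm_toReal_rpow hm0 hG,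
    ENNReal.coe_toReal] at h1
  have i1 : 0 ≤ ∫ x, ‖u x‖ ^ critExp N m := integral_nonneg fun x => by positivity
  have i2 : 0 ≤ ∫ x, ‖G x‖ ^ m := integral_nonneg fun x => by positivity
  have h2 := Real.rpow_le_rpow (by positivity) h1 hs0.le
  rw [← Real.rpow_mul i1, one_div_mul_cancel hs0.ne', Real.rpow_one,
    Real.mul_rpow (by positivity) (by positivity), ← Real.rpow_mul i2] at h2
  simp only [Real.norm_eq_abs] at h2
  refine h2.trans ?_
  rw [one_div_mul_eq_div]
  gcongr
  linarith

/-! ### Growth of the nonlinearity and of its primitive. -/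

section Nonlinearity

variable {p θ τ : ℝ} {f : ℝ → ℝ}

/-- The critical power gives integrability of f(u)u and F(u) for u in L^{p*}; the subcritical one
drives the De Giorgi iteration. Since τ < p*, the critical bound is the stronger one near 0 and the
subcritical one at infinity, and a compact interval remains. -/
theorem NonlinearityHyp.growth (hf : NonlinearityHyp N p θ τ f) (hp : 2 ≤ p) :
    ∃ C : ℝ, 0 < C ∧ ∀ s, 0 < s → f s ≤ C * s ^ (τ - 1) ∧ f s ≤ C * s ^ (critExp N p - 1) := by
  have hτ : 1 < τ := by linarith [hf.p_lt_τ]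
  have hs : 1 < critExp N p := by linarith [hf.τ_lt]
  have key : ∀ s r : ℝ, 0 < s → s * f s / s ^ r = f s / s ^ (r - 1) := by
    intro s r h0
    rw [Real.rpow_sub_one h0.ne']
    field_simp
  obtain ⟨K, hK1, hK2⟩ := EReal.lt_iff_exists_real_btwn.1 hf.f1
  have ev1 := eventually_lt_of_limsup_lt hK1
  rw [eventually_nhdsWithin_iff, Metric.eventually_nhds_iff] at ev1
  obtain ⟨δ, hδ, h1⟩ := ev1
  have ev2 := eventually_lt_of_limsup_lt (hf.f2.trans_lt zero_lt_one)
  obtain ⟨L, hL⟩ := eventually_atTop.1 ev2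
  set δ' := min (δ / 2) 1
  set L' := max L 1
  have hδ' : 0 < δ' := by positivity
  obtain ⟨B, hB⟩ := (isCompact_Icc (a := δ') (b := L')).exists_bound_of_continuousOn
    hf.continuous.continuousOn
  have hB0 : ∀ s ∈ Icc δ' L', f s ≤ |B| := fun s hs =>
    (le_abs_self _).trans ((hB s hs).trans (le_abs_self _))
  refine ⟨|K| + 1 + |B| * (1 / δ' ^ (τ - 1) + 1 / δ' ^ (critExp N p - 1)), by positivity,
    fun s hs0 => ?_⟩
  have hX : 0 ≤ |B| * (1 / δ' ^ (τ - 1)) := by positivity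
  have hY : 0 ≤ |B| * (1 / δ' ^ (critExp N p - 1)) := by positivity
  have hKabs := abs_nonneg K
  rw [mul_add]
  have pτ : 0 < s ^ (τ - 1) := by positivity
  have pc : 0 < s ^ (critExp N p - 1) := by positivity
  have hlt := hf.τ_lt
  rcases lt_or_ge s δ' with h | h
  · have hsδ : s < δ := by
      have : δ' ≤ δ / 2 := min_le_left _ _
      linarith
    have hs1 : s ≤ 1 := h.le.trans (min_le_right _ _)
    have := h1 (y := s) (by simpa [abs_of_pos hs0] using hsδ) hs0
    rw [key s _ hs0, EReal.coe_lt_coe_iff, div_lt_iff₀ pc] at this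
    have hcmp : s ^ (critExp N p - 1) ≤ s ^ (τ - 1) :=
      Real.rpow_le_rpow_of_exponent_ge hs0 hs1 (by linarith)
    have hKa := le_abs_self K
    constructor <;> nlinarith
  rcases lt_or_ge L' s with h' | h'
  · have hs1 : 1 ≤ s := (le_max_right _ _).trans h'.le
    have := hL s ((le_max_left _ _).trans h'.le)
    rw [key s _ hs0, ← EReal.coe_one, EReal.coe_lt_coe_iff, div_lt_iff₀ pτ] at this
    have hcmp : s ^ (τ - 1) ≤ s ^ (critExp N p - 1) :=
      Real.rpow_le_rpow_of_exponent_le hs1 (by linarith)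
    constructor <;> nlinarith
  · have hb := hB0 s ⟨h, h'⟩
    have c1 : δ' ^ (τ - 1) ≤ s ^ (τ - 1) := Real.rpow_le_rpow hδ'.le h (by linarith)
    have c2 : δ' ^ (critExp N p - 1) ≤ s ^ (critExp N p - 1) :=
      Real.rpow_le_rpow hδ'.le h (by linarith)
    have d1 : |B| ≤ |B| * (1 / δ' ^ (τ - 1)) * s ^ (τ - 1) := by
      rw [mul_assoc, one_div_mul_eq_div]
      exact le_mul_of_one_le_right (abs_nonneg _) ((one_le_div (by positivity)).2 c1)
    have d2 : |B| ≤ |B| * (1 / δ' ^ (critExp N p - 1)) * s ^ (critExp N p - 1) := by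
      rw [mul_assoc, one_div_mul_eq_div]
      exact le_mul_of_one_le_right (abs_nonneg _) ((one_le_div (by positivity)).2 c2)
    constructor <;> nlinarith [mul_nonneg hX pτ.le, mul_nonneg hY pτ.le, mul_nonneg hX pc.le,
      mul_nonneg hY pc.le, mul_nonneg hKabs pτ.le, mul_nonneg hKabs pc.le]

theorem NonlinearityHyp.hasDerivAt_primF (hf : NonlinearityHyp N p θ τ f) (s : ℝ) :
    HasDerivAt (primF f) (f s) s :=
  intervalIntegral.integral_hasDerivAt_right (hf.continuous.intervalIntegrable _ _)
    (hf.continuous.stronglyMeasurableAtFilter _ _) hf.continuous.continuousAt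

theorem NonlinearityHyp.continuous_primF (hf : NonlinearityHyp N p θ τ f) :
    Continuous (primF f) :=
  continuous_iff_continuousAt.2 fun s => (hf.hasDerivAt_primF s).continuousAt

theorem NonlinearityHyp.monotone_primF (hf : NonlinearityHyp N p θ τ f) : Monotone (primF f) :=
  monotone_of_hasDerivAt_nonneg (fun s => hf.hasDerivAt_primF s) fun s => hf.nonneg s

theorem NonlinearityHyp.primF_of_nonpos (hf : NonlinearityHyp N p θ τ f) {s : ℝ} (hs : s ≤ 0) :
    primF f s = 0 := by
  rw [primF, intervalIntegral.integral_congr (g := fun _ => 0)]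
  · simp
  · intro t ht
    rw [uIcc_of_ge hs] at ht
    exact hf.f4 t ht.2

theorem NonlinearityHyp.primF_nonneg (hf : NonlinearityHyp N p θ τ f) (s : ℝ) :
    0 ≤ primF f s := by
  rcases le_total s 0 with h | h
  · rw [hf.primF_of_nonpos h]
  · rw [← hf.primF_of_nonpos le_rfl]
    exact hf.monotone_primF h

/-- By the Ambrosetti-Rabinowitz condition, t ↦ t^{-θ}F(ts) is nondecreasing for s > 0; compare t =
1 with t = d. -/
theorem NonlinearityHyp.rpow_mul_primF_le (hf : NonlinearityHyp N p θ τ f) (s : ℝ)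
    {d : ℝ} (hd : 1 ≤ d) : d ^ θ * primF f s ≤ primF f (d * s) := by
  rcases le_or_gt s 0 with h | h
  · rw [hf.primF_of_nonpos h, mul_zero]
    exact hf.primF_nonneg _
  have hder : ∀ t : ℝ, 0 < t → HasDerivAt (fun t => t ^ (-θ) * primF f (t * s))
      (-θ * t ^ (-θ - 1) * primF f (t * s) + t ^ (-θ) * (f (t * s) * s)) t := by
    intro t ht
    have h1 : HasDerivAt (fun t : ℝ => t * s) s t := by
      simpa using (hasDerivAt_id t).mul_const s
    have h2 : HasDerivAt (fun t => primF f (t * s)) _ t :=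
      HasDerivAt.comp t (h₂ := primF f) (hf.hasDerivAt_primF (t * s)) h1
    exact (Real.hasDerivAt_rpow_const (Or.inl ht.ne')).mul h2
  have hmono : MonotoneOn (fun t => t ^ (-θ) * primF f (t * s)) (Ioi 0) := by
    refine monotoneOn_of_deriv_nonneg (convex_Ioi 0)
      (fun t ht => (hder t ht).continuousAt.continuousWithinAt)
      (fun t ht => ?_) fun t ht => ?_
    · rw [interior_Ioi] at ht
      exact (hder t ht).differentiableAt.differentiableWithinAt
    · rw [interior_Ioi] at ht
      have ht' : 0 < t := ht
      rw [(hder t ht).deriv]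
      have h3 := (hf.f3 (t * s) (by positivity)).2
      have e1 : t ^ (-θ) = t * t ^ (-θ - 1) := by
        rw [Real.rpow_sub_one ht'.ne']
        field_simp
      rw [e1]
      have e2 : -θ * t ^ (-θ - 1) * primF f (t * s) + t * t ^ (-θ - 1) * (f (t * s) * s)
        = t ^ (-θ - 1) * (t * s * f (t * s) - θ * primF f (t * s)) := by ring
      rw [e2]
      exact mul_nonneg (by positivity) (by linarith)
  have h4 := hmono (mem_Ioi.2 zero_lt_one) (mem_Ioi.2 (by linarith : 0 < d)) hd
  simp only [Real.one_rpow, one_mul] at h4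
  have hd0 : 0 < d := by linarith
  rw [Real.rpow_neg hd0.le, ← div_eq_inv_mul, le_div_iff₀ (by positivity)] at h4
  linarith

theorem mul_le_rpow_of_growth {C s : ℝ}
    (hC : ∀ s, 0 < s → f s ≤ C * s ^ (τ - 1) ∧ f s ≤ C * s ^ (critExp N p - 1)) (hs : 0 < s) :
    s * f s ≤ C * s ^ critExp N p := by
  have h := mul_le_mul_of_nonneg_left (hC s hs).2 hs.le
  rw [Real.rpow_sub_one hs.ne'] at h
  refine h.trans (le_of_eq ?_)
  field_simp

theorem NonlinearityHyp.primF_le (hf : NonlinearityHyp N p θ τ f) (hp : 2 ≤ p) {C : ℝ}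
    (hC0 : 0 < C)
    (hC : ∀ s, 0 < s → f s ≤ C * s ^ (τ - 1) ∧ f s ≤ C * s ^ (critExp N p - 1)) (s : ℝ) :
    primF f s ≤ C * |s| ^ critExp N p := by
  rcases le_or_gt s 0 with h | h
  · rw [hf.primF_of_nonpos h]; positivity
  · have h1 := (hf.f3 s h).2
    have h2 := mul_le_rpow_of_growth hC h
    have h3 := hf.primF_nonneg s
    have h4 := hf.p_lt_θ
    rw [abs_of_pos h]
    nlinarith

end Nonlinearity

/-! ### Energies of linear combinations, and a path in a two-dimensional cone. -/

theorem memLp_integrable_rpow {F : Type*} [NormedAddCommGroup F] {s : ℝ} (hs : 0 < s)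
    {u : RN N → F} (hu : MemLp u (ENNReal.ofReal s)) : Integrable fun x => ‖u x‖ ^ s := by
  have := hu.integrable_norm_rpow (by simpa using hs) ENNReal.ofReal_ne_top
  rwa [ENNReal.toReal_ofReal hs.le] at this

theorem MemD.hasWeakGradient {m : ℝ} {u : RN N → ℝ} (h : MemD m u) :
    HasWeakGradient u (weakGrad u) := by
  obtain ⟨G, hG, -⟩ := h.2
  exact hG.congr .rfl hG.weakGrad_ae_eq.symm

theorem MemD.memLp_weakGrad {m : ℝ} {u : RN N → ℝ} (h : MemD m u) :
    MemLp (weakGrad u) (ENNReal.ofReal m) := by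
  obtain ⟨G, hG, hL⟩ := h.2
  exact hL.ae_eq hG.weakGrad_ae_eq.symm

theorem MemD.linear_comb {m : ℝ} {u v : RN N → ℝ} (hu : MemD m u) (hv : MemD m v) (c d : ℝ) :
    MemD m fun x => c * u x + d * v x :=
  ⟨(hu.1.const_mul c).add (hv.1.const_mul d), _,
    hu.hasWeakGradient.linear_comb hv.hasWeakGradient c d,
    (hu.memLp_weakGrad.const_smul c).add (hv.memLp_weakGrad.const_smul d)⟩

theorem spaceBall_linear_comb {p q : ℝ} {u v : RN N → ℝ} (hu : u ∈ spaceBall p q)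
    (hv : v ∈ spaceBall p q) (c d : ℝ) : (fun x => c * u x + d * v x) ∈ spaceBall p q := by
  refine ⟨hu.1.linear_comb hv.1 c d, hu.2.1.linear_comb hv.2.1 c d, ?_⟩
  filter_upwards [hu.2.2, hv.2.2] with x h1 h2 hx
  rw [h1 hx, h2 hx]; ring

/-- Bounding by the larger of the two norms keeps the constant equal to the power m of |c| + |d|, so
that energies grow at most like that power. -/
theorem norm_comb_rpow_le {F : Type*} [NormedAddCommGroup F] [NormedSpace ℝ F] {m : ℝ}
    (hm : 0 < m) (α β : F) (c d : ℝ) :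
    ‖c • α + d • β‖ ^ m ≤ (|c| + |d|) ^ m * (‖α‖ ^ m + ‖β‖ ^ m) := by
  have h1 : ‖c • α + d • β‖ ≤ (|c| + |d|) * max ‖α‖ ‖β‖ := by
    refine (norm_add_le _ _).trans ?_
    rw [norm_smul, norm_smul, add_mul, Real.norm_eq_abs, Real.norm_eq_abs]
    gcongr
    · exact le_max_left _ _
    · exact le_max_right _ _
  have h2 := Real.rpow_le_rpow (norm_nonneg _) h1 hm.le
  rw [Real.mul_rpow (by positivity) (by positivity)] at h2
  refine h2.trans (mul_le_mul_of_nonneg_left ?_ (by positivity))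
  rcases max_choice ‖α‖ ‖β‖ with h | h <;> rw [h]
  · have : 0 ≤ ‖β‖ ^ m := by positivity
    linarith
  · have : 0 ≤ ‖α‖ ^ m := by positivity
    linarith

/-- The `m`-energy of a linear combination. -/
theorem energy_comb_le {m : ℝ} (hm : 1 ≤ m) {V u v : RN N → ℝ} (hV : ∀ x, 0 ≤ V x)
    (hu : MemD m u) (hv : MemD m v) (iu : Integrable fun x => V x * |u x| ^ m)
    (iv : Integrable fun x => V x * |v x| ^ m) (c d : ℝ) :
    (∫ x, ‖weakGrad (fun x => c * u x + d * v x) x‖ ^ m) + ∫ x, V x * |c * u x + d * v x| ^ m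
      ≤ (|c| + |d|) ^ m * (((∫ x, ‖weakGrad u x‖ ^ m) + ∫ x, V x * |u x| ^ m)
        + ((∫ x, ‖weakGrad v x‖ ^ m) + ∫ x, V x * |v x| ^ m)) := by
  have hm0 : 0 < m := by linarith
  have hg := (hu.hasWeakGradient.linear_comb hv.hasWeakGradient c d).weakGrad_ae_eq
  have i1 := memLp_integrable_rpow hm0 hu.memLp_weakGrad
  have i2 := memLp_integrable_rpow hm0 hv.memLp_weakGrad
  have h1 : ∫ x, ‖weakGrad (fun x => c * u x + d * v x) x‖ ^ m
      ≤ (|c| + |d|) ^ m * ((∫ x, ‖weakGrad u x‖ ^ m) + ∫ x, ‖weakGrad v x‖ ^ m) := by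
    rw [← integral_add i1 i2, ← integral_const_mul]
    refine integral_mono_of_nonneg (ae_of_all _ fun x => by positivity)
      ((i1.add i2).const_mul _) ?_
    filter_upwards [hg] with x hx
    rw [hx]
    exact norm_comb_rpow_le hm0 _ _ c d
  have h2 : ∫ x, V x * |c * u x + d * v x| ^ m
      ≤ (|c| + |d|) ^ m * ((∫ x, V x * |u x| ^ m) + ∫ x, V x * |v x| ^ m) := by
    rw [← integral_add iu iv, ← integral_const_mul]
    refine integral_mono_of_nonneg (ae_of_all _ fun x => mul_nonneg (hV x) (by positivity))
      ((iu.add iv).const_mul _) (ae_of_all _ fun x => ?_)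
    have := mul_le_mul_of_nonneg_left (norm_comb_rpow_le hm0 (u x) (v x) c d) (hV x)
    simp only [smul_eq_mul, Real.norm_eq_abs] at this
    refine this.trans (le_of_eq ?_)
    ring
  linarith

/-- Powers of a higher order eventually dominate. -/
theorem exists_rpow_dominates {p q θ A B κ : ℝ} (hqp : q ≤ p) (hpθ : p < θ)
    (hB : 0 ≤ B) (hκ : 0 < κ) (L : ℝ) :
    ∃ T : ℝ, 1 ≤ T ∧ L ≤ T ∧ ∀ t, T ≤ t → A * t ^ p + B * t ^ q ≤ κ * t ^ θ := by
  have h := (tendsto_rpow_atTop (sub_pos.2 hpθ)).eventually_ge_atTop ((A + B) / κ)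
  obtain ⟨T, hT⟩ := eventually_atTop.1 h
  refine ⟨max (max T 1) L, (le_max_right _ _).trans (le_max_left _ _), le_max_right _ _,
    fun t ht => ?_⟩
  have ht1 : 1 ≤ t := (le_max_right T 1).trans ((le_max_left _ _).trans ht)
  have htT : T ≤ t := (le_max_left T 1).trans ((le_max_left _ _).trans ht)
  have ht0 : 0 < t := by linarith
  have h1 := hT t htT
  rw [div_le_iff₀ hκ] at h1
  have h2 : t ^ q ≤ t ^ p := Real.rpow_le_rpow_of_exponent_le ht1 hqp
  have h3 : t ^ θ = t ^ (θ - p) * t ^ p := by rw [← Real.rpow_add ht0]; ring_nf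
  have h4 : 0 < t ^ p := by positivity
  rw [h3]
  nlinarith

theorem memD_of_contDiff {m : ℝ} {u : RN N → ℝ} (hu : ContDiff ℝ 1 u)
    (hc : HasCompactSupport u) : MemD m u := by
  have hg : Continuous (gradient u) :=
    (InnerProductSpace.toDual ℝ (RN N)).symm.continuous.comp (hu.continuous_fderiv one_ne_zero)
  have hgc : HasCompactSupport (gradient u) :=
    (hc.fderiv ℝ).comp_left (g := (InnerProductSpace.toDual ℝ (RN N)).symm) (map_zero _)
  exact ⟨hu.continuous.memLp_of_hasCompactSupport hc, _, hasWeakGradient_of_contDiff hu,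
    hg.memLp_of_hasCompactSupport hgc⟩

/-- A bump function on the unit ball. -/
def unitBump (N : ℕ) : ContDiffBump (0 : RN N) where
  rIn := 1 / 2
  rOut := 1
  rIn_pos := by norm_num
  rIn_lt_rOut := by norm_num

theorem unitBump_mem_spaceBall (p q : ℝ) : (unitBump N : RN N → ℝ) ∈ spaceBall p q := by
  refine ⟨memD_of_contDiff (unitBump N).contDiff (unitBump N).hasCompactSupport,
    memD_of_contDiff (unitBump N).contDiff (unitBump N).hasCompactSupport,
    ae_of_all _ fun x hx => (unitBump N).zero_of_le_dist ?_⟩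
  simpa [unitBump] using hx

theorem norm1_comb_le {m : ℝ} (hm : 1 ≤ m) {V u v : RN N → ℝ} (hV : ∀ x, 0 ≤ V x)
    (hu : MemD m u) (hv : MemD m v) (iu : Integrable fun x => V x * |u x| ^ m)
    (iv : Integrable fun x => V x * |v x| ^ m) :
    ∃ K : ℝ, ∀ c d : ℝ, norm1 m V (fun x => c * u x + d * v x) ≤ (|c| + |d|) * K := by
  have hm0 : 0 < m := by linarith
  refine ⟨(((∫ x, ‖weakGrad u x‖ ^ m) + ∫ x, V x * |u x| ^ m)
        + ((∫ x, ‖weakGrad v x‖ ^ m) + ∫ x, V x * |v x| ^ m)) ^ (1 / m), fun c d => ?_⟩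
  have h := energy_comb_le hm hV hu hv iu iv c d
  have nn : ∀ w : RN N → ℝ, 0 ≤ (∫ x, ‖weakGrad w x‖ ^ m) + ∫ x, V x * |w x| ^ m := fun w =>
    add_nonneg (integral_nonneg fun x => by positivity)
      (integral_nonneg fun x => mul_nonneg (hV x) (by positivity))
  have h2 := Real.rpow_le_rpow (nn _) h (by positivity : 0 ≤ 1 / m)
  rw [Real.mul_rpow (by positivity) (add_nonneg (nn _) (nn _)), ← Real.rpow_mul (by positivity),
    mul_one_div_cancel hm0.ne', Real.rpow_one] at h2
  exact h2

theorem norm1_nonneg (m : ℝ) {V : RN N → ℝ} (hV : ∀ x, 0 ≤ V x) (w : RN N → ℝ) :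
    0 ≤ norm1 m V w :=
  Real.rpow_nonneg (add_nonneg (integral_nonneg fun x => by positivity)
    (integral_nonneg fun x => mul_nonneg (hV x) (by positivity))) _

/-- The first two coordinates of a broken line in the plane through
`(0,0)`, `(T,0)`, `(0,T)` and `(0,1)`. -/
theorem exists_broken_line {T : ℝ} (hT : 1 ≤ T) : ∃ c d : ℝ → ℝ, Continuous c ∧ Continuous d ∧
    c 0 = 0 ∧ d 0 = 0 ∧ c 1 = 0 ∧ d 1 = 1 ∧ ∀ t ∈ Icc (0 : ℝ) 1, 0 ≤ c t ∧ 0 ≤ d t ∧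
      (d t = 0 ∨ T ≤ c t + d t ∨ (c t = 0 ∧ 1 ≤ d t)) := by
  refine ⟨fun t => max 0 (min (3 * T * t) (T * (2 - 3 * t))),
    fun t => max 0 (min (T * (3 * t - 1)) (T * (3 - 3 * t) + 3 * t - 2)), by fun_prop, by fun_prop,
    ?_, ?_, ?_, ?_, fun t ht => ⟨le_max_left _ _, le_max_left _ _, ?_⟩⟩
  · simp
  · norm_num
    left; linarith
  · norm_num
    right; linarith
  · have : min (T * (3 * 1 - 1)) (T * (3 - 3 * 1) + 3 * 1 - 2) = 1 := by
      rw [min_eq_right (by nlinarith)]; ring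
    simp only [this]
    norm_num
  · obtain ⟨h0, h1⟩ := ht
    rcases le_or_gt t (1 / 3) with h | h
    · left
      exact max_eq_left ((min_le_left _ _).trans (by nlinarith))
    right
    rcases le_or_gt t (2 / 3) with h' | h'
    · left
      have e1 : min (3 * T * t) (T * (2 - 3 * t)) = T * (2 - 3 * t) :=
        min_eq_right (by nlinarith)
      have e2 : min (T * (3 * t - 1)) (T * (3 - 3 * t) + 3 * t - 2) = T * (3 * t - 1) :=
        min_eq_left (by nlinarith)
      have g1 := le_max_right 0 (min (3 * T * t) (T * (2 - 3 * t)))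
      have g2 := le_max_right 0 (min (T * (3 * t - 1)) (T * (3 - 3 * t) + 3 * t - 2))
      beta_reduce
      rw [e1] at g1 ⊢
      rw [e2] at g2 ⊢
      linarith
    · right
      have e2 : min (T * (3 * t - 1)) (T * (3 - 3 * t) + 3 * t - 2)
          = T * (3 - 3 * t) + 3 * t - 2 := min_eq_right (by nlinarith)
      refine ⟨max_eq_left ((min_le_right _ _).trans (by nlinarith)), ?_⟩
      beta_reduce
      rw [e2]
      exact le_trans (by nlinarith) (le_max_right _ _)

/-! ### Uniform bound on the mountain-pass level. -/

section MountainPass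

variable {p q θ τ aInf bInf R : ℝ} {f : ℝ → ℝ} {a b : RN N → ℝ}

/-- As R > 1, the unit ball lies in the unpenalized region. This is the source of independence from
`R`. -/
theorem energyJ_of_mem_spaceBall (hR : 1 < R) {w : RN N → ℝ} (hw : w ∈ spaceBall p q) :
    energyJ p q θ R f a b w
      = 1 / p * ((∫ x, ‖weakGrad w x‖ ^ p) + ∫ x, a x * |w x| ^ p)
        + 1 / q * ((∫ x, ‖weakGrad w x‖ ^ q) + ∫ x, b x * |w x| ^ q) - ∫ x, primF f (w x) := by
  have : ∫ x, ∫ s in (0 : ℝ)..(w x), penal p θ R f a x s = ∫ x, primF f (w x) := by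
    refine integral_congr_ae ?_
    filter_upwards [hw.2.2] with x hx
    by_cases hb : x ∈ Metric.ball (0 : RN N) 1
    · have hxR : ‖x‖ ≤ R := by
        simp only [Metric.mem_ball, dist_zero_right] at hb
        linarith
      simp [penal, hxR, primF]
    · simp [hx hb, primF]
  rw [energyJ, this]
  ring

theorem integrable_primF_comp (hf : NonlinearityHyp N p θ τ f) (hp : 2 ≤ p) (hpN : p < N)
    {w : RN N → ℝ} (hw : MemLp w (ENNReal.ofReal (critExp N p))) :
    Integrable fun x => primF f (w x) := by
  obtain ⟨C, hC0, hC⟩ := hf.growth hp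
  refine ((memLp_integrable_rpow (critExp_pos (by linarith) hpN) hw).const_mul C).mono'
    (hf.continuous_primF.comp_aestronglyMeasurable hw.1) (ae_of_all _ fun x => ?_)
  rw [Real.norm_eq_abs, abs_of_nonneg (hf.primF_nonneg _)]
  exact hf.primF_le hp hC0 hC _

/-- Lower bound for `∫ F(w)` through the measure of a superlevel set. -/
theorem primF_mul_measure_le (hf : NonlinearityHyp N p θ τ f) {w : RN N → ℝ}
    (hw : Integrable fun x => primF f (w x)) {P : Set (RN N)} {t : ℝ} (hP : ∀ x ∈ P, t ≤ w x) :
    primF f t * volume.real P ≤ ∫ x, primF f (w x) := by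
  rcases (hf.primF_nonneg t).eq_or_lt with h | h
  · rw [← h, zero_mul]
    exact integral_nonneg fun x => hf.primF_nonneg _
  · refine le_trans ?_ (mul_meas_ge_le_integral_of_nonneg (ae_of_all _ fun x => hf.primF_nonneg _)
      hw (primF f t))
    refine mul_le_mul_of_nonneg_left (measureReal_mono (fun x hx => ?_)
      (hw.measure_ge_lt_top h).ne) h.le
    exact hf.monotone_primF (hP x hx)

theorem primF_scale_ge (hf : NonlinearityHyp N p θ τ f) {s₀ t : ℝ} (hs₀ : 0 < s₀) (ht : s₀ ≤ t) :
    (t / s₀) ^ θ * primF f s₀ ≤ primF f t := by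
  have := hf.rpow_mul_primF_le s₀ ((one_le_div hs₀).2 ht)
  rwa [div_mul_cancel₀ _ hs₀.ne'] at this

/-- The energy along a linear combination with large coefficients is nonpositive. -/
theorem exists_energy_comb_nonpos (hq : 2 ≤ q) (hqp : q ≤ p) (hpN : p < N)
    (hf : NonlinearityHyp N p θ τ f) {s₀ : ℝ} (hs₀ : 0 < s₀) (hF : 0 < primF f s₀)
    (ha : ∀ x, 0 ≤ a x) (hb : ∀ x, 0 ≤ b x)
    (hE : spaceBall p q ⊆ spaceE p q a b) (hR : 1 < R) {v e : RN N → ℝ} (hv : v ∈ spaceBall p q)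
    (he : e ∈ spaceBall p q) (hvpos : ∀ x ∈ Metric.ball (0 : RN N) 1, 0 < v x)
    (hJ : energyJ p q θ R f a b e < 0) :
    ∃ T : ℝ, 1 ≤ T ∧ ∀ c d : ℝ, 0 ≤ c → 0 ≤ d → T ≤ c + d →
      energyJ p q θ R f a b (fun x => c * v x + d * e x) ≤ 0 := by
  have hp : 2 ≤ p := hq.trans hqp
  have nn : ∀ (m : ℝ) (V : RN N → ℝ), (∀ x, 0 ≤ V x) → ∀ w : RN N → ℝ,
      0 ≤ (∫ x, ‖weakGrad w x‖ ^ m) + ∫ x, V x * |w x| ^ m := fun m V hV w =>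
    add_nonneg (integral_nonneg fun x => by positivity)
      (integral_nonneg fun x => mul_nonneg (hV x) (by positivity))
  -- If no such δ existed then e ≤ 0 almost everywhere, as v > 0 on the ball. Then ∫F(e) = 0 and
  -- J(e) ≥ 0, against `hJ`.
  obtain ⟨δ, hδ, hPδ⟩ : ∃ δ : ℝ, 0 < δ ∧ volume {x | δ ≤ v x ∧ δ ≤ e x} ≠ 0 := by
    by_contra! hcon
    have h0 : ∀ᵐ x, ∀ n : ℕ, ¬ ((1 : ℝ) / (n + 1) ≤ v x ∧ 1 / ((n : ℝ) + 1) ≤ e x) := by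
      rw [ae_all_iff]
      intro n
      have := hcon (1 / ((n : ℝ) + 1)) (by positivity)
      rw [measure_eq_zero_iff_ae_notMem] at this
      exact this
    have h1 : ∀ᵐ x, e x ≤ 0 := by
      filter_upwards [h0, he.2.2] with x hx hxe
      by_contra hpos
      rw [not_le] at hpos
      have hxb : x ∈ Metric.ball (0 : RN N) 1 := by
        by_contra hxb
        rw [hxe hxb] at hpos
        exact lt_irrefl _ hpos
      obtain ⟨n, hn⟩ := exists_nat_one_div_lt (lt_min (hvpos x hxb) hpos)
      exact hx n ⟨hn.le.trans (min_le_left _ _), hn.le.trans (min_le_right _ _)⟩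
    have h2 : ∫ x, primF f (e x) = 0 := by
      refine integral_eq_zero_of_ae ?_
      filter_upwards [h1] with x hx
      exact hf.primF_of_nonpos hx
    rw [energyJ_of_mem_spaceBall hR he, h2, sub_zero] at hJ
    have := nn p a ha e
    have := nn q b hb e
    have : 0 ≤ 1 / p * ((∫ x, ‖weakGrad e x‖ ^ p) + ∫ x, a x * |e x| ^ p)
        + 1 / q * ((∫ x, ‖weakGrad e x‖ ^ q) + ∫ x, b x * |e x| ^ q) := by positivity
    linarith
  set P := {x | δ ≤ v x ∧ δ ≤ e x}
  have hPfin : volume P ≠ ⊤ := by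
    have : (P : Set (RN N)) ≤ᵐ[volume] (Metric.ball 0 1 : Set (RN N)) := by
      filter_upwards [he.2.2] with x hx hxP
      by_contra hxb
      have h1 := hxP.2
      rw [hx hxb] at h1
      linarith
    exact ((measure_mono_ae this).trans_lt measure_ball_lt_top).ne
  have hPpos : 0 < volume.real P := ENNReal.toReal_pos hPδ hPfin
  set Kp := ((∫ x, ‖weakGrad v x‖ ^ p) + ∫ x, a x * |v x| ^ p)
    + ((∫ x, ‖weakGrad e x‖ ^ p) + ∫ x, a x * |e x| ^ p)
  set Kq := ((∫ x, ‖weakGrad v x‖ ^ q) + ∫ x, b x * |v x| ^ q)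
    + ((∫ x, ‖weakGrad e x‖ ^ q) + ∫ x, b x * |e x| ^ q)
  have hKq : 0 ≤ Kq := add_nonneg (nn q b hb _) (nn q b hb _)
  -- On P, cv + de ≥ (c + d)δ, so once this exceeds s₀ the θ-scaling gives ∫F ≥ κ(c + d)^θ. The
  -- threshold s₀/δ passed to `exists_rpow_dominates` ensures that.
  set κ := (δ / s₀) ^ θ * primF f s₀ * volume.real P
  have hκ : 0 < κ := by positivity
  obtain ⟨T, hT1, hTL, hT⟩ := exists_rpow_dominates (A := 1 / p * Kp) (B := 1 / q * Kq) hqp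
    hf.p_lt_θ (by positivity) hκ (s₀ / δ)
  refine ⟨T, hT1, fun c d hc hd hcd => ?_⟩
  have hvE := hE hv
  have heE := hE he
  have hw := spaceBall_linear_comb hv he c d
  rw [energyJ_of_mem_spaceBall hR hw]
  have e1 := energy_comb_le (by linarith) ha hv.1 he.1 hvE.2.2.1 heE.2.2.1 c d
  have e2 := energy_comb_le (by linarith) hb hv.2.1 he.2.1 hvE.2.2.2 heE.2.2.2 c d
  rw [abs_of_nonneg hc, abs_of_nonneg hd] at e1 e2
  set l := c + d
  have hl : 0 < l := by linarith
  have e3 : primF f (l * δ) * volume.real P ≤ ∫ x, primF f (c * v x + d * e x) := by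
    refine primF_mul_measure_le hf (integrable_primF_comp hf hp hpN hw.1.1) fun x hx => ?_
    have := mul_le_mul_of_nonneg_left hx.1 hc
    have := mul_le_mul_of_nonneg_left hx.2 hd
    simp only [l]
    linarith
  have e4 : s₀ ≤ l * δ := by
    have := hTL.trans hcd
    rwa [div_le_iff₀ hδ] at this
  have e5 := primF_scale_ge hf hs₀ e4
  have e6 : κ * l ^ θ ≤ ∫ x, primF f (c * v x + d * e x) := by
    refine le_trans (le_of_eq ?_) ((mul_le_mul_of_nonneg_right e5 hPpos.le).trans e3)
    rw [mul_div_assoc, Real.mul_rpow hl.le (by positivity)]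
    simp only [κ]
    ring
  have e7 := hT l hcd
  have e8 := mul_le_mul_of_nonneg_left e1 (by positivity : 0 ≤ 1 / p)
  have e9 := mul_le_mul_of_nonneg_left e2 (by positivity : 0 ≤ 1 / q)
  have e10 : 1 / p * (l ^ p * Kp) + 1 / q * (l ^ q * Kq) ≤ κ * l ^ θ := by
    refine le_trans (le_of_eq ?_) e7
    ring
  linarith

/-- In fact J(de) ≤ d^p J(e): the quadratic-type terms grow at most like d^p because q ≤ p, while
∫F(de) grows at least like d^θ ≥ d^p. -/
theorem energyJ_smul_le_zero (hq : 2 ≤ q) (hqp : q ≤ p) (hpN : p < N)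
    (hf : NonlinearityHyp N p θ τ f) (hb : ∀ x, 0 ≤ b x) (hR : 1 < R) {e : RN N → ℝ}
    (he : e ∈ spaceBall p q) (hJ : energyJ p q θ R f a b e < 0) {d : ℝ} (hd : 1 ≤ d) :
    energyJ p q θ R f a b (fun x => d * e x) ≤ 0 := by
  have hp : 2 ≤ p := hq.trans hqp
  have hd0 : 0 < d := by linarith
  have hw : (fun x => d * e x) ∈ spaceBall p q := by
    simpa using spaceBall_linear_comb he he d 0
  have hg : weakGrad (fun x => d * e x) =ᵐ[volume] fun x => d • weakGrad e x := by
    have := (he.1.hasWeakGradient.linear_comb he.1.hasWeakGradient d 0).weakGrad_ae_eq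
    simpa using this
  have hgm : ∀ m : ℝ, ∫ x, ‖weakGrad (fun x => d * e x) x‖ ^ m
      = d ^ m * ∫ x, ‖weakGrad e x‖ ^ m := by
    intro m
    rw [← integral_const_mul]
    refine integral_congr_ae ?_
    filter_upwards [hg] with x hx
    rw [hx, norm_smul, Real.norm_eq_abs, abs_of_pos hd0, Real.mul_rpow hd0.le (norm_nonneg _)]
  have hVm : ∀ (m : ℝ) (V : RN N → ℝ), ∫ x, V x * |d * e x| ^ m
      = d ^ m * ∫ x, V x * |e x| ^ m := by
    intro m V
    rw [← integral_const_mul]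
    refine integral_congr_ae (ae_of_all _ fun x => ?_)
    simp only [abs_mul, abs_of_pos hd0]
    rw [Real.mul_rpow hd0.le (abs_nonneg _)]
    ring
  rw [energyJ_of_mem_spaceBall hR he] at hJ
  rw [energyJ_of_mem_spaceBall hR hw, hgm, hgm, hVm, hVm]
  have hFi := integrable_primF_comp hf hp hpN he.1.1
  have h1 : d ^ θ * ∫ x, primF f (e x) ≤ ∫ x, primF f (d * e x) := by
    rw [← integral_const_mul]
    exact integral_mono (hFi.const_mul _) (integrable_primF_comp hf hp hpN hw.1.1) fun x =>
      hf.rpow_mul_primF_le (e x) hd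
  have h2 : d ^ p ≤ d ^ θ := Real.rpow_le_rpow_of_exponent_le hd hf.p_lt_θ.le
  have h3 : d ^ q ≤ d ^ p := Real.rpow_le_rpow_of_exponent_le hd hqp
  have h4 : 0 ≤ ∫ x, primF f (e x) := integral_nonneg fun x => hf.primF_nonneg _
  have h5 : 0 ≤ 1 / q * ((∫ x, ‖weakGrad e x‖ ^ q) + ∫ x, b x * |e x| ^ q) :=
    mul_nonneg (by positivity) (add_nonneg (integral_nonneg fun x => by positivity)
      (integral_nonneg fun x => mul_nonneg (hb x) (by positivity)))
  have h6 : 0 < d ^ p := by positivity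
  nlinarith [mul_le_mul_of_nonneg_right h2 h4, mul_le_mul_of_nonneg_right h3 h5]

/-- The mountain-pass level is bounded independently of the penalization. -/
theorem exists_mpLevel_le (hq : 2 ≤ q) (hqp : q ≤ p) (hpN : p < N)
    (hf : NonlinearityHyp N p θ τ f) (haInf : 0 < aInf) (hbInf : 0 < bInf) :
    ∃ C₀ : ℝ, 0 ≤ C₀ ∧ ∀ (a b : RN N → ℝ) (Lam R₀ : ℝ), PotentialHyp p q aInf bInf Lam R₀ a b →
      ∀ R : ℝ, 1 < R → ∀ X : Set (RN N → ℝ), spaceBall p q ⊆ X → X ⊆ spaceE p q a b →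
      ∀ e ∈ spaceBall p q, energyJ p q θ R f a b e < 0 →
        mpLevel p q θ R f a b X e ≤ C₀ := by
  have hp : 2 ≤ p := hq.trans hqp
  have hp0 : 0 < p := by linarith
  have hq0 : 0 < q := by linarith
  have nn : ∀ (m : ℝ) (V : RN N → ℝ), (∀ x, 0 ≤ V x) → ∀ w : RN N → ℝ,
      0 ≤ (∫ x, ‖weakGrad w x‖ ^ m) + ∫ x, V x * |w x| ^ m := fun m V hV w =>
    add_nonneg (integral_nonneg fun x => by positivity)
      (integral_nonneg fun x => mul_nonneg (hV x) (by positivity))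
  -- If F vanishes identically, J ≥ 0 on functions supported in the ball, so no admissible `e`
  -- exists and any constant serves.
  by_cases hF : ∃ s₀, 0 < s₀ ∧ 0 < primF f s₀
  swap
  · refine ⟨0, le_rfl, fun a b Lam R₀ hab R hR X hX hXE e he hJ => ?_⟩
    exfalso
    push Not at hF
    have hF0 : ∀ s, primF f s = 0 := fun s => by
      rcases le_or_gt s 0 with h | h
      · exact hf.primF_of_nonpos h
      · exact le_antisymm (hF s h) (hf.primF_nonneg s)
    rw [energyJ_of_mem_spaceBall hR he] at hJ
    simp only [hF0, integral_zero, sub_zero] at hJ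
    have := nn p a hab.nonneg_a e
    have := nn q b hab.nonneg_b e
    have : 0 ≤ 1 / p * ((∫ x, ‖weakGrad e x‖ ^ p) + ∫ x, a x * |e x| ^ p)
        + 1 / q * ((∫ x, ‖weakGrad e x‖ ^ q) + ∫ x, b x * |e x| ^ q) := by positivity
    linarith
  obtain ⟨s₀, hs₀, hFs⟩ := hF
  set v : RN N → ℝ := ⇑(unitBump N)
  have hv : v ∈ spaceBall p q := unitBump_mem_spaceBall p q
  have hvc : Continuous v := (unitBump N).continuous
  have hvpos : ∀ x ∈ Metric.ball (0 : RN N) 1, 0 < v x := fun x hx =>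
    (unitBump N).pos_of_mem_ball hx
  have hv0 : ∀ x ∉ Metric.ball (0 : RN N) 1, v x = 0 := fun x hx =>
    (unitBump N).zero_of_le_dist (by simpa [unitBump] using hx)
  have iv : ∀ m : ℝ, 0 < m → Integrable fun x => |v x| ^ m := fun m hm =>
    memLp_integrable_rpow hm
      (hvc.memLp_of_hasCompactSupport (unitBump N).hasCompactSupport)
  set P : Set (RN N) := Metric.ball 0 (1 / 2)
  have hPpos : 0 < volume.real P :=
    ENNReal.toReal_pos (Metric.measure_ball_pos _ _ (by norm_num)).ne' measure_ball_lt_top.ne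
  have hvP : ∀ x ∈ P, v x = 1 := fun x hx =>
    (unitBump N).one_of_mem_closedBall (Metric.ball_subset_closedBall hx)
  set A := 1 / p * ((∫ x, ‖weakGrad v x‖ ^ p) + aInf * ∫ x, |v x| ^ p)
  set B := 1 / q * ((∫ x, ‖weakGrad v x‖ ^ q) + bInf * ∫ x, |v x| ^ q)
  have hA : 0 ≤ A := mul_nonneg (by positivity) (add_nonneg (integral_nonneg fun x => by positivity)
    (mul_nonneg haInf.le (integral_nonneg fun x => by positivity)))
  have hB : 0 ≤ B := mul_nonneg (by positivity) (add_nonneg (integral_nonneg fun x => by positivity)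
    (mul_nonneg hbInf.le (integral_nonneg fun x => by positivity)))
  set κ := (1 / s₀) ^ θ * primF f s₀ * volume.real P
  have hκ : 0 < κ := by positivity
  -- A, B, κ and hence T₀ involve only v, f and the bounds `aInf`, `bInf`; they are fixed before a,
  -- b, R and e appear.
  obtain ⟨T₀, hT1, hTL, hT⟩ := exists_rpow_dominates (A := A) (B := B) hqp hf.p_lt_θ hB hκ s₀
  have hC₀ : 0 ≤ A * T₀ ^ p + B * T₀ ^ q := by positivity
  refine ⟨A * T₀ ^ p + B * T₀ ^ q, hC₀, fun a b Lam R₀ hab R hR X hX hXE e he hJ => ?_⟩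
  have hE : spaceBall p q ⊆ spaceE p q a b := hX.trans hXE
  have ray : ∀ c : ℝ, 0 ≤ c → energyJ p q θ R f a b (fun x => c * v x)
      ≤ A * T₀ ^ p + B * T₀ ^ q := by
    intro c hc
    have hw : (fun x => c * v x) ∈ spaceBall p q := by
      simpa using spaceBall_linear_comb hv hv c 0
    have hg : weakGrad (fun x => c * v x) =ᵐ[volume] fun x => c • weakGrad v x := by
      have := (hv.1.hasWeakGradient.linear_comb hv.1.hasWeakGradient c 0).weakGrad_ae_eq
      simpa using this
    have hgm : ∀ (m : ℝ) (V : RN N → ℝ) (K : ℝ), 0 < m → (∀ x, 0 ≤ V x) →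
        (∀ x ∈ Metric.ball (0 : RN N) 1, V x ≤ K) →
        (∫ x, ‖weakGrad (fun x => c * v x) x‖ ^ m) + ∫ x, V x * |c * v x| ^ m
          ≤ c ^ m * ((∫ x, ‖weakGrad v x‖ ^ m) + K * ∫ x, |v x| ^ m) := by
      intro m V K hm hV0 hVK
      rw [mul_add]
      refine add_le_add (le_of_eq ?_) ?_
      · rw [← integral_const_mul]
        refine integral_congr_ae ?_
        filter_upwards [hg] with x hx
        rw [hx, norm_smul, Real.norm_eq_abs, abs_of_nonneg hc, Real.mul_rpow hc (norm_nonneg _)]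
      · rw [← integral_const_mul, ← integral_const_mul]
        refine integral_mono_of_nonneg (ae_of_all _ fun x => mul_nonneg (hV0 x) (by positivity))
          (((iv m hm).const_mul K).const_mul _) (ae_of_all _ fun x => ?_)
        simp only [abs_mul, abs_of_nonneg hc]
        rw [Real.mul_rpow hc (abs_nonneg _)]
        by_cases hx : x ∈ Metric.ball (0 : RN N) 1
        · have := mul_le_mul_of_nonneg_right (hVK x hx)
            (by positivity : 0 ≤ c ^ m * |v x| ^ m)
          linarith
        · rw [hv0 x hx, abs_zero, Real.zero_rpow hm.ne']
          simp
    rw [energyJ_of_mem_spaceBall hR hw]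
    have g1 := mul_le_mul_of_nonneg_left (hgm p a aInf hp0 hab.nonneg_a hab.a_le)
      (by positivity : 0 ≤ 1 / p)
    have g2 := mul_le_mul_of_nonneg_left (hgm q b bInf hq0 hab.nonneg_b hab.b_le)
      (by positivity : 0 ≤ 1 / q)
    have g3 : 1 / p * (c ^ p * ((∫ x, ‖weakGrad v x‖ ^ p) + aInf * ∫ x, |v x| ^ p))
        + 1 / q * (c ^ q * ((∫ x, ‖weakGrad v x‖ ^ q) + bInf * ∫ x, |v x| ^ q))
        = A * c ^ p + B * c ^ q := by
      simp only [A, B]; ring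
    -- Before T₀ the term ∫F ≥ 0 is discarded; beyond T₀ it outweighs the other terms and the energy
    -- is nonpositive.
    rcases le_total c T₀ with h | h
    · have g4 : 0 ≤ ∫ x, primF f (c * v x) := integral_nonneg fun x => hf.primF_nonneg _
      have g5 : A * c ^ p ≤ A * T₀ ^ p := by gcongr
      have g6 : B * c ^ q ≤ B * T₀ ^ q := by gcongr
      linarith
    · have g4 : primF f c * volume.real P ≤ ∫ x, primF f (c * v x) :=
        primF_mul_measure_le hf (integrable_primF_comp hf hp hpN hw.1.1) fun x hx => by
          rw [hvP x hx, mul_one]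
      have g5 := primF_scale_ge hf hs₀ (hTL.trans h)
      have g6 : κ * c ^ θ ≤ primF f c * volume.real P := by
        refine le_trans (le_of_eq ?_) (mul_le_mul_of_nonneg_right g5 hPpos.le)
        rw [div_eq_mul_one_div c, Real.mul_rpow hc (by positivity)]
        simp only [κ]
        ring
      have g7 := hT c h
      linarith
  obtain ⟨T, hT1', hTneg⟩ := exists_energy_comb_nonpos hq hqp hpN hf hs₀ hFs hab.nonneg_a
    hab.nonneg_b hE hR hv he hvpos hJ
  -- The three alternatives are the three legs: the ray of v, bounded by `ray`; the segment from Tv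
  -- to Te; and the ray of e from Te back to e. The last two have nonpositive energy.
  obtain ⟨c, d, hc, hd, c0, d0, c1, d1, hcd⟩ := exists_broken_line hT1'
  set γ : ℝ → RN N → ℝ := fun t x => c t * v x + d t * e x
  have hγE : ∀ t ∈ Icc (0 : ℝ) 1, energyJ p q θ R f a b (γ t) ≤ A * T₀ ^ p + B * T₀ ^ q := by
    intro t ht
    obtain ⟨h1, h2, h3 | h3 | ⟨h3, h4⟩⟩ := hcd t ht
    · have : γ t = fun x => c t * v x := by ext x; simp [γ, h3]
      rw [this]
      exact ray _ h1
    · exact (hTneg _ _ h1 h2 h3).trans hC₀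
    · have : γ t = fun x => d t * e x := by ext x; simp [γ, h3]
      rw [this]
      exact (energyJ_smul_le_zero hq hqp hpN hf hab.nonneg_b hR he hJ h4).trans hC₀
  have hγ : γ ∈ paths p q a b X e := by
    refine ⟨fun t _ => hX (spaceBall_linear_comb hv he _ _), fun t _ => ?_, ?_, ?_⟩
    · obtain ⟨K₁, hK₁⟩ := norm1_comb_le (by linarith) hab.nonneg_a hv.1 he.1 (hE hv).2.2.1
        (hE he).2.2.1
      obtain ⟨K₂, hK₂⟩ := norm1_comb_le (by linarith) hab.nonneg_b hv.2.1 he.2.1 (hE hv).2.2.2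
        (hE he).2.2.2
      have lim : Tendsto (fun s => (|c s - c t| + |d s - d t|) * K₁
          + (|c s - c t| + |d s - d t|) * K₂) (𝓝[Icc 0 1] t) (𝓝 0) := by
        have hcont : Continuous fun s => (|c s - c t| + |d s - d t|) * K₁
          + (|c s - c t| + |d s - d t|) * K₂ := by fun_prop
        have := hcont.tendsto t
        simp only [sub_self, abs_zero, add_zero, zero_mul] at this
        exact this.mono_left nhdsWithin_le_nhds
      refine tendsto_of_tendsto_of_tendsto_of_le_of_le tendsto_const_nhds lim
        (fun s => add_nonneg (norm1_nonneg p hab.nonneg_a _) (norm1_nonneg q hab.nonneg_b _))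
        fun s => ?_
      have : γ s - γ t = fun x => (c s - c t) * v x + (d s - d t) * e x := by
        ext x
        simp only [γ, Pi.sub_apply]
        ring
      simp only [normE, this]
      exact add_le_add (hK₁ _ _) (hK₂ _ _)
    · exact ae_of_all _ fun x => by simp [γ, c0, d0]
    · exact ae_of_all _ fun x => by simp [γ, c1, d1]
  have hmax : sSup ((fun t => energyJ p q θ R f a b (γ t)) '' Icc (0 : ℝ) 1)
      ≤ A * T₀ ^ p + B * T₀ ^ q := by
    refine csSup_le (Nonempty.image _ ⟨0, by simp⟩) ?_
    rintro _ ⟨t, ht, rfl⟩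
    exact hγE t ht
  refine le_trans (csInf_le ?_ (mem_image_of_mem _ hγ)) hmax
  -- The infimum is usable only if the path maxima are bounded below; they are nonnegative because J
  -- vanishes at the starting point, which is zero almost everywhere.
  refine ⟨0, ?_⟩
  rintro _ ⟨γ', hγ', rfl⟩
  simp only
  have hz : energyJ p q θ R f a b (γ' 0) = 0 := by
    have h0 := hγ'.2.2.1
    have hg : weakGrad (γ' 0) =ᵐ[volume] fun _ => (0 : RN N) :=
      ((hasWeakGradient_const (0 : ℝ)).congr h0.symm .rfl).weakGrad_ae_eq
    have i1 : ∀ m : ℝ, 0 < m → ∫ x, ‖weakGrad (γ' 0) x‖ ^ m = 0 := fun m hm => by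
      refine integral_eq_zero_of_ae ?_
      filter_upwards [hg] with x hx
      simp [hx, Real.zero_rpow hm.ne']
    have i2 : ∀ (m : ℝ) (V : RN N → ℝ), 0 < m → ∫ x, V x * |γ' 0 x| ^ m = 0 := fun m V hm => by
      refine integral_eq_zero_of_ae ?_
      filter_upwards [h0] with x hx
      simp [hx, Real.zero_rpow hm.ne']
    have i3 : ∫ x, ∫ s in (0 : ℝ)..(γ' 0 x), penal p θ R f a x s = 0 := by
      refine integral_eq_zero_of_ae ?_
      filter_upwards [h0] with x hx
      simp [hx]
    simp only [energyJ, i1 p hp0, i1 q hq0, i2 p a hp0, i2 q b hq0, i3]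
    simp
  by_cases hbd : BddAbove ((fun t => energyJ p q θ R f a b (γ' t)) '' Icc (0 : ℝ) 1)
  · refine le_csSup hbd ⟨0, by simp, hz⟩
  -- An unbounded set of reals has supremum 0 by convention, so the lower bound 0 survives.
  · rw [Real.sSup_of_not_bddAbove hbd]

end MountainPass

/-! ### The penalized nonlinearity and the gradient bound. -/

section Penalization

variable {p q θ τ R : ℝ} {f : ℝ → ℝ} {a b : RN N → ℝ}

theorem penal_of_norm_le {x : RN N} (hx : ‖x‖ ≤ R) (t : ℝ) : penal p θ R f a x t = f t := by
  simp [penal, hx]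

theorem penal_of_lt_norm {x : RN N} (hx : R < ‖x‖) (t : ℝ) : penal p θ R f a x t
    = min (f t) (a x / (θ * p / (θ - p)) * (|t| ^ (p - 2) * t)) := by
  simp [penal, not_le.2 hx, min_def]

theorem continuous_abs_rpow_mul {m : ℝ} (hm : 2 ≤ m) :
    Continuous fun t : ℝ => |t| ^ (m - 2) * t :=
  (continuous_abs.rpow_const fun _ => Or.inr (by linarith)).mul continuous_id

theorem abs_rpow_mul_self {m t : ℝ} (hm : 2 ≤ m) : |t| ^ (m - 2) * t * t = |t| ^ m := by
  rcases eq_or_ne t 0 with rfl | ht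
  · simp [Real.zero_rpow (by linarith : m ≠ 0)]
  · have h0 : 0 < |t| := abs_pos.2 ht
    rw [mul_assoc, ← abs_mul_abs_self t, ← pow_two, ← Real.rpow_natCast,
      ← Real.rpow_add h0]
    norm_num

theorem norm_rpow_mul_sq {F : Type*} [NormedAddCommGroup F] {m : ℝ} (hm : 2 ≤ m) (y : F) :
    ‖y‖ ^ (m - 2) * ‖y‖ ^ 2 = ‖y‖ ^ m := by
  have := abs_rpow_mul_self (t := ‖y‖) hm
  rw [abs_norm] at this
  rw [← this]; ring

theorem NonlinearityHyp.theta_div_pos (hf : NonlinearityHyp N p θ τ f) (hp : 2 ≤ p) :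
    0 < θ * p / (θ - p) := by
  have := hf.p_lt_θ
  have : 0 < θ - p := by linarith
  have : 0 < θ := by linarith
  positivity

/-- This lets a|u|^p absorb the penalized term, both in the energy estimate and in the comparison
outside the ball. -/
theorem NonlinearityHyp.one_le_theta_div (hf : NonlinearityHyp N p θ τ f) (hp : 2 ≤ p) :
    1 ≤ θ * p / (θ - p) := by
  have := hf.p_lt_θ
  rw [one_le_div (by linarith)]
  nlinarith

theorem penal_le (x : RN N) (t : ℝ) : penal p θ R f a x t ≤ f t := by
  rcases le_or_gt ‖x‖ R with h | h
  · rw [penal_of_norm_le h]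
  · rw [penal_of_lt_norm h]
    exact min_le_left _ _

theorem penal_nonneg (hf : NonlinearityHyp N p θ τ f) (hp : 2 ≤ p) (ha : ∀ x, 0 ≤ a x)
    (x : RN N) {t : ℝ} (ht : 0 ≤ t) : 0 ≤ penal p θ R f a x t := by
  rcases le_or_gt ‖x‖ R with h | h
  · rw [penal_of_norm_le h]; exact hf.nonneg t
  · rw [penal_of_lt_norm h]
    exact le_min (hf.nonneg t)
      (mul_nonneg (div_nonneg (ha x) (hf.theta_div_pos hp).le) (by positivity))

theorem aestronglyMeasurable_penal (hf : Continuous f) (hp : 2 ≤ p) (ha : Continuous a)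
    {u : RN N → ℝ} (hu : AEStronglyMeasurable u) :
    AEStronglyMeasurable fun x => penal p θ R f a x (u x) := by
  have hu' := hu.aemeasurable
  set S : Set (RN N) := {x | ‖x‖ ≤ R}
  have hS : MeasurableSet S := (isClosed_le continuous_norm continuous_const).measurableSet
  have e : (fun x => penal p θ R f a x (u x)) = S.indicator (fun x => f (u x)) + Sᶜ.indicator
      (fun x => min (f (u x)) (a x / (θ * p / (θ - p)) * (|u x| ^ (p - 2) * u x))) := by
    ext x
    by_cases h : ‖x‖ ≤ R
    · simp [penal_of_norm_le h, S, h]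
    · simp [penal_of_lt_norm (not_le.1 h), S, h]
  rw [e]
  refine AEMeasurable.aestronglyMeasurable ?_
  have h1 : AEMeasurable (fun x => f (u x)) volume := hf.measurable.comp_aemeasurable hu'
  have h2 : AEMeasurable (fun x => |u x| ^ (p - 2) * u x) volume :=
    (continuous_abs_rpow_mul hp).measurable.comp_aemeasurable hu'
  exact (h1.indicator hS).add
    ((h1.min ((ha.measurable.div_const _).aemeasurable.mul h2)).indicator hS.compl)

theorem continuous_penal_right (hf : Continuous f) (hp : 2 ≤ p) (x : RN N) :
    Continuous (penal p θ R f a x) := by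
  rcases le_or_gt ‖x‖ R with h | h
  · exact hf.congr fun t => (penal_of_norm_le h t).symm
  · exact (hf.min (continuous_const.mul (continuous_abs_rpow_mul hp))).congr fun t =>
      (penal_of_lt_norm h t).symm

theorem penal_primitive_nonneg (hf : NonlinearityHyp N p θ τ f) (hp : 2 ≤ p)
    (ha : ∀ x, 0 ≤ a x) (x : RN N) {t : ℝ} (ht : 0 < t) :
    0 ≤ ∫ s in (0 : ℝ)..t, penal p θ R f a x s :=
  intervalIntegral.integral_nonneg ht.le fun _ hs => penal_nonneg hf hp ha x hs.1

/-- The Ambrosetti-Rabinowitz inequality for the penalized nonlinearity. -/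
theorem penal_primitive_le (hf : NonlinearityHyp N p θ τ f) (hp : 2 ≤ p)
    (ha : ∀ x, 0 ≤ a x) (x : RN N) {t : ℝ} (ht : 0 < t) :
    ∫ s in (0 : ℝ)..t, penal p θ R f a x s
      ≤ 1 / θ * (penal p θ R f a x t * t) + (1 / p - 1 / θ) * (a x * |t| ^ p) := by
  have hpθ := hf.p_lt_θ
  have hθ : 0 < θ := by linarith
  have hp0 : 0 < p := by linarith
  have hk := hf.theta_div_pos hp
  have hk1 := hf.one_le_theta_div hp
  set k := θ * p / (θ - p)
  have hdiff : 0 ≤ 1 / p - 1 / θ := sub_nonneg.2 (one_div_le_one_div_of_le hp0 hpθ.le)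
  have hnn : 0 ≤ (1 / p - 1 / θ) * (a x * |t| ^ p) :=
    mul_nonneg hdiff (mul_nonneg (ha x) (by positivity))
  have hgc := continuous_penal_right (θ := θ) (R := R) (a := a) hf.continuous hp x
  have h1 : ∫ s in (0 : ℝ)..t, penal p θ R f a x s ≤ primF f t :=
    intervalIntegral.integral_mono_on ht.le (hgc.intervalIntegrable _ _)
      (hf.continuous.intervalIntegrable _ _) fun s _ => penal_le x s
  have h2 : primF f t ≤ 1 / θ * (f t * t) := by
    have := (hf.f3 t ht).2
    rw [one_div_mul_eq_div, le_div_iff₀ hθ]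
    linarith
  rcases le_or_gt ‖x‖ R with h | h
  · rw [penal_of_norm_le h]
    linarith
  rcases le_total (f t) (a x / k * (|t| ^ (p - 2) * t)) with h' | h'
  · rw [penal_of_lt_norm h, min_eq_left h']
    linarith
  -- In the truncated regime g(x,t)t = (a/k)t^p while G(x,t) ≤ (1/p)(a/k)t^p. The excess over
  -- g(x,t)t/θ is at most (1/p - 1/θ)(a/k)t^p, and k ≥ 1.
  · rw [penal_of_lt_norm h, min_eq_right h']
    have h3 : ∫ s in (0 : ℝ)..t, penal p θ R f a x s ≤ ∫ s in (0 : ℝ)..t, a x / k * s ^ (p - 1) := by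
      refine intervalIntegral.integral_mono_on ht.le (hgc.intervalIntegrable _ _)
        ((continuous_const.mul (continuous_id.rpow_const fun _ =>
          Or.inr (by linarith))).intervalIntegrable _ _) fun s hs => ?_
      rw [penal_of_lt_norm h]
      refine (min_le_right _ _).trans (le_of_eq ?_)
      rcases hs.1.eq_or_lt with h0 | h0
      · rw [← h0, Real.zero_rpow (by linarith)]; simp
      · rw [abs_of_pos h0, ← Real.rpow_add_one h0.ne']
        congr 2; ring
    have h4 : ∫ s in (0 : ℝ)..t, a x / k * s ^ (p - 1) = 1 / p * (a x / k * |t| ^ p) := by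
      rw [intervalIntegral.integral_const_mul, integral_rpow (Or.inl (by linarith)), sub_add_cancel,
        Real.zero_rpow hp0.ne', abs_of_pos ht]
      ring
    have h5 : a x / k * (|t| ^ (p - 2) * t) * t = a x / k * |t| ^ p := by
      rw [← abs_rpow_mul_self hp]; ring
    have h6 : a x / k ≤ a x := div_le_self (ha x) hk1
    rw [h5]
    rw [h4] at h3
    have h7 : (1 / p - 1 / θ) * (a x / k * |t| ^ p) ≤ (1 / p - 1 / θ) * (a x * |t| ^ p) :=
      mul_le_mul_of_nonneg_left (mul_le_mul_of_nonneg_right h6 (by positivity)) hdiff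
    linarith

theorem integrable_penal_mul (hf : NonlinearityHyp N p θ τ f) (hp : 2 ≤ p) (hpN : p < N)
    (hac : Continuous a) (ha : ∀ x, 0 ≤ a x) {u w : RN N → ℝ}
    (hu : MemLp u (ENNReal.ofReal (critExp N p))) (hpos : ∀ᵐ x, 0 < u x)
    (hw : AEStronglyMeasurable w) (hwu : ∀ᵐ x, 0 ≤ w x ∧ w x ≤ u x) :
    Integrable fun x => penal p θ R f a x (u x) * w x := by
  obtain ⟨C, hC0, hC⟩ := hf.growth hp
  refine ((memLp_integrable_rpow (critExp_pos (by linarith) hpN) hu).const_mul C).mono'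
    ((aestronglyMeasurable_penal hf.continuous hp hac hu.1).mul hw) ?_
  filter_upwards [hpos, hwu] with x h1 h2
  have h3 := penal_nonneg (R := R) hf hp ha x h1.le
  rw [Real.norm_eq_abs, Real.norm_eq_abs, abs_of_nonneg (mul_nonneg h3 h2.1), abs_of_pos h1]
  refine le_trans ?_ (mul_le_rpow_of_growth hC h1)
  rw [mul_comm]
  exact mul_le_mul h2.2 (penal_le x _) h3 h1.le

/-- Critical points with energy at most `C₀` have bounded gradients in `L^p`. -/
theorem grad_energy_le (hq : 2 ≤ q) (hqp : q ≤ p) (hpN : p < N)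
    (hf : NonlinearityHyp N p θ τ f) (hac : Continuous a) (ha : ∀ x, 0 ≤ a x)
    (hb : ∀ x, 0 ≤ b x) {u : RN N → ℝ} (hu : u ∈ spaceE p q a b) (hpos : ∀ᵐ x, 0 < u x)
    (hcrit : derivJ p q θ R f a b u u = 0) {C₀ : ℝ} (hJ : energyJ p q θ R f a b u ≤ C₀) :
    (1 / p - 1 / θ) * ∫ x, ‖weakGrad u x‖ ^ p ≤ C₀ := by
  have hp : 2 ≤ p := hq.trans hqp
  have hpθ := hf.p_lt_θ
  have e1 : ∀ m : ℝ, 2 ≤ m → ∀ x, ‖weakGrad u x‖ ^ (m - 2) * inner ℝ (weakGrad u x) (weakGrad u x)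
      = ‖weakGrad u x‖ ^ m := fun m hm x => by
    rw [real_inner_self_eq_norm_sq, norm_rpow_mul_sq hm]
  have e2 : ∀ m : ℝ, 2 ≤ m → ∀ x, |u x| ^ (m - 2) * u x * u x = |u x| ^ m := fun m hm x =>
    abs_rpow_mul_self hm
  simp only [derivJ, e1 p hp, e1 q hq, e2 p hp, e2 q hq] at hcrit
  have hi := integrable_penal_mul (R := R) hf hp hpN hac ha hu.1.1 hpos hu.1.1.1
    (hpos.mono fun x hx => ⟨hx.le, le_rfl⟩)
  -- In J(u) - J'(u)u/θ the coefficient of ∫a|u|^p is exactly 1/p - 1/θ, so the last term here is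
  -- cancelled. What survives is the p-gradient and the q-terms, nonnegative because q < θ.
  have hG : ∫ x, ∫ s in (0 : ℝ)..(u x), penal p θ R f a x s
      ≤ 1 / θ * (∫ x, penal p θ R f a x (u x) * u x) + (1 / p - 1 / θ) * ∫ x, a x * |u x| ^ p := by
    rw [← integral_const_mul, ← integral_const_mul,
      ← integral_add (hi.const_mul _) (hu.2.2.1.const_mul _)]
    refine integral_mono_of_nonneg ?_ ((hi.const_mul _).add (hu.2.2.1.const_mul _)) ?_
    · filter_upwards [hpos] with x hx using penal_primitive_nonneg hf hp ha x hx
    · filter_upwards [hpos] with x hx using penal_primitive_le hf hp ha x hx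
  rw [energyJ] at hJ
  have i1 : 0 ≤ ∫ x, ‖weakGrad u x‖ ^ q := integral_nonneg fun x => by positivity
  have i2 : 0 ≤ ∫ x, b x * |u x| ^ q :=
    integral_nonneg fun x => mul_nonneg (hb x) (by positivity)
  have hqθ : 0 ≤ 1 / q - 1 / θ :=
    sub_nonneg.2 (one_div_le_one_div_of_le (by linarith) (by linarith))
  have hQ : ∫ x, penal p θ R f a x (u x) * u x = (∫ x, ‖weakGrad u x‖ ^ p)
      + (∫ x, a x * |u x| ^ p) + (∫ x, ‖weakGrad u x‖ ^ q) + ∫ x, b x * |u x| ^ q := by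
    linarith
  rw [hQ] at hG
  nlinarith [mul_nonneg hqθ i1, mul_nonneg hqθ i2]

end Penalization

/-! ### Admissibility of the test functions (u - g)⁺. -/

section Truncation

variable {p q : ℝ} {a b : RN N → ℝ} {u g : RN N → ℝ}

theorem hasWeakGradient_truncation {G : RN N → RN N} (hu : HasWeakGradient u G)
    (hg : ContDiff ℝ 1 g) : HasWeakGradient (fun x => max (u x - g x) 0)
      (fun x => (if g x < u x then (1 : ℝ) else 0) • (G x - gradient g x)) := by
  have h := (hu.linear_comb (hasWeakGradient_of_contDiff hg) 1 (-1)).max_zero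
  have e1 : ∀ x, 1 * u x + -1 * g x = u x - g x := fun x => by ring
  have e2 : ∀ x, (1 : ℝ) • G x + (-1 : ℝ) • gradient g x = G x - gradient g x := fun x => by
    rw [one_smul, neg_one_smul, sub_eq_add_neg]
  simpa only [e1, e2, sub_pos] using h

theorem truncation_abs_le (hg0 : ∀ x, 0 ≤ g x) (x : RN N) : |max (u x - g x) 0| ≤ |u x| := by
  rw [abs_of_nonneg (le_max_right _ _)]
  exact max_le (by linarith [hg0 x, le_abs_self (u x)]) (abs_nonneg _)

theorem memD_truncation {m : ℝ} (hu : MemD m u) (hg : ContDiff ℝ 1 g) (hg0 : ∀ x, 0 ≤ g x)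
    (hL : MemLp (fun x => (if g x < u x then (1 : ℝ) else 0) • (weakGrad u x - gradient g x))
      (ENNReal.ofReal m)) : MemD m fun x => max (u x - g x) 0 := by
  have hw := hasWeakGradient_truncation hu.hasWeakGradient hg
  exact ⟨hu.1.mono hw.1.aestronglyMeasurable (ae_of_all _ fun x => truncation_abs_le hg0 x),
    _, hw, hL⟩

theorem integrable_mul_rpow_of_abs_le {m : ℝ} {V w : RN N → ℝ} (hm : 0 < m) (hVc : Continuous V)
    (hV : ∀ x, 0 ≤ V x) (iu : Integrable fun x => V x * |u x| ^ m) (hw : AEStronglyMeasurable w)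
    (h : ∀ x, |w x| ≤ |u x|) : Integrable fun x => V x * |w x| ^ m := by
  refine iu.mono' (hVc.aestronglyMeasurable.mul
    ((continuous_abs.rpow_const fun _ => Or.inr hm.le).comp_aestronglyMeasurable hw))
    (ae_of_all _ fun x => ?_)
  rw [Real.norm_eq_abs, abs_of_nonneg (mul_nonneg (hV x) (by positivity))]
  exact mul_le_mul_of_nonneg_left (Real.rpow_le_rpow (abs_nonneg _) (h x) hm.le) (hV x)

/-- Since g ≥ 0, the truncation is dominated by |u|; all zero-order integrability is inherited, and
only the gradient needs hypotheses. -/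
theorem truncation_mem_spaceE (hq : 0 < q) (hp : 0 < p) (hac : Continuous a) (hbc : Continuous b)
    (ha : ∀ x, 0 ≤ a x) (hb : ∀ x, 0 ≤ b x) (hu : u ∈ spaceE p q a b) (hg : ContDiff ℝ 1 g)
    (hg0 : ∀ x, 0 ≤ g x)
    (hLp : MemLp (fun x => (if g x < u x then (1 : ℝ) else 0) • (weakGrad u x - gradient g x))
      (ENNReal.ofReal p))
    (hLq : MemLp (fun x => (if g x < u x then (1 : ℝ) else 0) • (weakGrad u x - gradient g x))
      (ENNReal.ofReal q)) : (fun x => max (u x - g x) 0) ∈ spaceE p q a b := by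
  have hm := (hasWeakGradient_truncation hu.1.hasWeakGradient hg).1.aestronglyMeasurable
  exact ⟨memD_truncation hu.1 hg hg0 hLp, memD_truncation hu.2.1 hg hg0 hLq,
    integrable_mul_rpow_of_abs_le hp hac ha hu.2.2.1 hm (truncation_abs_le hg0),
    integrable_mul_rpow_of_abs_le hq hbc hb hu.2.2.2 hm (truncation_abs_le hg0)⟩

theorem aestronglyMeasurable_indicator_lt (hu : AEStronglyMeasurable u) (hg : Continuous g) :
    AEStronglyMeasurable fun x => if g x < u x then (1 : ℝ) else 0 := by
  have : Measurable fun t : ℝ => if 0 < t then (1 : ℝ) else 0 :=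
    Measurable.ite measurableSet_Ioi measurable_const measurable_const
  simpa only [Function.comp_def, Pi.sub_apply, sub_pos] using
    (this.comp_aemeasurable (hu.aemeasurable.sub hg.measurable.aemeasurable)).aestronglyMeasurable

end Truncation

/-! ### De Giorgi iteration and the uniform bound. -/

/-- A superlinear recursion with geometric growth decays geometrically for small data. -/
theorem geometric_decay {U : ℕ → ℝ} {D β σ W : ℝ} (hU : ∀ n, 0 ≤ U n) (hW : 0 < W)
    (hU0 : U 0 ≤ W) (hβ : 1 ≤ β) (hσ : 1 < σ) (hD : 0 ≤ D)
    (hrec : ∀ n, U (n + 1) ≤ D * β ^ (n + 1) * U n ^ σ)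
    (hsmall : D * β * W ^ (σ - 1) ≤ β ^ (-(1 / (σ - 1)))) (n : ℕ) :
    U n ≤ W * (β ^ (-(1 / (σ - 1)))) ^ n := by
  have hβ0 : 0 < β := by linarith
  set ρ := β ^ (-(1 / (σ - 1)))
  have hρ : 0 < ρ := by positivity
  -- The exponent in ρ is chosen for this identity: raising ρ^n to the power σ gains β^{-n}, which
  -- offsets the growth of the coefficients.
  have hρσ : ρ ^ σ = ρ * β⁻¹ := by
    have h1 : ρ ^ (σ - 1) = β⁻¹ := by
      simp only [ρ]
      rw [← Real.rpow_mul hβ0.le, neg_mul, one_div_mul_cancel (by linarith), Real.rpow_neg_one]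
    rw [← h1, ← Real.rpow_one_add' hρ.le (by linarith)]
    congr 1; ring
  have hWσ : W ^ σ = W * W ^ (σ - 1) := by
    rw [← Real.rpow_one_add' hW.le (by linarith)]
    congr 1; ring
  induction n with
  | zero => simpa using hU0
  | succ n ih =>
    have h1 : U n ^ σ ≤ (W * ρ ^ n) ^ σ := Real.rpow_le_rpow (hU n) ih (by linarith)
    have h2 : (W * ρ ^ n) ^ σ = W * W ^ (σ - 1) * (ρ ^ n * (β ^ n)⁻¹) := by
      rw [Real.mul_rpow hW.le (by positivity), hWσ, ← Real.rpow_natCast ρ, ← Real.rpow_mul hρ.le,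
        mul_comm (n : ℝ) σ, Real.rpow_mul hρ.le, hρσ, Real.rpow_natCast, mul_pow, inv_pow,
        Real.rpow_natCast]
    calc U (n + 1) ≤ D * β ^ (n + 1) * U n ^ σ := hrec n
      _ ≤ D * β ^ (n + 1) * (W * W ^ (σ - 1) * (ρ ^ n * (β ^ n)⁻¹)) := by
          rw [← h2]
          exact mul_le_mul_of_nonneg_left h1 (by positivity)
      _ = W * ρ ^ n * (D * β * W ^ (σ - 1)) := by
          rw [pow_succ]
          field_simp
      _ ≤ W * ρ ^ n * ρ := mul_le_mul_of_nonneg_left hsmall (by positivity)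
      _ = W * ρ ^ (n + 1) := by ring

/-- The pointwise comparison of consecutive truncations. -/
theorem truncation_step {τ s M t : ℝ} {n : ℕ} (hτ : 1 < τ) (hs : τ < s) (hM : 0 < M) :
    |t| ^ (τ - 1) * max (t - M * (1 - (1 / 2) ^ (n + 1))) 0
      ≤ M ^ (τ - s) * (2 ^ (s - 1)) ^ (n + 1) * |max (t - M * (1 - (1 / 2) ^ n)) 0| ^ s := by
  set k := M * (1 - (1 / 2) ^ n)
  set h := M * (1 / 2) ^ (n + 1)
  have hh : 0 < h := by positivity
  have hk' : M * (1 - (1 / 2) ^ (n + 1)) = k + h := by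
    simp only [k, h, pow_succ]; ring
  have hp2 : (0 : ℝ) < (1 / 2) ^ n := by positivity
  have hk0 : 0 ≤ k :=
    mul_nonneg hM.le (sub_nonneg.2 (pow_le_one₀ (by norm_num) (by norm_num)))
  have hMk : M = k + 2 * h := by simp only [k, h, pow_succ]; ring
  rw [hk']
  rcases le_or_gt t (k + h) with ht | ht
  · rw [max_eq_right (by linarith), mul_zero]
    positivity
  have hw : h < t - k := by linarith
  have hw0 : 0 < t - k := hh.trans hw
  have ht0 : 0 < t := by linarith
  rw [max_eq_left (by linarith), max_eq_left hw0.le, abs_of_pos ht0, abs_of_pos hw0]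
  have hMh : M / h = 2 ^ (n + 1) := by
    simp only [h]
    rw [div_mul_eq_div_div, div_self hM.ne', one_div_pow, one_div_one_div]
  -- Here h is the gap between consecutive levels, M = k + 2h and t - k > h, so t is at most 2^{n+1}
  -- times its excess over the lower level.
  have h1 : t ≤ M / h * (t - k) := by
    rw [div_mul_eq_mul_div, le_div_iff₀ hh, hMk]
    nlinarith
  set B : ℝ := 2 ^ (n + 1)
  have hB : 0 < B := by positivity
  rw [hMh] at h1
  have h2 : t ^ (τ - 1) ≤ B ^ (τ - 1) * (t - k) ^ (τ - 1) := by
    rw [← Real.mul_rpow hB.le hw0.le]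
    exact Real.rpow_le_rpow ht0.le h1 (by linarith)
  have h3 : (t - k) ^ (τ - 1) * (t - k) = (t - k) ^ s * (t - k) ^ (τ - s) := by
    rw [← Real.rpow_add_one hw0.ne', ← Real.rpow_add hw0]
    congr 1; ring
  -- The exponent is negative because τ < s, so the lower bound on t - k becomes an upper bound.
  -- Subcriticality enters here, yielding the factor M^{τ-s}.
  have h4 : (t - k) ^ (τ - s) ≤ h ^ (τ - s) :=
    Real.rpow_le_rpow_of_nonpos hh hw.le (by linarith)
  have h5 : h ^ (τ - s) = M ^ (τ - s) * B ^ (s - τ) := by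
    have : h = M / B := by
      rw [eq_div_iff hB.ne', ← hMh]; field_simp
    rw [this, Real.div_rpow hM.le hB.le, ← neg_sub s τ, Real.rpow_neg hB.le (s - τ)]
    field_simp
  have h6 : ((2 : ℝ) ^ (s - 1)) ^ (n + 1) = B ^ (τ - 1) * B ^ (s - τ) := by
    rw [← Real.rpow_add hB, ← Real.rpow_natCast, ← Real.rpow_mul (by norm_num)]
    simp only [B]
    rw [← Real.rpow_natCast 2 (n + 1), ← Real.rpow_mul (by norm_num)]
    congr 1; ring
  calc t ^ (τ - 1) * (t - (k + h)) ≤ (B ^ (τ - 1) * (t - k) ^ (τ - 1)) * (t - k) :=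
        mul_le_mul h2 (by linarith) (by linarith) (by positivity)
    _ = B ^ (τ - 1) * ((t - k) ^ s * (t - k) ^ (τ - s)) := by rw [mul_assoc, h3]
    _ ≤ B ^ (τ - 1) * ((t - k) ^ s * h ^ (τ - s)) := by gcongr
    _ = _ := by rw [h5, h6]; ring

section Bound

variable {p q θ τ R : ℝ} {f : ℝ → ℝ} {a b : RN N → ℝ} {u : RN N → ℝ}

theorem memLp_indicator_smul {m : ℝ} {G : RN N → RN N} {g : RN N → ℝ}
    (hG : MemLp G (ENNReal.ofReal m)) (hu : AEStronglyMeasurable u) (hg : Continuous g) :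
    MemLp (fun x => (if g x < u x then (1 : ℝ) else 0) • G x) (ENNReal.ofReal m) :=
  hG.mono ((aestronglyMeasurable_indicator_lt hu hg).smul hG.1) (ae_of_all _ fun x => by
    split_ifs <;> simp)

/-- Caccioppoli-type estimate: the energy of a truncation. -/
theorem truncation_energy_le (hq : 2 ≤ q) (hqp : q ≤ p) (hac : Continuous a) (hbc : Continuous b)
    (ha : ∀ x, 0 ≤ a x) (hb : ∀ x, 0 ≤ b x) (hu : u ∈ spaceE p q a b) (hpos : ∀ᵐ x, 0 < u x)
    (hcrit : ∀ v ∈ spaceE p q a b, derivJ p q θ R f a b u v = 0) {k : ℝ} (hk : 0 ≤ k) :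
    MemD p (fun x => max (u x - k) 0) ∧
    ∫ x, ‖weakGrad (fun x => max (u x - k) 0) x‖ ^ p
      ≤ ∫ x, penal p θ R f a x (u x) * max (u x - k) 0 := by
  have hp : 2 ≤ p := hq.trans hqp
  have hg : ContDiff ℝ 1 fun _ : RN N => k := contDiff_const
  have hgrad : ∀ x : RN N, gradient (fun _ : RN N => k) x = 0 := fun x => by simp [gradient]
  have hL : ∀ m : ℝ, MemD m u → MemLp (fun x => (if k < u x then (1 : ℝ) else 0) •
      (weakGrad u x - gradient (fun _ => k) x)) (ENNReal.ofReal m) := fun m hm => by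
    simp only [hgrad, sub_zero]
    exact memLp_indicator_smul hm.memLp_weakGrad hu.1.1.1 continuous_const
  have hwE := truncation_mem_spaceE (by linarith) (by linarith) hac hbc ha hb hu hg (fun _ => hk)
    (hL p hu.1) (hL q hu.2.1)
  refine ⟨hwE.1, ?_⟩
  have hgw := (hasWeakGradient_truncation hu.1.hasWeakGradient hg).weakGrad_ae_eq
  simp only [hgrad, sub_zero] at hgw
  have e1 : ∀ m : ℝ, 2 ≤ m → ∫ x, ‖weakGrad u x‖ ^ (m - 2) *
      inner ℝ (weakGrad u x) (weakGrad (fun x => max (u x - k) 0) x)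
      = ∫ x, ‖weakGrad (fun x => max (u x - k) 0) x‖ ^ m := fun m hm => by
    refine integral_congr_ae ?_
    filter_upwards [hgw] with x hx
    rw [hx]
    split_ifs
    · rw [one_smul, real_inner_self_eq_norm_sq, norm_rpow_mul_sq hm]
    · rw [zero_smul, inner_zero_right, mul_zero, norm_zero, Real.zero_rpow (by linarith)]
  have e2 : ∀ (m : ℝ) (V : RN N → ℝ), (∀ x, 0 ≤ V x) →
      0 ≤ ∫ x, V x * (|u x| ^ (m - 2) * u x * max (u x - k) 0) := fun m V hV => by
    refine integral_nonneg_of_ae ?_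
    filter_upwards [hpos] with x hx
    exact mul_nonneg (hV x) (mul_nonneg (mul_nonneg (by positivity) hx.le) (le_max_right _ _))
  -- With the truncation as test function, the potential terms and the q-gradient term are
  -- nonnegative and can be dropped.
  have h := hcrit _ hwE
  rw [derivJ, e1 p hp, e1 q hq] at h
  have h1 := e2 p a ha
  have h2 := e2 q b hb
  have h3 : 0 ≤ ∫ x, ‖weakGrad (fun x => max (u x - k) 0) x‖ ^ q :=
    integral_nonneg fun x => by positivity
  linarith

/-- De Giorgi iteration: critical points bounded in energy are bounded. -/
theorem exists_sup_bound (hq : 2 ≤ q) (hqp : q ≤ p) (hpN : p < N)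
    (hf : NonlinearityHyp N p θ τ f) {C₀ : ℝ} (hC₀ : 0 ≤ C₀) :
    ∃ M : ℝ, 0 < M ∧ ∀ (R : ℝ) (a b u : RN N → ℝ), Continuous a → Continuous b →
      (∀ x, 0 ≤ a x) → (∀ x, 0 ≤ b x) → u ∈ spaceE p q a b → (∀ᵐ x, 0 < u x) →
      (∀ v ∈ spaceE p q a b, derivJ p q θ R f a b u v = 0) → energyJ p q θ R f a b u ≤ C₀ →
      ∀ᵐ x, u x ≤ M := by
  have hp : 2 ≤ p := hq.trans hqp
  have hp0 : 0 < p := by linarith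
  have hpθ := hf.p_lt_θ
  have hpτ := hf.p_lt_τ
  have hτs := hf.τ_lt
  obtain ⟨S, hS, hsob⟩ := sobolev (N := N) (by linarith : 1 ≤ p) hpN
  obtain ⟨C, hC0, hC⟩ := hf.growth hp
  set s := critExp N p
  have hs0 : 0 < s := critExp_pos hp0 hpN
  have hsp : p < s := lt_critExp hp0 hpN
  set σ := s / p
  have hσ : 1 < σ := (one_lt_div hp0).2 hsp
  have hσ0 : 0 < σ := by linarith
  have hdiff : 0 < 1 / p - 1 / θ := sub_pos.2 (one_div_lt_one_div_of_lt hp0 hpθ)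
  set W := S * (C₀ / (1 / p - 1 / θ)) ^ σ + 1
  have hW : 0 < W := by positivity
  set β : ℝ := ((2 : ℝ) ^ (s - 1)) ^ σ
  have h2s : (1 : ℝ) < 2 ^ (s - 1) := Real.one_lt_rpow (by norm_num) (by linarith)
  have hβ : 1 < β := Real.one_lt_rpow h2s hσ0
  have hβ0 : 0 < β := by linarith
  set ρ := β ^ (-(1 / (σ - 1)))
  have hρ : 0 < ρ := by positivity
  have hρ1 : ρ < 1 := Real.rpow_lt_one_of_one_lt_of_neg hβ
    (neg_neg_of_pos (one_div_pos.2 (by linarith)))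
  -- The smallness condition of `geometric_decay` holds for large M since M^{τ-s} → 0. Every other
  -- quantity in it is already fixed, independently of u.
  have hev : ∃ M : ℝ, 0 < M ∧ S * (C * M ^ (τ - s)) ^ σ * β * W ^ (σ - 1) ≤ ρ := by
    have h1 : Tendsto (fun M : ℝ => M ^ (τ - s)) atTop (𝓝 0) := by
      have := tendsto_rpow_neg_atTop (y := s - τ) (by linarith)
      simpa using this
    have h2 : Tendsto (fun M : ℝ => S * (C * M ^ (τ - s)) ^ σ * β * W ^ (σ - 1)) atTop (𝓝 0) := by
      have h3 := ((h1.const_mul C).rpow_const (p := σ) (Or.inr hσ0.le))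
      have h4 := ((h3.const_mul S).mul_const β).mul_const (W ^ (σ - 1))
      simpa [Real.zero_rpow hσ0.ne'] using h4
    obtain ⟨M, h5, h6⟩ := ((h2.eventually (ge_mem_nhds hρ)).and (eventually_gt_atTop 0)).exists
    exact ⟨M, h6, h5⟩
  obtain ⟨M, hM, hMsmall⟩ := hev
  refine ⟨M, hM, fun R a b u hac hbc ha hb hu hpos hcrit hJ => ?_⟩
  have hus := memLp_integrable_rpow hs0 hu.1.1
  set k : ℕ → ℝ := fun n => M * (1 - (1 / 2) ^ n)
  have hk : ∀ n, 0 ≤ k n := fun n =>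
    mul_nonneg hM.le (sub_nonneg.2 (pow_le_one₀ (by norm_num) (by norm_num)))
  set U : ℕ → ℝ := fun n => ∫ x, |max (u x - k n) 0| ^ s
  have hD := fun n => truncation_energy_le hq hqp hac hbc ha hb hu hpos hcrit (hk n)
  have iU : ∀ n, Integrable fun x => |max (u x - k n) 0| ^ s := fun n =>
    memLp_integrable_rpow hs0 (hD n).1.1
  have hU0 : ∀ n, 0 ≤ U n := fun n => integral_nonneg fun x => by positivity
  have hUW : U 0 ≤ W := by
    have h1 : U 0 = ∫ x, |u x| ^ s := by
      refine integral_congr_ae ?_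
      filter_upwards [hpos] with x hx
      simp [k, hx.le]
    rw [h1]
    have h2 := hsob u _ hu.1.hasWeakGradient hu.1.1 hu.1.memLp_weakGrad
    have h3 := grad_energy_le hq hqp hpN hf hac ha hb hu hpos (hcrit u hu) hJ
    rw [mul_comm, ← le_div_iff₀ hdiff] at h3
    have h4 : (∫ x, ‖weakGrad u x‖ ^ p) ^ σ ≤ (C₀ / (1 / p - 1 / θ)) ^ σ :=
      Real.rpow_le_rpow (integral_nonneg fun x => by positivity) h3 hσ0.le
    have h5 := mul_le_mul_of_nonneg_left h4 hS.le
    simp only [W]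
    linarith
  -- The Sobolev inequality bounds U (n + 1) by the σ-th power of the truncation's gradient energy,
  -- which the equation, subcritical growth and `truncation_step` bound linearly by U n.
  -- Superlinearity comes from σ = p*/p > 1.
  have hrec : ∀ n, U (n + 1) ≤ S * (C * M ^ (τ - s)) ^ σ * β ^ (n + 1) * U n ^ σ := by
    intro n
    have h1 := hsob _ _ (hD (n + 1)).1.hasWeakGradient (hD (n + 1)).1.1
      (hD (n + 1)).1.memLp_weakGrad
    have h2 : ∫ x, penal p θ R f a x (u x) * max (u x - k (n + 1)) 0
        ≤ C * M ^ (τ - s) * (2 ^ (s - 1)) ^ (n + 1) * U n := by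
      rw [← integral_const_mul]
      refine integral_mono_of_nonneg ?_ ((iU n).const_mul _) ?_
      · filter_upwards [hpos] with x hx
        exact mul_nonneg (penal_nonneg hf hp ha x hx.le) (le_max_right _ _)
      · filter_upwards [hpos] with x hx
        have h3 := truncation_step (t := u x) (n := n) (by linarith : 1 < τ) hτs hM
        have h4 := (penal_le (p := p) (θ := θ) (R := R) (a := a) x (u x)).trans (hC _ hx).1
        have h5 := mul_le_mul_of_nonneg_right h4 (le_max_right (u x - k (n + 1)) 0)
        rw [abs_of_pos hx] at h3
        have h6 := mul_le_mul_of_nonneg_left h3 hC0.le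
        simp only [k] at h5 ⊢
        calc _ ≤ _ := h5
          _ = C * (u x ^ (τ - 1) * max (u x - M * (1 - (1 / 2) ^ (n + 1))) 0) := by ring
          _ ≤ _ := h6
          _ = _ := by ring
    have h3 := Real.rpow_le_rpow (integral_nonneg fun x => by positivity)
      ((hD (n + 1)).2.trans h2) hσ0.le
    refine h1.trans ((mul_le_mul_of_nonneg_left h3 hS.le).trans (le_of_eq ?_))
    rw [Real.mul_rpow (by positivity) (hU0 n), Real.mul_rpow (by positivity) (by positivity)]
    have : (((2 : ℝ) ^ (s - 1)) ^ (n + 1)) ^ σ = β ^ (n + 1) := by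
      simp only [β]
      rw [← Real.rpow_natCast, ← Real.rpow_mul (by positivity), mul_comm,
        Real.rpow_mul (by positivity), Real.rpow_natCast]
    rw [this]
    ring
  have hdecay := geometric_decay hU0 hW hUW hβ.le hσ (by positivity) hrec hMsmall
  have hzero : ∫ x, |max (u x - M) 0| ^ s = 0 := by
    -- All levels k n lie below M, so the truncation at M is dominated by each truncation of the
    -- sequence.
    have hle : ∀ n, ∫ x, |max (u x - M) 0| ^ s ≤ W * ρ ^ n := by
      intro n
      refine le_trans ?_ (hdecay n)
      refine integral_mono_of_nonneg (ae_of_all _ fun x => by positivity) (iU n)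
        (ae_of_all _ fun x => ?_)
      refine Real.rpow_le_rpow (abs_nonneg _) ?_ hs0.le
      rw [abs_of_nonneg (le_max_right _ _), abs_of_nonneg (le_max_right _ _)]
      refine max_le_max_right _ ?_
      have : k n ≤ M := by
        simp only [k]
        have : (0 : ℝ) < (1 / 2) ^ n := by positivity
        nlinarith
      linarith
    have hlim : Tendsto (fun n : ℕ => W * ρ ^ n) atTop (𝓝 0) := by
      simpa using (tendsto_pow_atTop_nhds_zero_of_lt_one hρ.le hρ1).const_mul W
    exact le_antisymm (ge_of_tendsto' hlim hle) (integral_nonneg fun x => by positivity)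
  have hiM := memLp_integrable_rpow hs0
    (truncation_energy_le hq hqp hac hbc ha hb hu hpos hcrit hM.le).1.1
  simp only [Real.norm_eq_abs] at hiM
  rw [integral_eq_zero_iff_of_nonneg (fun x => by positivity) hiM] at hzero
  filter_upwards [hzero] with x hx
  simp only [Pi.zero_apply] at hx
  rw [Real.rpow_eq_zero (abs_nonneg _) hs0.ne', abs_eq_zero, max_eq_right_iff] at hx
  linarith

end Bound

/-! ### Monotonicity of the m-Laplace field for m ≥ 2. -/

section Monotone

theorem rpow_sub_mul_sq_sub_nonneg {F : Type*} [NormedAddCommGroup F] {m : ℝ} (hm : 2 ≤ m) (x y : F) :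
    0 ≤ (‖x‖ ^ (m - 2) - ‖y‖ ^ (m - 2)) * (‖x‖ ^ 2 - ‖y‖ ^ 2) := by
  rcases le_total ‖x‖ ‖y‖ with h | h
  · have h1 := Real.rpow_le_rpow (norm_nonneg _) h (by linarith : 0 ≤ m - 2)
    have h2 := pow_le_pow_left₀ (norm_nonneg _) h 2
    exact mul_nonneg_of_nonpos_of_nonpos (by linarith) (by linarith)
  · have h1 := Real.rpow_le_rpow (norm_nonneg _) h (by linarith : 0 ≤ m - 2)
    have h2 := pow_le_pow_left₀ (norm_nonneg _) h 2
    exact mul_nonneg (by linarith) (by linarith)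

variable {F : Type*} [NormedAddCommGroup F] [InnerProductSpace ℝ F]

/-- Symmetrizing exhibits the monotonicity expression as a sum of two terms, each nonnegative when m
≥ 2; the first one carries strictness. -/
theorem two_mul_inner_rpow_sub (m : ℝ) (x y : F) :
    2 * (‖x‖ ^ (m - 2) * inner ℝ x (x - y) - ‖y‖ ^ (m - 2) * inner ℝ y (x - y))
      = (‖x‖ ^ (m - 2) + ‖y‖ ^ (m - 2)) * ‖x - y‖ ^ 2
        + (‖x‖ ^ (m - 2) - ‖y‖ ^ (m - 2)) * (‖x‖ ^ 2 - ‖y‖ ^ 2) := by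
  rw [norm_sub_sq_real, inner_sub_right, inner_sub_right, real_inner_self_eq_norm_sq,
    real_inner_self_eq_norm_sq, real_inner_comm]
  ring

/-- Monotonicity of the `m`-Laplace field `x ↦ |x|^{m-2} x`. -/
theorem inner_rpow_sub_nonneg {m : ℝ} (hm : 2 ≤ m) (x y : F) :
    0 ≤ ‖x‖ ^ (m - 2) * inner ℝ x (x - y) - ‖y‖ ^ (m - 2) * inner ℝ y (x - y) := by
  have h1 := two_mul_inner_rpow_sub m x y
  have h2 := rpow_sub_mul_sq_sub_nonneg hm x y
  have h3 : 0 ≤ (‖x‖ ^ (m - 2) + ‖y‖ ^ (m - 2)) * ‖x - y‖ ^ 2 := by positivity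
  linarith

/-- Strict monotonicity of the `m`-Laplace field. -/
theorem eq_of_inner_rpow_sub_eq_zero {m : ℝ} (hm : 2 ≤ m) {x y : F}
    (h : ‖x‖ ^ (m - 2) * inner ℝ x (x - y) - ‖y‖ ^ (m - 2) * inner ℝ y (x - y) = 0) : x = y := by
  have h1 := two_mul_inner_rpow_sub m x y
  have h2 := rpow_sub_mul_sq_sub_nonneg hm x y
  have h3 : 0 ≤ (‖x‖ ^ (m - 2) + ‖y‖ ^ (m - 2)) * ‖x - y‖ ^ 2 := by positivity
  have h4 : (‖x‖ ^ (m - 2) + ‖y‖ ^ (m - 2)) * ‖x - y‖ ^ 2 = 0 := by linarith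
  have hx : 0 ≤ ‖x‖ ^ (m - 2) := by positivity
  have hy : 0 ≤ ‖y‖ ^ (m - 2) := by positivity
  rcases mul_eq_zero.1 h4 with h5 | h5
  · have h6 : ‖x‖ ^ (m - 2) = 0 := by linarith
    have h7 : ‖y‖ ^ (m - 2) = 0 := by linarith
    -- For m = 2 both powers equal 1, by the convention 0 ^ 0 = 1, and this case is impossible; for
    -- m > 2 both vectors are zero.
    rw [Real.rpow_eq_zero_iff_of_nonneg (norm_nonneg _), norm_eq_zero] at h6 h7
    rw [h6.1, h7.1]
  · exact sub_eq_zero.1 (norm_eq_zero.1 (pow_eq_zero_iff (by norm_num) |>.1 h5))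

theorem abs_norm_rpow_mul_inner_le {m : ℝ} (hm : 2 ≤ m) (x y : F) :
    |‖x‖ ^ (m - 2) * inner ℝ x y| ≤ ‖x‖ ^ m + ‖y‖ ^ m := by
  set t := max ‖x‖ ‖y‖
  have ht : 0 ≤ t := (norm_nonneg x).trans (le_max_left _ _)
  have h1 : |‖x‖ ^ (m - 2) * inner ℝ x y| ≤ t ^ (m - 2) * (t * t) := by
    rw [abs_mul, abs_of_nonneg (by positivity : 0 ≤ ‖x‖ ^ (m - 2))]
    refine mul_le_mul (Real.rpow_le_rpow (norm_nonneg _) (le_max_left _ _) (by linarith))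
      ((abs_real_inner_le_norm x y).trans
        (mul_le_mul (le_max_left _ _) (le_max_right _ _) (norm_nonneg _) ht))
      (abs_nonneg _) (by positivity)
  have h2 : t ^ (m - 2) * (t * t) = t ^ m := by
    have := norm_rpow_mul_sq hm t
    rwa [Real.norm_eq_abs, abs_of_nonneg ht, pow_two] at this
  rw [h2] at h1
  refine h1.trans ?_
  have hx : 0 ≤ ‖x‖ ^ m := by positivity
  have hy : 0 ≤ ‖y‖ ^ m := by positivity
  rcases max_choice ‖x‖ ‖y‖ with h | h <;> simp only [t, h] <;> linarith

end Monotone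

/-! ### Regularized radial powers and radial vector fields. -/

section Radial

/-- A smooth positive function on the line equal to `s` for `s ≥ R²`. -/
def regSq (R s : ℝ) : ℝ :=
  Real.smoothTransition (2 * s / R ^ 2 - 1) * s
    + (1 - Real.smoothTransition (2 * s / R ^ 2 - 1)) * (R ^ 2 / 2)

variable {R : ℝ}

theorem contDiff_regSq (R : ℝ) : ContDiff ℝ ∞ (regSq R) := by
  have h : ContDiff ℝ ∞ fun s : ℝ => Real.smoothTransition (2 * s / R ^ 2 - 1) :=
    Real.smoothTransition.contDiff.comp (by fun_prop)
  exact (h.mul contDiff_id).add ((contDiff_const.sub h).mul contDiff_const)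

theorem regSq_of_le (hR : 0 < R) {s : ℝ} (hs : R ^ 2 ≤ s) : regSq R s = s := by
  have : Real.smoothTransition (2 * s / R ^ 2 - 1) = 1 := by
    apply Real.smoothTransition.one_of_one_le
    rw [le_sub_iff_add_le, le_div_iff₀ (by positivity)]
    linarith
  rw [regSq, this]; ring

theorem regSq_pos (hR : 0 < R) (s : ℝ) : 0 < regSq R s := by
  have hR2 : 0 < R ^ 2 := by positivity
  have h0 := Real.smoothTransition.nonneg (2 * s / R ^ 2 - 1)
  rcases le_or_gt s (R ^ 2 / 2) with h | h
  · have : Real.smoothTransition (2 * s / R ^ 2 - 1) = 0 := by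
      apply Real.smoothTransition.zero_of_nonpos
      rw [sub_nonpos, div_le_one hR2]
      linarith
    rw [regSq, this]
    simp [hR2]
  · rw [regSq]
    nlinarith

theorem regSq_le (hR : 0 < R) {s : ℝ} (hs : s ≤ R ^ 2) : regSq R s ≤ R ^ 2 := by
  have hR2 : 0 < R ^ 2 := by positivity
  have h0 := Real.smoothTransition.nonneg (2 * s / R ^ 2 - 1)
  have h1 := Real.smoothTransition.le_one (2 * s / R ^ 2 - 1)
  rw [regSq]
  nlinarith

/-- The radial power `|x|^{-β}`, regularized inside the ball of radius `R`. -/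
def regPow (R β : ℝ) (x : RN N) : ℝ := regSq R (‖x‖ ^ 2) ^ (-β / 2)

theorem contDiff_regPow (hR : 0 < R) (β : ℝ) : ContDiff ℝ ∞ (regPow R β : RN N → ℝ) :=
  ((contDiff_regSq R).comp (contDiff_norm_sq ℝ)).rpow_const_of_ne fun _ => (regSq_pos hR _).ne'

theorem regPow_nonneg (hR : 0 < R) (β : ℝ) (x : RN N) : 0 ≤ regPow R β x :=
  Real.rpow_nonneg (regSq_pos hR _).le _

theorem regPow_of_le (hR : 0 < R) (β : ℝ) {x : RN N} (hx : R ≤ ‖x‖) :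
    regPow R β x = ‖x‖ ^ (-β) := by
  rw [regPow, regSq_of_le hR (pow_le_pow_left₀ hR.le hx 2), ← Real.rpow_natCast,
    ← Real.rpow_mul (norm_nonneg _)]
  congr 1
  push_cast
  ring

/-- The regularized square stays below R² inside the ball and the exponent is nonpositive. The
barrier is therefore at least M there, which makes the comparison function vanish on the ball. -/
theorem le_regPow (hR : 0 < R) {β : ℝ} (hβ : 0 ≤ β) {x : RN N} (hx : ‖x‖ ≤ R) :
    R ^ (-β) ≤ regPow R β x := by
  have h1 : R ^ (-β) = (R ^ 2) ^ (-β / 2) := by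
    rw [← Real.rpow_natCast, ← Real.rpow_mul hR.le]
    congr 1
    push_cast
    ring
  rw [h1, regPow]
  exact Real.rpow_le_rpow_of_nonpos (regSq_pos hR _)
    (regSq_le hR (pow_le_pow_left₀ (norm_nonneg _) hx 2)) (by linarith)

theorem fderiv_regPow (hR : 0 < R) (β : ℝ) {x : RN N} (hx : R < ‖x‖) (y : RN N) :
    fderiv ℝ (regPow R β) x y = -β * ‖x‖ ^ (-β - 2) * inner ℝ x y := by
  have hx0 : 0 < ‖x‖ := hR.trans hx
  have hev : (regPow R β : RN N → ℝ) =ᶠ[𝓝 x] fun y => (‖y‖ ^ 2) ^ (-β / 2) := by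
    filter_upwards [(isOpen_lt continuous_const continuous_norm).mem_nhds hx] with z hz
    rw [regPow, regSq_of_le hR (pow_le_pow_left₀ hR.le (le_of_lt hz) 2)]
  have h1 := (hasStrictFDerivAt_norm_sq x).hasFDerivAt
  have h2 := h1.rpow_const (p := -β / 2) (Or.inl (by positivity))
  rw [hev.fderiv_eq, h2.fderiv]
  have h3 : (‖x‖ ^ 2) ^ (-β / 2 - 1) = ‖x‖ ^ (-β - 2) := by
    rw [← Real.rpow_natCast, ← Real.rpow_mul hx0.le]
    congr 1
    push_cast
    ring
  simp only [smul_apply, innerSL_apply_apply, h3, smul_eq_mul, nsmul_eq_mul]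
  push_cast
  ring

/-- Testing the weak gradient with the field `g(x) x`. -/
theorem HasWeakGradient.integral_radial {w g : RN N → ℝ} {G : RN N → RN N}
    (hw : HasWeakGradient w G) (hg : ContDiff ℝ ∞ g) (hc : HasCompactSupport g) :
    ∫ x, w x * (N * g x + fderiv ℝ g x x) = -∫ x, g x * inner ℝ (G x) x := by
  set E : Fin N → RN N := fun i => EuclideanSpace.single i 1
  have hcoord : ∀ i : Fin N, ContDiff ℝ ∞ fun x : RN N => x i := fun i => by fun_prop
  -- The test functions are the components of the field g(x)x; summing over coordinates produces its
  -- divergence Ng + x·∇g.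
  have hφ : ∀ i, ContDiff ℝ ∞ fun x : RN N => g x * x i := fun i => hg.mul (hcoord i)
  have hφc : ∀ i, HasCompactSupport fun x : RN N => g x * x i := fun i => hc.mul_right
  have hfd : ∀ i (x : RN N), fderiv ℝ (fun x : RN N => g x * x i) x (E i)
      = g x + x i * fderiv ℝ g x (E i) := by
    intro i x
    have h1 : HasFDerivAt (fun x : RN N => x i)
        (EuclideanSpace.proj i : RN N →L[ℝ] ℝ) x :=
      (EuclideanSpace.proj i : RN N →L[ℝ] ℝ).hasFDerivAt
    have h2 := (hg.differentiable (by simp) x).hasFDerivAt.mul h1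
    have h3 : fderiv ℝ (fun x : RN N => g x * x i) x = _ := h2.fderiv
    rw [h3]
    simp [E]
  have hsum : ∀ x : RN N, ∑ i, x i • E i = x := fun x => by
    have := (EuclideanSpace.basisFun (Fin N) ℝ).sum_repr x
    simpa [E] using this
  have key : ∀ i, ∫ x, w x * fderiv ℝ (fun x : RN N => g x * x i) x (E i)
      = -∫ x, inner ℝ (G x) (E i) * (g x * x i) := fun i => hw.2.2 _ (hφ i) (hφc i) (E i)
  have h1 : ∫ x, w x * (N * g x + fderiv ℝ g x x)
      = ∑ i, ∫ x, w x * fderiv ℝ (fun x : RN N => g x * x i) x (E i) := by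
    rw [← integral_finsetSum _ fun i _ => hw.mul_fderiv_integrable (hφ i) (hφc i) (E i)]
    refine integral_congr_ae (ae_of_all _ fun x => ?_)
    simp only
    rw [← Finset.mul_sum]
    simp only [hfd]
    rw [Finset.sum_add_distrib]
    congr 2
    · simp
    · conv_lhs => rw [← hsum x]
      rw [map_sum, hsum x]
      simp
  have h2 : ∫ x, g x * inner ℝ (G x) x = ∑ i, ∫ x, inner ℝ (G x) (E i) * (g x * x i) := by
    rw [← integral_finsetSum _ fun i _ =>
      hw.inner_integrable (hφ i).continuous (hφc i) (E i)]
    refine integral_congr_ae (ae_of_all _ fun x => ?_)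
    simp only
    conv_lhs => rw [← hsum x]
    rw [inner_sum, hsum x, Finset.mul_sum]
    refine Finset.sum_congr rfl fun i _ => ?_
    rw [real_inner_smul_right]
    ring
  rw [h1, h2, Finset.sum_congr rfl fun i _ => key i, Finset.sum_neg_distrib]

/-- The field `-|x|^{-β} x` has nonnegative weak divergence outside a ball when `β ≤ N`. -/
theorem integral_radial_field_nonpos (hR : 0 < R) {β : ℝ} (hβ1 : 1 ≤ β) (hβN : β ≤ N)
    {w : RN N → ℝ} {G : RN N → RN N} (hw : HasWeakGradient w G) (hwi : Integrable w)
    (hGi : Integrable G) (hw0 : ∀ᵐ x, 0 ≤ w x) (hin : ∀ᵐ x, ‖x‖ ≤ R → w x = 0 ∧ G x = 0) :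
    ∫ x, ‖x‖ ^ (-β) * inner ℝ x (G x) ≤ 0 := by
  obtain ⟨D, hD0, hD⟩ := exists_cutoff N
  choose η h1 h2 h3 h4 h5 h6 h7 using fun n : ℕ => hD ((n : ℝ) + 1) (by positivity)
  set ψ : RN N → ℝ := regPow R β
  have hψ : ContDiff ℝ ∞ ψ := contDiff_regPow hR β
  have hψx : ∀ x : RN N, R < ‖x‖ → ψ x * ‖x‖ ≤ R ^ (1 - β) := fun x hx => by
    have hx0 : 0 < ‖x‖ := hR.trans hx
    simp only [ψ]
    rw [regPow_of_le hR β hx.le, ← Real.rpow_add_one hx0.ne', neg_add_eq_sub]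
    exact Real.rpow_le_rpow_of_nonpos hR hx.le (by linarith)
  have hKn : 0 ≤ R ^ (1 - β) := by positivity
  have lim : Tendsto (fun n => ∫ x, η n x * ψ x * inner ℝ (G x) x) atTop
      (𝓝 (∫ x, ‖x‖ ^ (-β) * inner ℝ x (G x))) := by
    refine tendsto_integral_of_dominated_convergence (fun x => R ^ (1 - β) * ‖G x‖) (fun n => ?_)
      (hGi.norm.const_mul _) (fun n => ?_) ?_
    · exact (((h1 n).continuous.mul hψ.continuous).aestronglyMeasurable).mul
        (hGi.aestronglyMeasurable.inner continuous_id.aestronglyMeasurable)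
    · filter_upwards [hin] with x hx
      rcases le_or_gt ‖x‖ R with hxR | hxR
      · rw [(hx hxR).2]; simp
      · rw [norm_mul, norm_mul, Real.norm_eq_abs, Real.norm_eq_abs, abs_of_nonneg (h3 n x).1,
          abs_of_nonneg (regPow_nonneg hR β x)]
        have i1 := norm_inner_le_norm (𝕜 := ℝ) (G x) x
        have i2 := hψx x hxR
        have i3 := regPow_nonneg hR β x
        calc η n x * regPow R β x * ‖inner ℝ (G x) x‖
            ≤ 1 * regPow R β x * (‖G x‖ * ‖x‖) := by
              gcongr
              exact (h3 n x).2
          _ = (ψ x * ‖x‖) * ‖G x‖ := by simp only [ψ]; ring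
          _ ≤ R ^ (1 - β) * ‖G x‖ := by gcongr
    · filter_upwards [hin] with x hx
      rcases le_or_gt ‖x‖ R with hxR | hxR
      · rw [(hx hxR).2]; simp
      · refine tendsto_const_nhds.congr' ?_
        filter_upwards [(tendsto_natCast_atTop_atTop (R := ℝ)).eventually_ge_atTop ‖x‖] with n hn
        rw [h4 n x (by linarith), one_mul, real_inner_comm]
        simp only [ψ]
        rw [regPow_of_le hR β hxR.le]
  -- This is the cutoff error: |∇η| ≤ D/(n+1) and |x|^{1-β} ≤ R^{1-β} outside the ball, where β ≥ 1
  -- is needed.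
  have lim0 : Tendsto (fun n : ℕ => R ^ (1 - β) * D * (∫ x, w x) * (1 / ((n : ℝ) + 1)))
      atTop (𝓝 0) := by
    simpa using tendsto_one_div_add_atTop_nhds_zero_nat.const_mul (R ^ (1 - β) * D * ∫ x, w x)
  refine le_of_tendsto_of_tendsto' lim lim0 fun n => ?_
  have hgc : ContDiff ℝ ∞ fun x => η n x * ψ x := (h1 n).mul hψ
  have key := hw.integral_radial hgc (h2 n).mul_right
  rw [← neg_neg (∫ x, η n x * ψ x * inner ℝ (G x) x), ← key, ← integral_neg]
  have e1 : R ^ (1 - β) * D * (∫ x, w x) * (1 / ((n : ℝ) + 1))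
      = ∫ x, R ^ (1 - β) * (D / ((n : ℝ) + 1)) * w x := by
    rw [integral_const_mul]; ring
  rw [e1]
  have hn : (0 : ℝ) < n + 1 := by positivity
  have i1 : Integrable fun x => w x * (N * (η n x * ψ x) + fderiv ℝ (fun x => η n x * ψ x) x x) := by
    have c1 : Continuous fun x => (N * (η n x * ψ x) + fderiv ℝ (fun x => η n x * ψ x) x x) :=
      (continuous_const.mul hgc.continuous).add
        ((hgc.continuous_fderiv (by simp)).clm_apply continuous_id)
    have c2 : HasCompactSupport fun x =>
        (N * (η n x * ψ x) + fderiv ℝ (fun x => η n x * ψ x) x x) := by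
      have c3 : HasCompactSupport fun x => η n x * ψ x := (h2 n).mul_right
      refine HasCompactSupport.add c3.mul_left ?_
      refine (c3.fderiv ℝ).mono fun x hx => ?_
      contrapose! hx
      rw [Function.notMem_support] at hx ⊢
      rw [hx]; simp
    simpa [mul_comm] using hw.1.integrable_smul_left_of_hasCompactSupport c1 c2
  refine integral_mono_ae i1.neg (hwi.const_mul _) ?_
  filter_upwards [hw0, hin] with x hx0 hx
  rcases le_or_gt ‖x‖ R with hxR | hxR
  · rw [(hx hxR).1]; simp
  · have hxpos : 0 < ‖x‖ := hR.trans hxR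
    have hd : fderiv ℝ (fun x => η n x * ψ x) x x
        = -β * (η n x * ψ x) + ψ x * fderiv ℝ (η n) x x := by
      rw [fderiv_fun_mul ((h1 n).differentiable (by simp) x) (hψ.differentiable (by simp) x)]
      simp only [add_apply, smul_apply, smul_eq_mul]
      simp only [ψ]
      rw [fderiv_regPow hR β hxR, regPow_of_le hR β hxR.le, real_inner_self_eq_norm_sq,
        Real.rpow_sub hxpos, Real.rpow_two]
      field_simp
    have hη : |fderiv ℝ (η n) x x| ≤ D / (n + 1) * ‖x‖ :=
      ((fderiv ℝ (η n) x).le_opNorm x).trans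
        (mul_le_mul_of_nonneg_right (h5 n x) (norm_nonneg _))
    have hψ0 : 0 ≤ ψ x := regPow_nonneg hR β x
    -- The divergence of |x|^{-β}x is (N - β)|x|^{-β}; its sign is the whole content of the
    -- inequality.
    have j1 : 0 ≤ (N - β) * (η n x * ψ x) :=
      mul_nonneg (by linarith) (mul_nonneg (h3 n x).1 hψ0)
    have j2 : -(ψ x * fderiv ℝ (η n) x x) ≤ R ^ (1 - β) * (D / (n + 1)) := by
      have k1 := neg_le_abs (fderiv ℝ (η n) x x)
      have k2 := mul_le_mul_of_nonneg_left (k1.trans hη) hψ0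
      have k3 := mul_le_mul_of_nonneg_left (hψx x hxR) (by positivity : 0 ≤ D / ((n : ℝ) + 1))
      linarith
    rw [hd]
    have j3 : -(N * (η n x * ψ x) + (-β * (η n x * ψ x) + ψ x * fderiv ℝ (η n) x x))
        ≤ R ^ (1 - β) * (D / (n + 1)) := by linarith
    have := mul_le_mul_of_nonneg_right j3 hx0
    linarith

end Radial

/-! ### The barrier and the comparison principle. -/

section Decay

variable {p q θ τ R M : ℝ} {f : ℝ → ℝ} {a b : RN N → ℝ} {u : RN N → ℝ}

/-- The decay rate `(N - p) / (p - 1)` of the fundamental solution of the `p`-Laplacian. -/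
def decayRate (N : ℕ) (p : ℝ) : ℝ := (N - p) / (p - 1)

/-- The barrier `M (R / |x|)^α`, smoothly extended to the ball of radius `R`. -/
def barrier (p R M : ℝ) (x : RN N) : ℝ :=
  M * R ^ decayRate N p * regPow R (decayRate N p) x

theorem decayRate_pos (hp : 1 < p) (hpN : p < N) : 0 < decayRate N p :=
  div_pos (by linarith) (by linarith)

theorem contDiff_barrier (hR : 0 < R) : ContDiff ℝ ∞ (barrier p R M : RN N → ℝ) :=
  contDiff_const.mul (contDiff_regPow hR _)

theorem barrier_nonneg (hR : 0 < R) (hM : 0 < M) (x : RN N) : 0 ≤ barrier p R M x :=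
  mul_nonneg (by positivity) (regPow_nonneg hR _ _)

theorem le_barrier (hp : 1 < p) (hpN : p < N) (hR : 0 < R) (hM : 0 < M) {x : RN N}
    (hx : ‖x‖ ≤ R) : M ≤ barrier p R M x := by
  have h1 := le_regPow hR (decayRate_pos hp hpN).le hx
  have h2 : M = M * R ^ decayRate N p * R ^ (-decayRate N p) := by
    rw [mul_assoc, ← Real.rpow_add hR]; simp
  rw [barrier]
  nth_rewrite 1 [h2]
  exact mul_le_mul_of_nonneg_left h1 (by positivity)

theorem barrier_of_le (hR : 0 < R) {x : RN N} (hx : R ≤ ‖x‖) :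
    barrier p R M x = M * (R ^ decayRate N p / ‖x‖ ^ decayRate N p) := by
  rw [barrier, regPow_of_le hR _ hx, Real.rpow_neg (norm_nonneg _)]
  ring

theorem gradient_barrier (hR : 0 < R) {x : RN N} (hx : R < ‖x‖) :
    gradient (barrier p R M) x = (-(M * R ^ decayRate N p * decayRate N p)
      * ‖x‖ ^ (-decayRate N p - 2)) • x := by
  have hd := (contDiff_regPow (N := N) hR (decayRate N p)).differentiable (by simp) x
  refine ext_inner_right ℝ fun y => ?_
  rw [gradient, InnerProductSpace.toDual_symm_apply, real_inner_smul_left]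
  have : fderiv ℝ (barrier p R M) x
      = (M * R ^ decayRate N p) • fderiv ℝ (regPow R (decayRate N p)) x :=
    fderiv_const_mul hd _
  rw [this, smul_apply, fderiv_regPow hR _ hx, smul_eq_mul]
  ring

theorem norm_gradient_barrier (hp : 1 < p) (hpN : p < N) (hR : 0 < R) (hM : 0 < M) {x : RN N}
    (hx : R < ‖x‖) : ‖gradient (barrier p R M) x‖
      = M * R ^ decayRate N p * decayRate N p * ‖x‖ ^ (-decayRate N p - 1) := by
  have hx0 : 0 < ‖x‖ := hR.trans hx
  have hα := decayRate_pos hp hpN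
  rw [gradient_barrier hR hx, norm_smul, Real.norm_eq_abs, neg_mul, abs_neg,
    abs_of_pos (by positivity), mul_assoc, ← Real.rpow_add_one hx0.ne']
  congr 2; ring

theorem laplace_field_barrier (hp : 1 < p) (hpN : p < N) (hR : 0 < R) (hM : 0 < M) (m : ℝ)
    {x : RN N} (hx : R < ‖x‖) (y : RN N) :
    ‖gradient (barrier p R M) x‖ ^ (m - 2) * inner ℝ (gradient (barrier p R M) x) y
      = -(M * R ^ decayRate N p * decayRate N p) ^ (m - 1) *
        (‖x‖ ^ (-((decayRate N p + 1) * (m - 1) + 1)) * inner ℝ x y) := by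
  have hx0 : 0 < ‖x‖ := hR.trans hx
  have hα := decayRate_pos hp hpN
  rw [norm_gradient_barrier hp hpN hR hM hx, gradient_barrier hR hx, real_inner_smul_left]
  set c := M * R ^ decayRate N p * decayRate N p
  have hc : 0 < c := by positivity
  have e1 : c ^ (m - 1) = c ^ (m - 2) * c := by
    rw [← Real.rpow_add_one hc.ne']; congr 1; ring
  have e2 : ‖x‖ ^ (-((decayRate N p + 1) * (m - 1) + 1))
      = ‖x‖ ^ ((-decayRate N p - 1) * (m - 2)) * ‖x‖ ^ (-decayRate N p - 2) := by
    rw [← Real.rpow_add hx0]; congr 1; ring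
  rw [Real.mul_rpow hc.le (by positivity), ← Real.rpow_mul hx0.le, e1, e2]
  ring

/-- The barrier is a weak supersolution for the `m`-Laplacian, `2 ≤ m ≤ p`, outside the ball. -/
theorem barrier_supersolution {m : ℝ} (hm : 2 ≤ m) (hmp : m ≤ p) (hpN : p < N) (hR : 0 < R)
    (hM : 0 < M) {w : RN N → ℝ} {G : RN N → RN N} (hw : HasWeakGradient w G)
    (hwi : Integrable w) (hGi : Integrable G) (hw0 : ∀ᵐ x, 0 ≤ w x)
    (hin : ∀ᵐ x, ‖x‖ ≤ R → w x = 0 ∧ G x = 0) :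
    0 ≤ ∫ x, ‖gradient (barrier p R M) x‖ ^ (m - 2) * inner ℝ (gradient (barrier p R M) x) (G x) := by
  have hp1 : 1 < p := by linarith
  have hα := decayRate_pos hp1 hpN
  -- The field |∇B|^{m-2}∇B of the barrier B is a negative multiple of |x|^{-β}x with β =
  -- (α+1)(m-1)+1. The choice of α gives β = N for m = p, and smaller m lowers β; this is where q ≤
  -- p enters.
  have hβN : (decayRate N p + 1) * (m - 1) + 1 ≤ N := by
    have h1 : (decayRate N p + 1) * (p - 1) = N - 1 := by
      rw [decayRate]
      have : p - 1 ≠ 0 := by linarith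
      field_simp
      ring
    have h2 : (decayRate N p + 1) * (m - 1) ≤ (decayRate N p + 1) * (p - 1) :=
      mul_le_mul_of_nonneg_left (by linarith) (by linarith)
    linarith
  have hβ1 : 1 ≤ (decayRate N p + 1) * (m - 1) + 1 := by
    have : 0 ≤ (decayRate N p + 1) * (m - 1) := mul_nonneg (by linarith) (by linarith)
    linarith
  have h := integral_radial_field_nonpos hR hβ1 hβN hw hwi hGi hw0 hin
  have e : ∫ x, ‖gradient (barrier p R M) x‖ ^ (m - 2)
      * inner ℝ (gradient (barrier p R M) x) (G x)
      = ∫ x, -(M * R ^ decayRate N p * decayRate N p) ^ (m - 1) *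
        (‖x‖ ^ (-((decayRate N p + 1) * (m - 1) + 1)) * inner ℝ x (G x)) := by
    refine integral_congr_ae ?_
    filter_upwards [hin] with x hx
    rcases le_or_gt ‖x‖ R with hxR | hxR
    · rw [(hx hxR).2]; simp
    · exact laplace_field_barrier hp1 hpN hR hM m hxR _
  rw [e, integral_const_mul, neg_mul]
  have : 0 ≤ (M * R ^ decayRate N p * decayRate N p) ^ (m - 1) := by positivity
  nlinarith

/-- Comparison with the barrier, up to `ε`. -/
theorem le_barrier_add (hq : 2 ≤ q) (hqp : q ≤ p) (hpN : p < N)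
    (hf : NonlinearityHyp N p θ τ f) (hac : Continuous a) (hbc : Continuous b)
    (ha : ∀ x, 0 ≤ a x) (hb : ∀ x, 0 ≤ b x) (hu : u ∈ spaceE p q a b) (hpos : ∀ᵐ x, 0 < u x)
    (hcrit : ∀ v ∈ spaceE p q a b, derivJ p q θ R f a b u v = 0) (hR : 0 < R) (hM : 0 < M)
    (huM : ∀ᵐ x, u x ≤ M) {ε : ℝ} (hε : 0 < ε) : ∀ᵐ x, u x ≤ barrier p R M x + ε := by
  have hp : 2 ≤ p := hq.trans hqp
  have hp0 : 0 < p := by linarith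
  have hp1 : 1 < p := by linarith
  have hα := decayRate_pos hp1 hpN
  set s := critExp N p
  have hs0 : 0 < s := critExp_pos hp0 hpN
  have hs1 : 1 < s := by linarith [lt_critExp hp0 hpN]
  set B : RN N → ℝ := barrier p R M
  have hB : ContDiff ℝ ∞ B := contDiff_barrier hR
  set g : RN N → ℝ := fun x => B x + ε
  have hg : ContDiff ℝ 1 g := (hB.of_le (by simp)).add contDiff_const
  have hg0 : ∀ x, 0 ≤ g x := fun x => add_nonneg (barrier_nonneg hR hM x) hε.le
  have hgB : ∀ x, gradient g x = gradient B x := fun x => by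
    simp only [gradient, g, fderiv_add_const]
  set L := M * R ^ decayRate N p * decayRate N p * R ^ (-decayRate N p - 1)
  have hL : 0 ≤ L := by positivity
  have hBL : ∀ x : RN N, R < ‖x‖ → ‖gradient B x‖ ≤ L := fun x hx => by
    rw [norm_gradient_barrier hp1 hpN hR hM hx]
    exact mul_le_mul_of_nonneg_left (Real.rpow_le_rpow_of_nonpos hR hx.le (by linarith))
      (by positivity)
  -- Inside the ball the barrier is at least M ≥ u, so the contact set lies outside; the shift by ε
  -- forces u > ε on it.
  have hout : ∀ᵐ x, g x < u x → R < ‖x‖ ∧ ε < u x := by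
    filter_upwards [huM] with x hx hgu
    refine ⟨?_, ?_⟩
    · by_contra hc
      have := le_barrier hp1 hpN hR hM (not_lt.1 hc)
      simp only [g, B] at hgu
      linarith
    · have := barrier_nonneg (p := p) hR hM x
      simp only [g, B] at hgu
      linarith
  have ius := memLp_integrable_rpow hs0 hu.1.1
  -- A Chebyshev bound: as u is in L^{p*}, the contact set has finite measure. This makes w and G
  -- integrable, although ∇B itself need not be in L^q.
  have hone : ∀ x, ε < u x → 1 ≤ ε ^ (-s) * |u x| ^ s := fun x hx => by
    rw [Real.rpow_neg hε.le, ← div_eq_inv_mul, one_le_div (by positivity)]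
    exact Real.rpow_le_rpow hε.le (hx.le.trans (le_abs_self _)) hs0.le
  have hcst : ∀ x, 0 ≤ ε ^ (-s) * |u x| ^ s := fun x => by positivity
  have hindm := aestronglyMeasurable_indicator_lt hu.1.1.1 hg.continuous
  have hBgc : Continuous (gradient B) :=
    (InnerProductSpace.toDual ℝ (RN N)).symm.continuous.comp (hB.continuous_fderiv (by simp))
  have hBm : ∀ m : ℝ, 0 < m →
      MemLp (fun x => (if g x < u x then (1 : ℝ) else 0) • gradient B x) (ENNReal.ofReal m) := by
    intro m hm
    have hmeas : AEStronglyMeasurable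
        (fun x => (if g x < u x then (1 : ℝ) else 0) • gradient B x) volume :=
      hindm.smul hBgc.aestronglyMeasurable
    rw [← integrable_norm_rpow_iff hmeas (by simpa using hm) ENNReal.ofReal_ne_top,
      ENNReal.toReal_ofReal hm.le]
    refine (ius.const_mul (L ^ m * ε ^ (-s))).mono'
      ((hmeas.norm.aemeasurable.pow_const m).aestronglyMeasurable) ?_
    filter_upwards [hout] with x hx
    rw [Real.norm_eq_abs, abs_of_nonneg (by positivity)]
    split_ifs with h
    · rw [one_smul, mul_assoc]
      have h1 := Real.rpow_le_rpow (norm_nonneg _) (hBL x (hx h).1) hm.le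
      exact h1.trans (le_mul_of_one_le_right (by positivity) (hone x (hx h).2))
    · rw [zero_smul, norm_zero, Real.zero_rpow hm.ne']
      positivity
  have hGL : ∀ m : ℝ, 0 < m → MemD m u → MemLp (fun x => (if g x < u x then (1 : ℝ) else 0) •
      (weakGrad u x - gradient g x)) (ENNReal.ofReal m) := fun m hm hmu => by
    simp only [hgB, smul_sub]
    exact (memLp_indicator_smul hmu.memLp_weakGrad hu.1.1.1 hg.continuous).sub (hBm m hm)
  have hGp := hGL p hp0 hu.1
  have hGq := hGL q (by linarith) hu.2.1
  have hwE := truncation_mem_spaceE (by linarith) hp0 hac hbc ha hb hu hg hg0 hGp hGq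
  have hw := hasWeakGradient_truncation hu.1.hasWeakGradient hg
  have hgw := hw.weakGrad_ae_eq
  simp only [hgB] at hGp hGq hw hgw
  set G : RN N → RN N := fun x => (if g x < u x then (1 : ℝ) else 0) •
      (weakGrad u x - gradient B x)
  set w : RN N → ℝ := fun x => max (u x - g x) 0
  have hGzero : ∀ x, ¬ g x < u x → G x = 0 := fun x hx => by simp [G, hx]
  have hwzero : ∀ x, ¬ g x < u x → w x = 0 := fun x hx => by
    simp only [w]
    exact max_eq_right (by linarith [not_lt.1 hx])
  have hGeq : ∀ x, g x < u x → G x = weakGrad u x - gradient B x := fun x hx => by simp [G, hx]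
  have hw0 : ∀ x, 0 ≤ w x := fun x => le_max_right _ _
  have hwu : ∀ᵐ x, w x ≤ u x := by
    filter_upwards [hpos] with x hx
    exact max_le (by linarith [hg0 x]) hx.le
  have hwi : Integrable w := by
    refine (ius.const_mul (ε ^ (1 - s))).mono' hw.1.aestronglyMeasurable ?_
    filter_upwards [hout, hwu] with x hx hwux
    rw [Real.norm_eq_abs, abs_of_nonneg (hw0 x)]
    by_cases h : g x < u x
    · have hux : 0 < u x := hε.trans (hx h).2
      refine hwux.trans ?_
      rw [Real.norm_eq_abs, abs_of_pos hux]
      have h1 : u x = u x ^ (1 - s) * u x ^ s := by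
        rw [← Real.rpow_add hux]; simp
      nth_rewrite 1 [h1]
      exact mul_le_mul_of_nonneg_right
        (Real.rpow_le_rpow_of_nonpos hε (hx h).2.le (by linarith)) (by positivity)
    · rw [hwzero x h]
      positivity
  have hGi : Integrable G := by
    refine ((memLp_integrable_rpow hp0 hGp).add (ius.const_mul (ε ^ (-s)))).mono' hGp.1 ?_
    filter_upwards [hout] with x hx
    simp only [Pi.add_apply]
    by_cases h : g x < u x
    · have h1 := hone x (hx h).2
      rw [Real.norm_eq_abs (u x)]
      rcases le_total ‖G x‖ 1 with h2 | h2
      · have : 0 ≤ ‖G x‖ ^ p := by positivity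
        linarith
      · have := Real.rpow_le_rpow_of_exponent_le h2 hp1.le
        rw [Real.rpow_one] at this
        linarith
    · rw [hGzero x h, norm_zero, Real.zero_rpow hp0.ne', Real.norm_eq_abs]
      have := hcst x
      linarith
  have hin : ∀ᵐ x, ‖x‖ ≤ R → w x = 0 ∧ G x = 0 := by
    filter_upwards [hout] with x hx hxR
    have : ¬ g x < u x := fun h => absurd (hx h).1 (not_lt.2 hxR)
    exact ⟨hwzero x this, hGzero x this⟩
  have iu : ∀ m : ℝ, 2 ≤ m → MemD m u → MemLp G (ENNReal.ofReal m) → Integrable fun x =>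
      ‖weakGrad u x‖ ^ (m - 2) * inner ℝ (weakGrad u x) (G x) := fun m hm hmu hGm => by
    have hm0 : 0 < m := by linarith
    refine ((memLp_integrable_rpow hm0 hmu.memLp_weakGrad).add
      (memLp_integrable_rpow hm0 hGm)).mono' ?_
      (ae_of_all _ fun x => abs_norm_rpow_mul_inner_le hm _ _)
    exact (hmu.memLp_weakGrad.1.norm.aemeasurable.pow_const _).aestronglyMeasurable.mul
      (hmu.memLp_weakGrad.1.inner hGm.1)
  have iB : ∀ m : ℝ, 2 ≤ m → Integrable fun x =>
      ‖gradient B x‖ ^ (m - 2) * inner ℝ (gradient B x) (G x) := fun m hm => by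
    refine (hGi.norm.const_mul (L ^ (m - 1))).mono' ?_ ?_
    · exact (hBgc.norm.measurable.pow_const _).aestronglyMeasurable.mul
        (hBgc.aestronglyMeasurable.inner hGi.1)
    · filter_upwards [hin] with x hx
      rcases le_or_gt ‖x‖ R with hxR | hxR
      · rw [(hx hxR).2]; simp
      · rw [norm_mul, Real.norm_eq_abs, abs_of_nonneg (by positivity)]
        have h1 := hBL x hxR
        have h2 : L ^ (m - 1) = L ^ (m - 2) * L := by
          rw [← Real.rpow_add_one' hL (by linarith)]; congr 1; ring
        rw [h2, mul_assoc]
        refine mul_le_mul (Real.rpow_le_rpow (norm_nonneg _) h1 (by linarith))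
          ((norm_inner_le_norm _ _).trans (mul_le_mul_of_nonneg_right h1 (norm_nonneg _)))
          (norm_nonneg _) (by positivity)
  have hnn : ∀ m : ℝ, 2 ≤ m → ∀ x, 0 ≤ ‖weakGrad u x‖ ^ (m - 2) * inner ℝ (weakGrad u x) (G x)
      - ‖gradient B x‖ ^ (m - 2) * inner ℝ (gradient B x) (G x) := fun m hm x => by
    by_cases h : g x < u x
    · rw [hGeq x h]
      exact inner_rpow_sub_nonneg hm _ _
    · rw [hGzero x h]; simp
  have hsub := hcrit w hwE
  have e1 : ∀ m : ℝ, ∫ x, ‖weakGrad u x‖ ^ (m - 2) * inner ℝ (weakGrad u x) (weakGrad w x)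
      = ∫ x, ‖weakGrad u x‖ ^ (m - 2) * inner ℝ (weakGrad u x) (G x) := fun m => by
    refine integral_congr_ae ?_
    filter_upwards [hgw] with x hx
    rw [hx]
  rw [derivJ, e1, e1] at hsub
  have e2 : 0 ≤ ∫ x, b x * (|u x| ^ (q - 2) * u x * w x) := by
    refine integral_nonneg_of_ae ?_
    filter_upwards [hpos] with x hx
    exact mul_nonneg (hb x) (mul_nonneg (mul_nonneg (by positivity) hx.le) (hw0 x))
  -- The test function lives outside the ball, where g(x,u) ≤ (a/k)u^{p-1} ≤ a u^{p-1}.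
  have e3 : ∫ x, penal p θ R f a x (u x) * w x ≤ ∫ x, a x * (|u x| ^ (p - 2) * u x * w x) := by
    refine integral_mono_of_nonneg ?_ ?_ ?_
    · filter_upwards [hpos] with x hx
      exact mul_nonneg (penal_nonneg hf hp ha x hx.le) (hw0 x)
    · refine hu.2.2.1.mono' ?_ ?_
      · exact hac.aestronglyMeasurable.mul
          (((continuous_abs_rpow_mul hp).comp_aestronglyMeasurable hu.1.1.1).mul
            hw.1.aestronglyMeasurable)
      · filter_upwards [hpos, hwu] with x hx hwx
        have h1 : 0 ≤ |u x| ^ (p - 2) * u x := mul_nonneg (by positivity) hx.le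
        rw [Real.norm_eq_abs, abs_of_nonneg (mul_nonneg (ha x) (mul_nonneg h1 (hw0 x))),
          ← abs_rpow_mul_self hp]
        exact mul_le_mul_of_nonneg_left (mul_le_mul_of_nonneg_left hwx h1) (ha x)
    · filter_upwards [hpos, hin] with x hx hxin
      rcases le_or_gt ‖x‖ R with hxR | hxR
      · rw [(hxin hxR).1]; simp
      · rw [penal_of_lt_norm hxR, ← mul_assoc (a x)]
        refine mul_le_mul_of_nonneg_right ((min_le_right _ _).trans ?_) (hw0 x)
        exact mul_le_mul_of_nonneg_right (div_le_self (ha x) (hf.one_le_theta_div hp))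
          (mul_nonneg (by positivity) hx.le)
  have e4 := barrier_supersolution hp le_rfl hpN hR hM hw hwi hGi (ae_of_all _ hw0) hin
  have e5 := barrier_supersolution hq hqp hpN hR hM hw hwi hGi (ae_of_all _ hw0) hin
  have e6 : 0 ≤ ∫ x, (‖weakGrad u x‖ ^ (q - 2) * inner ℝ (weakGrad u x) (G x)
      - ‖gradient B x‖ ^ (q - 2) * inner ℝ (gradient B x) (G x)) := integral_nonneg (hnn q hq)
  have e7 : 0 ≤ ∫ x, (‖weakGrad u x‖ ^ (p - 2) * inner ℝ (weakGrad u x) (G x)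
      - ‖gradient B x‖ ^ (p - 2) * inner ℝ (gradient B x) (G x)) := integral_nonneg (hnn p hp)
  have e8 := integral_sub (iu p hp hu.1 hGp) (iB p hp)
  have e9 := integral_sub (iu q hq hu.2.1 hGq) (iB q hq)
  -- Subtracting the barrier inequalities `e4`, `e5` from the equation shows that the p- and
  -- q-monotonicity integrals have sum at most 0. Both are nonnegative, so the p-integral vanishes.
  have e10 : ∫ x, (‖weakGrad u x‖ ^ (p - 2) * inner ℝ (weakGrad u x) (G x)
      - ‖gradient B x‖ ^ (p - 2) * inner ℝ (gradient B x) (G x)) = 0 := by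
    rw [e9] at e6
    refine le_antisymm ?_ e7
    rw [e8]
    linarith
  rw [integral_eq_zero_iff_of_nonneg (hnn p hp) ((iu p hp hu.1 hGp).sub (iB p hp))] at e10
  have hG0 : ∀ᵐ x, G x = 0 := by
    filter_upwards [e10] with x hx
    by_cases h : g x < u x
    · simp only [Pi.zero_apply] at hx
      rw [hGeq x h] at hx ⊢
      rw [eq_of_inner_rpow_sub_eq_zero hp hx, sub_self]
    · exact hGzero x h
  -- Strict monotonicity gave G = 0; as w belongs to D^{1,p}, the Sobolev inequality rules out a
  -- nonzero constant and gives w = 0.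
  obtain ⟨S, -, hsob⟩ := sobolev (N := N) hp1.le hpN
  have h1 := hsob w G hw hwE.1.1 hGp
  have h2 : ∫ x, ‖G x‖ ^ p = 0 := by
    refine integral_eq_zero_of_ae ?_
    filter_upwards [hG0] with x hx
    simp [hx, Real.zero_rpow hp0.ne']
  rw [h2, Real.zero_rpow (div_pos hs0 hp0).ne', mul_zero] at h1
  have iws := memLp_integrable_rpow hs0 hwE.1.1
  simp only [Real.norm_eq_abs] at iws
  have h3 := le_antisymm h1 (integral_nonneg fun x => by positivity)
  rw [integral_eq_zero_iff_of_nonneg (fun x => by positivity) iws] at h3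
  filter_upwards [h3] with x hx
  simp only [Pi.zero_apply] at hx
  rw [Real.rpow_eq_zero (abs_nonneg _) hs0.ne', abs_eq_zero, max_eq_right_iff] at hx
  simp only [g] at hx
  linarith

/-- Letting ε run through 1/(n+1) keeps the exceptional null sets countable in number. -/
theorem le_decay (hq : 2 ≤ q) (hqp : q ≤ p) (hpN : p < N)
    (hf : NonlinearityHyp N p θ τ f) (hac : Continuous a) (hbc : Continuous b)
    (ha : ∀ x, 0 ≤ a x) (hb : ∀ x, 0 ≤ b x) (hu : u ∈ spaceE p q a b) (hpos : ∀ᵐ x, 0 < u x)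
    (hcrit : ∀ v ∈ spaceE p q a b, derivJ p q θ R f a b u v = 0) (hR : 0 < R) (hM : 0 < M)
    (huM : ∀ᵐ x, u x ≤ M) : ∀ᵐ x : RN N, R ≤ ‖x‖ →
      u x ≤ M * (R ^ ((N - p) / (p - 1)) / ‖x‖ ^ ((N - p) / (p - 1))) := by
  have h : ∀ᵐ x, ∀ n : ℕ, u x ≤ barrier p R M x + 1 / ((n : ℝ) + 1) :=
    ae_all_iff.2 fun n => le_barrier_add hq hqp hpN hf hac hbc ha hb hu hpos hcrit hR hM huM
      (by positivity)
  filter_upwards [h] with x hx hxR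
  have h1 : u x ≤ barrier p R M x := by
    have hlim := (tendsto_one_div_add_atTop_nhds_zero_nat (𝕜 := ℝ)).const_add (barrier p R M x)
    rw [add_zero] at hlim
    exact ge_of_tendsto' hlim hx
  rwa [barrier_of_le hR hxR] at h1

end Decay

end PQLaplace
end

/-! ### Assembly: the De Giorgi bound M serves for both conclusions. -/

theorem lemma3p4 (N : ℕ) (p q θ τ : ℝ) (hq : 2 ≤ q) (hqp : q ≤ p) (hpN : p < N)
    (f : ℝ → ℝ) (hf : PQLaplace.NonlinearityHyp N p θ τ f)
    (aInf bInf : ℝ) (haInf : 0 < aInf) (hbInf : 0 < bInf) :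
    ∃ M₂ : ℝ, 0 < M₂ ∧
      ∀ (a b : PQLaplace.RN N → ℝ) (Lam R₀ : ℝ),
        PQLaplace.PotentialHyp p q aInf bInf Lam R₀ a b →
      ∀ R : ℝ, 1 < R → R ≤ R₀ →
      ∀ X : Set (PQLaplace.RN N → ℝ),
        PQLaplace.spaceBall p q ⊆ X → X ⊆ PQLaplace.spaceE p q a b →
      ∀ e ∈ PQLaplace.spaceBall p q, PQLaplace.energyJ p q θ R f a b e < 0 →
      ∀ u : PQLaplace.RN N → ℝ, PQLaplace.IsPositiveGroundState p q θ R f a b X e u →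
        eLpNorm u ∞ volume ≤ ENNReal.ofReal M₂ ∧
        ∀ᵐ x : PQLaplace.RN N, R ≤ ‖x‖ →
          u x ≤ M₂ * (R ^ ((N - p) / (p - 1)) / ‖x‖ ^ ((N - p) / (p - 1))) := by
  obtain ⟨C₀, hC₀, hlevel⟩ := PQLaplace.exists_mpLevel_le hq hqp hpN hf haInf hbInf
  obtain ⟨M, hM, hsup⟩ := PQLaplace.exists_sup_bound hq hqp hpN hf hC₀
  refine ⟨M, hM, fun a b Lam R₀ hab R hR _ X hX hXE e he hJ u hu => ?_⟩
  have huM := hsup R a b u hab.continuous_a hab.continuous_b hab.nonneg_a hab.nonneg_b hu.mem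
    hu.pos hu.critical (hu.level.le.trans (hlevel a b Lam R₀ hab R hR X hX hXE e he hJ))
  refine ⟨?_, PQLaplace.le_decay hq hqp hpN hf hab.continuous_a hab.continuous_b hab.nonneg_a
    hab.nonneg_b hu.mem hu.pos hu.critical (by linarith) hM huM⟩
  rw [eLpNorm_exponent_top]
  refine eLpNormEssSup_le_of_ae_bound ?_
  filter_upwards [huM, hu.pos] with x h1 h2
  rwa [Real.norm_eq_abs, abs_of_pos h2]
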